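/- Let $n,m\ge 1$ be integers, $N=2^{n-1}$, $h=2^{n-1}m$, and let $k$ be a finite field of characteristic $2$ with ring of Witt vectors $W(k)$. For a symbol $x$ write $C_{2^n}\cdot x=\{x,\gamma x,\dots,\gamma^{N-1}x\}$, where the generator $\gamma$ of $C_{2^n}$ acts by $\gamma(\gamma^{r}x)=\gamma^{r+1}x$ for $r<N-1$ and $\gamma(\gamma^{N-1}x)=-x$. Let $\mathcal R_n=\mathbb Z_{(2)}[C_{2^n}\cdot t_1,C_{2^n}\cdot t_2,\dots]$ with this action (linear over $\mathbb Z_{(2)}$). There is a unique commutative $2$-typical formal group law $\mathcal F$ over $\mathcal R_n$ such that $\psi_\gamma(x)=x+_{\mathcal F^{\gamma}}\sum^{\mathcal F^{\gamma}}_{i\ge1}t_ix^{2^i}$ is a strict isomorphism $\mathcal F\to\mathcal F^{\gamma}$ (where $\mathcal F^\gamma$ is obtained by applying $\gamma$ to the coefficients) and such that the composite of the $N$ strict isomorphisms $(\gamma^{s})^*\psi_\gamma:\mathcal F^{\gamma^s}\to\mathcal F^{\gamma^{s+1}}$, $0\le s\le N-1$, is the (strict) formal inversion $-[-1]_{\mathcal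 F}(x)$. There are unique elements $v_i\in\mathcal R_n$ (the Araki elements) with $[2]_{\mathcal F}(x)=\sum^{\mathcal F}_{i\ge0}v_ix^{2^i}$. Let $A=W(k)[C_{2^n}\cdot t_1,\dots,C_{2^n}\cdot t_{m-1},C_{2^n}\cdot u^{\pm1}]$, graded by $|t_i|=2(2^i-1)$, $|u|=2$, with the $W(k)$-linear $\gamma$-action above, and let $\mathfrak m=(C_{2^n}\cdot t_1,\dots,C_{2^n}\cdot t_{m-1},C_{2^n}\cdot(u-\gamma u))\subset A$. Let $R(k,m)=A^{\wedge}_{\mathfrak m}$ be the graded completion, i.e. the graded ring whose component of degree $s$ is $\varprojlim_i A_s/I_0^iA_s$ with $I_0=\mathfrak m\cap A_0$; write $\mathfrak m$ also for the ideal of $R(k,m)$ generated by the same elements. Let $f:\mathcal R_n\to R(k,m)$ be the $\gamma$-equivariant ring homomorphism with $f(t_i)=t_i$ for $1\le i\le m-1$, $f(t_m)=u^{2^m-1}$, and $f(t_i)=0$ for $i>m$, and write $v_i$ also for $f(v_i)$. Then in $R(k,m)$ the ideal $\mathfrak m$ is the maximal ideal in the graded sense (it is a proper homogeneous ideal containing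 every proper homogeneous ideal), $$I_h:=(2,v_1,\dots,v_{h-1})=\mathfrak m ,$$ and $v_h$ is a unit. -/

import Mathlib

namespace RealLubinTate

noncomputable section

/-! ### Formal group laws -/

section FormalGroupLaws

variable {R : Type*} [CommRing R]

/-- A strict isomorphism `ψ : F → G` of formal group laws: `ψ(x) = x + ⋯` and
`ψ(F(x, y)) = G(ψ(x), ψ(y))`. -/
def IsStrictIso (F G : FormalGroup R) (ψ : PowerSeries R) : Prop :=
  PowerSeries.constantCoeff ψ = 0 ∧ PowerSeries.coeff 1 ψ = 1 ∧
    ψ.subst F.toPowerSeries =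
      G.toPowerSeries.subst
        ![ψ.subst (MvPowerSeries.X 0 : MvPowerSeries (Fin 2) R),
          ψ.subst (MvPowerSeries.X 1 : MvPowerSeries (Fin 2) R)]

/-- `ι` is the formal inversion `[-1]_F` of `F`, i.e. `F(x, ι(x)) = 0`. -/
def IsFormalInversion (F : FormalGroup R) (ι : PowerSeries R) : Prop :=
  PowerSeries.constantCoeff ι = 0 ∧
    F.toPowerSeries.subst ![(PowerSeries.X : PowerSeries R), ι] = 0

/-- The finite formal sum `g 0 +_F g 1 +_F ⋯ +_F g (M - 1)`. -/
def partialFormalSum (F : FormalGroup R) (g : ℕ → PowerSeries R) : ℕ → PowerSeries R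
  | 0 => 0
  | M + 1 => F.toPowerSeries.subst ![partialFormalSum F g M, g M]

/-- The infinite formal sum `∑^F_{i ≥ 0} c i * x ^ (2 ^ i)`. The coefficient of `x ^ d` is the same
in all partial sums of at least `d + 1` terms, because `x ^ (2 ^ i)` has order `2 ^ i > d` for
`i ≥ d + 1`. -/
def formalSum (F : FormalGroup R) (c : ℕ → R) : PowerSeries R :=
  PowerSeries.mk fun d => PowerSeries.coeff d
    (partialFormalSum F (fun i => PowerSeries.C (c i) * PowerSeries.X ^ (2 ^ i)) (d + 1))

/-- A formal group law over a torsion-free ring `R` is `2`-typical if over `ℚ ⊗ R` it has a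
logarithm (a strict isomorphism to the additive formal group law) of the form
`∑_{i ≥ 0} ℓ i * x ^ (2 ^ i)`. -/
def IsTwoTypical (F : FormalGroup R) : Prop :=
  ∃ L : PowerSeries (TensorProduct ℤ ℚ R),
    IsStrictIso
      (F.map (Algebra.TensorProduct.includeRight : R →ₐ[ℤ] TensorProduct ℤ ℚ R).toRingHom)
      FormalGroup.𝔾ₐ L ∧
    ∀ d : ℕ, (¬ ∃ i : ℕ, d = 2 ^ i) → PowerSeries.coeff d L = 0

/-- `v` is the sequence of Araki elements of `F`: `[2]_F(x) = ∑^F_{i ≥ 0} v i * x ^ (2 ^ i)`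
(which forces `v 0 = 2`). -/
def IsArakiSequence (F : FormalGroup R) (v : ℕ → R) : Prop :=
  F.toPowerSeries.subst ![(PowerSeries.X : PowerSeries R), PowerSeries.X] = formalSum F v

/-- For an endomorphism `γ` of `R` and a series `ψ`, the composite
`(γ^(s-1))^*ψ ∘ ⋯ ∘ γ^*ψ ∘ ψ` of `s` conjugates of `ψ`. -/
def iterateConj (γ : R →+* R) (ψ : PowerSeries R) : ℕ → PowerSeries R
  | 0 => PowerSeries.X
  | s + 1 => PowerSeries.subst (iterateConj γ ψ s) (PowerSeries.map (γ ^ s) ψ)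

end FormalGroupLaws

/-! ### The `C_{2^n}`-ring `𝓡_n = ℤ_(2)[C_{2^n} · t_1, C_{2^n} · t_2, …]` -/

instance isPrime_span_two : (Ideal.span {(2 : ℤ)}).IsPrime :=
  (Ideal.span_singleton_prime two_ne_zero).2 Int.prime_two

/-- The ring `ℤ_(2)`. -/
abbrev ZLocTwo : Type := Localization.AtPrime (Ideal.span {(2 : ℤ)})

/-- The ring `𝓡_n`. The variable with index `(i, r)` is `γ^r t_{i+1}`, where `0 ≤ r < 2^(n-1)`. -/
abbrev RRing (n : ℕ) : Type := MvPolynomial (ℕ × Fin (2 ^ (n - 1))) ZLocTwo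

/-- Given the orbit `x, γ x, …, γ^(2^(n-1)-1) x` of an element with `γ^(2^(n-1)) x = -x`, stored as
`orb`, this is `γ (γ^r x)`. -/
def gammaOrbit {B : Type*} [Neg B] (n : ℕ) (orb : Fin (2 ^ (n - 1)) → B)
    (r : Fin (2 ^ (n - 1))) : B :=
  if h : r.1 + 1 < 2 ^ (n - 1) then orb ⟨r.1 + 1, h⟩ else -orb ⟨0, by positivity⟩

/-- The action of the generator `γ` of `C_{2^n}` on `𝓡_n`. -/
def gammaR (n : ℕ) : RRing n →+* RRing n :=
  (MvPolynomial.aeval fun x : ℕ × Fin (2 ^ (n - 1)) =>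
    gammaOrbit n (fun r => (MvPolynomial.X (x.1, r) : RRing n)) x.2 :
      RRing n →ₐ[ZLocTwo] RRing n).toRingHom

/-- The elements `t_i = t_i^{C_{2^n}}` of `𝓡_n` for `i ≥ 0`, with the convention `t_0 = 1`. -/
def tR (n : ℕ) : ℕ → RRing n
  | 0 => 1
  | i + 1 => MvPolynomial.X (i, ⟨0, by positivity⟩)

/-- For a formal group law `F` over `𝓡_n`, the series
`ψ_γ(x) = x +_{F^γ} ∑^{F^γ}_{i ≥ 1} t_i x^(2^i)`, where `F^γ` is `F` with `γ` applied to its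
coefficients. -/
def psiGamma (n : ℕ) (F : FormalGroup (RRing n)) : PowerSeries (RRing n) :=
  formalSum (F.map (gammaR n)) (tR n)

/-- `F` is the canonical formal group law over `𝓡_n` (with respect to the generators `t_i`):
it is a commutative `2`-typical formal group law, `ψ_γ` is a strict isomorphism `F → F^γ`, and the
composite of the `2^(n-1)` strict isomorphisms
`F → F^γ → F^(γ^2) → ⋯ → F^(γ^(2^(n-1)))`, `(γ^s)^*ψ_γ`, is the formal inversion of `F`, normalized
to be strict: it equals `-[-1]_F(x)`. -/
structure IsCanonicalFormalGroup (n : ℕ) (F : FormalGroup (RRing n)) : Prop where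
  comm : F.IsComm
  twoTypical : IsTwoTypical F
  strictIso : IsStrictIso F (F.map (gammaR n)) (psiGamma n F)
  inversion : IsFormalInversion F (-(iterateConj (gammaR n) (psiGamma n F) (2 ^ (n - 1))))

/-! ### Completion of graded rings -/

section GradedCompletion

variable {S A : Type*} [CommRing S] [CommRing A] [Algebra S A]

/-- The ideal of `A` generated by `I_0 = I ∩ A_0`. -/
def zeroPartIdeal (𝒜 : ℤ → Submodule S A) (I : Ideal A) : Ideal A :=
  Ideal.span ((I : Set A) ∩ (𝒜 0 : Set A))

/-- The subgroup `lim_i A_s / I_0^i A_s` of `lim_i A / I_0^i A` (note that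
`A_s ∩ I_0^i A = I_0^i A_s`): compatible families all of whose members are represented by
homogeneous elements of degree `s`. -/
def completedPiece (𝒜 : ℤ → Submodule S A) (I : Ideal A) (s : ℤ) :
    Set (AdicCompletion (zeroPartIdeal 𝒜 I) A) :=
  {x | ∀ i : ℕ, ∃ a ∈ 𝒜 s,
    AdicCompletion.evalₐ (zeroPartIdeal 𝒜 I) i x = Ideal.Quotient.mk (zeroPartIdeal 𝒜 I ^ i) a}

/-- The completion `A^∧_I` of a graded ring `A` at a homogeneous ideal `I` in the graded sense:
the graded ring whose component of degree `s` is `lim_i A_s / I_0^i A_s`, realized as the subring of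
`lim_i A / I_0^i A` generated by (equivalently, consisting of the finite sums of elements of) these
components. -/
def gradedCompletion (𝒜 : ℤ → Submodule S A) [GradedAlgebra 𝒜] (I : Ideal A) :
    Subring (AdicCompletion (zeroPartIdeal 𝒜 I) A) :=
  Subring.closure (⋃ s : ℤ, completedPiece 𝒜 I s)

theorem algebraMap_mem_gradedCompletion (𝒜 : ℤ → Submodule S A) [GradedAlgebra 𝒜] (I : Ideal A)
    (a : A) :
    algebraMap A (AdicCompletion (zeroPartIdeal 𝒜 I) A) a ∈ gradedCompletion 𝒜 I := by
  classical
  rw [← DirectSum.sum_support_decompose 𝒜 a, map_sum]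
  refine Subring.sum_mem _ fun s _ => Subring.subset_closure (Set.mem_iUnion.2 ⟨s, fun i => ?_⟩)
  exact ⟨_, SetLike.coe_mem _, AdicCompletion.evalₐ_of _ i _⟩

/-- The canonical map `A → A^∧_I`. -/
def toGradedCompletion (𝒜 : ℤ → Submodule S A) [GradedAlgebra 𝒜] (I : Ideal A) :
    A →+* gradedCompletion 𝒜 I :=
  (algebraMap A (AdicCompletion (zeroPartIdeal 𝒜 I) A)).codRestrict _
    (algebraMap_mem_gradedCompletion 𝒜 I)

/-- An ideal of the graded ring `A^∧_I` is homogeneous if it is generated by homogeneous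
elements. -/
def IsHomogeneousIdeal (𝒜 : ℤ → Submodule S A) [GradedAlgebra 𝒜] (I : Ideal A)
    (𝔞 : Ideal (gradedCompletion 𝒜 I)) : Prop :=
  ∃ T : Set (gradedCompletion 𝒜 I),
    (∀ x ∈ T, ∃ s : ℤ, (x : AdicCompletion (zeroPartIdeal 𝒜 I) A) ∈ completedPiece 𝒜 I s) ∧
      Ideal.span T = 𝔞

end GradedCompletion

/-! ### The ring `R(k, m)` -/

section Rkm

/-- Exponents of monomials in the variables `γ^r t_{i+1}` (index `(i, r)`, `i + 1 ≤ m - 1`,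
exponents in `ℕ`) and `γ^r u` (index `r`, exponents in `ℤ`), where `0 ≤ r < 2^(n-1)`. -/
abbrev Expo (n m : ℕ) : Type :=
  (Fin (m - 1) × Fin (2 ^ (n - 1)) →₀ ℕ) × (Fin (2 ^ (n - 1)) →₀ ℤ)

variable (k : Type*) [Field k] [CharP k 2] (n m : ℕ)

/-- The ring `W(k)[C_{2^n} · t_1, …, C_{2^n} · t_{m-1}, C_{2^n} · u^{±1}]`. -/
abbrev ARing : Type _ := AddMonoidAlgebra (WittVector 2 k) (Expo n m)

/-- The degree of a monomial: `|t_i| = 2 (2^i - 1)` and `|u| = 2`. -/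
def expoDegree : Expo n m →+ ℤ :=
  AddMonoidHom.coprod
    (Finsupp.liftAddHom fun x : Fin (m - 1) × Fin (2 ^ (n - 1)) =>
      AddMonoidHom.comp (AddMonoidHom.mulLeft (2 * (2 ^ (x.1.1 + 1) - 1) : ℤ))
        (Nat.castAddMonoidHom ℤ))
    (Finsupp.liftAddHom fun _ : Fin (2 ^ (n - 1)) => AddMonoidHom.mulLeft (2 : ℤ))

/-- The grading of `ARing k n m`. -/
abbrev gradA : ℤ → Submodule (WittVector 2 k) (ARing k n m) :=
  AddMonoidAlgebra.gradeBy (WittVector 2 k) (expoDegree n m)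

/-- The variable `γ^r t_{i+1}`. -/
def tA (i : Fin (m - 1)) (r : Fin (2 ^ (n - 1))) : ARing k n m :=
  AddMonoidAlgebra.single (Finsupp.single (i, r) 1, 0) 1

/-- The invertible variable `γ^r u`. -/
def uA (r : Fin (2 ^ (n - 1))) : (ARing k n m)ˣ where
  val := AddMonoidAlgebra.single (0, Finsupp.single r 1) 1
  inv := AddMonoidAlgebra.single (0, Finsupp.single r (-1)) 1
  val_inv := by
    rw [AddMonoidAlgebra.single_mul_single, AddMonoidAlgebra.one_def]
    simp [← Prod.mk_zero_zero]
  inv_val := by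
    rw [AddMonoidAlgebra.single_mul_single, AddMonoidAlgebra.one_def]
    simp [← Prod.mk_zero_zero]

/-- The `W(k)`-linear action of the generator `γ` of `C_{2^n}`:
`γ (γ^r x) = γ^(r+1) x` for `r < 2^(n-1) - 1` and `γ (γ^(2^(n-1)-1) x) = -x`, for `x = t_i, u`. -/
def gammaA : ARing k n m →+* ARing k n m :=
  (AddMonoidAlgebra.lift (WittVector 2 k) (ARing k n m) (Expo n m)
    { toFun := fun e =>
        (e.toAdd.1.prod fun x c => gammaOrbit n (tA k n m x.1) x.2 ^ c) *
          ((∏ r, gammaOrbit n (uA k n m) r ^ (e.toAdd.2 r) : (ARing k n m)ˣ) : ARing k n m)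
      map_one' := by simp
      map_mul' := fun e e' => by
        simp only [toAdd_mul, Prod.fst_add, Prod.snd_add, Finsupp.add_apply, zpow_add,
          Finset.prod_mul_distrib, Units.val_mul]
        rw [Finsupp.prod_add_index' (by simp) (fun _ _ _ => pow_add _ _ _)]
        ring }).toRingHom

/-- The element `t_{i+1}`. -/
abbrev tA₀ (i : Fin (m - 1)) : ARing k n m := tA k n m i ⟨0, by positivity⟩

/-- The element `u`. -/
abbrev uA₀ : ARing k n m := (uA k n m ⟨0, by positivity⟩ : ARing k n m)

/-- The ideal `𝔪 = (C_{2^n} · t_1, …, C_{2^n} · t_{m-1}, C_{2^n} · (u - γ u))` before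
completion. -/
def maxA : Ideal (ARing k n m) :=
  Ideal.span
    ({x | ∃ (i : Fin (m - 1)) (r : ℕ), r < 2 ^ (n - 1) ∧ x = (gammaA k n m ^ r) (tA₀ k n m i)} ∪
      {x | ∃ r : ℕ, r < 2 ^ (n - 1) ∧
        x = (gammaA k n m ^ r) (uA₀ k n m - gammaA k n m (uA₀ k n m))})

/-- The ring `R(k, m) = W(k)[C_{2^n} · t_1, …, C_{2^n} · t_{m-1}, C_{2^n} · u^{±1}]^∧_𝔪`. -/
abbrev Rkm : Type _ := gradedCompletion (gradA k n m) (maxA k n m)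

/-- The ideal `𝔪` of `R(k, m)`, generated by the images of the generators of `maxA`. -/
def maxR : Ideal (Rkm k n m) :=
  (maxA k n m).map (toGradedCompletion (gradA k n m) (maxA k n m))

theorem isUnit_intCast_witt (y : (Ideal.span {(2 : ℤ)}).primeCompl) :
    IsUnit (Int.castRingHom (WittVector 2 k) y) := by
  apply WittVector.isUnit_of_coeff_zero_ne_zero
  have h : ((Int.castRingHom (WittVector 2 k) y : WittVector 2 k)).coeff 0 = ((y : ℤ) : k) := by
    rw [← WittVector.constantCoeff_apply, ← RingHom.comp_apply, eq_intCast]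
  rw [h, Ne, CharP.intCast_eq_zero_iff k 2]
  intro hy
  exact y.2 (Ideal.mem_span_singleton.2 (by exact_mod_cast hy))

/-- The ring homomorphism `ℤ_(2) → W(k)`. -/
def zLocToWitt : ZLocTwo →+* WittVector 2 k :=
  IsLocalization.lift (M := (Ideal.span {(2 : ℤ)}).primeCompl) (isUnit_intCast_witt k)

/-- The image of `t_{i+1} ∈ 𝓡_n`: it is `t_{i+1}` if `i + 1 < m`, `u^(2^m - 1)` if `i + 1 = m`, and
`0` if `i + 1 > m`. -/
def imageOfT (i : ℕ) : ARing k n m :=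
  if h : i < m - 1 then tA₀ k n m ⟨i, h⟩
  else if i + 1 = m then uA₀ k n m ^ (2 ^ m - 1)
  else 0

/-- The `C_{2^n}`-equivariant ring homomorphism `f : 𝓡_n → R(k, m)`, `γ^r t_i ↦ γ^r f(t_i)`. -/
def mapF : RRing n →+* Rkm k n m :=
  (toGradedCompletion (gradA k n m) (maxA k n m)).comp
    (MvPolynomial.eval₂Hom ((algebraMap (WittVector 2 k) (ARing k n m)).comp (zLocToWitt k))
      fun x : ℕ × Fin (2 ^ (n - 1)) => (gammaA k n m ^ x.2.1) (imageOfT k n m x.1))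

/-- The ideal `I_h = (2, v_1, …, v_{h-1})` of `R(k, m)`, where `v_i` also denotes its image under
`f`. -/
def idealI (v : ℕ → RRing n) (h : ℕ) : Ideal (Rkm k n m) :=
  Ideal.span ({2} ∪ {x | ∃ i : ℕ, 1 ≤ i ∧ i < h ∧ x = mapF k n m (v i)})

end Rkm

end

end RealLubinTate

/-!
The proof is elementary: everything is computed with the coefficients `ℓ_k` of the logarithm
`∑ ℓ_k x^(2^k)` of `𝓕` over `ℚ ⊗ 𝓡_n`. Put `N = 2^(n-1)` and `t_0 = 1`, and let `σ` be the
lift of the Frobenius that squares all variables. A sequence such as `ℓ` is regarded as a twisted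
power series `∑ ℓ_k φ^k`, where `φ a = σ(a) φ` (`TwistedSeries`).

*The logarithm.* The series `ψ_γ` is a strict isomorphism `𝓕 → 𝓕^γ` if and only if
`ℓ = γ(ℓ) T_0` with `T_0 = ∑ t_i φ^i`, and the condition on the composite of its conjugates means
that `γ^N` maps `ℓ_k` to `-ℓ_k` for `k > 0` (`isCanonicalFormalGroup_iff`). Summing
`ℓ_k - γ(ℓ_k)` over the orbit expresses `2 ℓ_k` by the lower coefficients, so there is exactly one
such `ℓ` (`IsCanonicalLog`). With `T_s = γ^s(T_0)` and `T = T_(N-1) ⋯ T_1 T_0` one gets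
`ℓ = γ^N(ℓ) T = (2 - ℓ) T`, that is, the functional equation `(1 + T⁻¹) ℓ = 2`, in which `T` has
coefficients in `𝓡_n` (`IsCanonicalLog.exists_functionalEquation`).

*Integrality.* As in Hazewinkel's functional equation lemma, `(1 + T⁻¹) ℓ = 2` implies that the
formal group law with logarithm `ℓ` is defined over `𝓡_n`
(`FunctionalEquation.exists_formalGroup`) and that the Araki elements exist, with
`v_k ≡ c_k` modulo `2, c_1, …, c_(k-1)`, where `T = ∑ c_k φ^k` (`exists_araki_congr`). In particular
`I_h` is generated by `2` and the images of `c_1, …, c_(h-1)`, and it remains to study `T` over `A`.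

*Reduction modulo `𝔪`.* The ideal `𝔪` contains `2`, and modulo `𝔪` all `T_s` become
`P = 1 + w φ^m` with the unit `w = u^(2^m-1)`. Hence `T` becomes `P^N`, which is `1` up to degree
`N m = h`, where its coefficient is a unit. So `I_h ⊆ 𝔪`, and `v_h` is a unit modulo `𝔪`
(`imageT_reduction`).

*Reduction modulo `I_h + 𝔪²`.* Here `T_s = P + E_s` with coefficients of `E_s` in `𝔪`. As these have
square zero and `σ` becomes the Frobenius, `φ E_s = 0`, so `T = P^N + ∑ E_s P^s`. The vanishing of
the coefficients of `T` in degrees `0 < k < h` says that certain polynomials `∑ e_s (1 + y)^s`, with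
`s < N` and `e_s` the coefficient of `E_s` in a fixed degree `i ≤ m`, vanish, except that the
coefficient of `y^(N-1)` is not known to vanish for `i = m`. In that degree `e_0 = 0`, so all `E_s`
vanish (`eq_of_reduction_eq_zero`). Therefore `𝔪 = I_h + 𝔪²` (`maxA_le_sup`).

*Completion.* Nakayama's lemma in `Â = lim A / 𝔪^i` gives `I_h Â = 𝔪 Â`, and `v_h` is a unit
of `Â`. The graded completion `R(k, m)` is a subring of `Â`. The endomorphism of `A` that sends an
element `a` of degree `2d` to `a u^(-d)` extends to a homomorphism `Â → R(k, m)` that fixes the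
elements of degree `0`, so the two statements descend to `R(k, m)`
(`idealI_eq_maxR_and_isUnit`). Finally, the part of degree `0` of `A / 𝔪` is the field `k`, hence
a homogeneous element of `R(k, m)` outside of `𝔪` is a unit (`isGreatest_maxR`).
-/

namespace RealLubinTate

noncomputable section

/-! ### Twisted power series -/

section Twisted

variable {R S : Type*} [CommRing R] [CommRing S]

/-- The ring of twisted power series `∑ a_i φ^i` over `R`, where `φ a = σ(a) φ`. An element is
encoded by its sequence of coefficients. -/
@[ext]
structure TwistedSeries (σ : R →+* R) where
  /-- The coefficient of `φ^i`. -/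
  coeff : ℕ → R

open Finset

/-- Reassociation of a sum over the triples with sum `k`. -/
lemma sum_antidiagonal_assoc {M : Type*} [AddCommMonoid M] (f : ℕ → ℕ → ℕ → M) (k : ℕ) :
    ∑ p ∈ antidiagonal k, ∑ q ∈ antidiagonal p.1, f q.1 q.2 p.2 =
      ∑ p ∈ antidiagonal k, ∑ q ∈ antidiagonal p.2, f p.1 q.1 q.2 := by
  rw [Finset.sum_sigma', Finset.sum_sigma']
  refine sum_nbij' (fun x => ⟨(x.2.1, x.2.2 + x.1.2), (x.2.2, x.1.2)⟩)
    (fun x => ⟨(x.1.1 + x.2.1, x.2.2), (x.1.1, x.2.1)⟩) ?_ ?_ ?_ ?_ ?_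
  · rintro ⟨⟨i, j⟩, ⟨p, q⟩⟩ h
    simp only [mem_sigma, HasAntidiagonal.mem_antidiagonal] at h ⊢
    exact ⟨by omega, trivial⟩
  · rintro ⟨⟨i, j⟩, ⟨p, q⟩⟩ h
    simp only [mem_sigma, HasAntidiagonal.mem_antidiagonal] at h ⊢
    exact ⟨by omega, trivial⟩
  · rintro ⟨⟨i, j⟩, ⟨p, q⟩⟩ h
    simp only [mem_sigma, HasAntidiagonal.mem_antidiagonal] at h ⊢
    obtain ⟨h1, rfl⟩ := h
    rfl
  · rintro ⟨⟨i, j⟩, ⟨p, q⟩⟩ h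
    simp only [mem_sigma, HasAntidiagonal.mem_antidiagonal] at h ⊢
    obtain ⟨h1, rfl⟩ := h
    rfl
  · rintro ⟨⟨i, j⟩, ⟨p, q⟩⟩ _
    rfl

namespace TwistedSeries

variable {σ : R →+* R}

instance : Zero (TwistedSeries σ) := ⟨⟨fun _ => 0⟩⟩
instance : One (TwistedSeries σ) := ⟨⟨fun k => if k = 0 then 1 else 0⟩⟩
instance : Add (TwistedSeries σ) := ⟨fun a b => ⟨fun k => a.coeff k + b.coeff k⟩⟩
instance : Neg (TwistedSeries σ) := ⟨fun a => ⟨fun k => -a.coeff k⟩⟩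
instance : Sub (TwistedSeries σ) := ⟨fun a b => ⟨fun k => a.coeff k - b.coeff k⟩⟩
instance : SMul ℕ (TwistedSeries σ) := ⟨fun n a => ⟨fun k => n • a.coeff k⟩⟩
instance : SMul ℤ (TwistedSeries σ) := ⟨fun n a => ⟨fun k => n • a.coeff k⟩⟩
instance : Mul (TwistedSeries σ) :=
  ⟨fun a b => ⟨fun k => ∑ p ∈ antidiagonal k, a.coeff p.1 * (σ ^ p.1) (b.coeff p.2)⟩⟩

@[simp] lemma coeff_zero (k : ℕ) : (0 : TwistedSeries σ).coeff k = 0 := rfl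
lemma coeff_one (k : ℕ) : (1 : TwistedSeries σ).coeff k = if k = 0 then 1 else 0 := rfl
@[simp] lemma coeff_one_zero : (1 : TwistedSeries σ).coeff 0 = 1 := rfl
@[simp] lemma coeff_add (a b : TwistedSeries σ) (k : ℕ) :
    (a + b).coeff k = a.coeff k + b.coeff k := rfl
@[simp] lemma coeff_sub (a b : TwistedSeries σ) (k : ℕ) :
    (a - b).coeff k = a.coeff k - b.coeff k := rfl
lemma coeff_mul (a b : TwistedSeries σ) (k : ℕ) :
    (a * b).coeff k = ∑ p ∈ antidiagonal k, a.coeff p.1 * (σ ^ p.1) (b.coeff p.2) := rfl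

lemma coeff_injective : Function.Injective (coeff : TwistedSeries σ → ℕ → R) :=
  fun _ _ h => TwistedSeries.ext h

instance : AddCommGroup (TwistedSeries σ) :=
  coeff_injective.addCommGroup _ rfl (fun _ _ => rfl) (fun _ => rfl) (fun _ _ => rfl)
    (fun _ _ => rfl) (fun _ _ => rfl)

instance : Ring (TwistedSeries σ) where
  left_distrib a b c := by
    ext k
    simp only [coeff_mul, coeff_add, map_add, mul_add, sum_add_distrib]
  right_distrib a b c := by
    ext k
    simp only [coeff_mul, coeff_add, add_mul, sum_add_distrib]
  zero_mul a := by ext k; simp [coeff_mul]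
  mul_zero a := by ext k; simp [coeff_mul]
  one_mul a := by
    ext k
    rw [coeff_mul, sum_eq_single (0, k)]
    · simp
    · rintro ⟨i, j⟩ h hne
      have : i ≠ 0 := by
        rintro rfl
        simp at h
        simp [h] at hne
      simp [coeff_one, this]
    · simp
  mul_one a := by
    ext k
    rw [coeff_mul, sum_eq_single (k, 0)]
    · simp
    · rintro ⟨i, j⟩ h hne
      have : j ≠ 0 := by
        rintro rfl
        simp at h
        simp [h] at hne
      simp [coeff_one, this]
    · simp
  mul_assoc a b c := by
    ext k
    simp only [coeff_mul, map_sum, map_mul, sum_mul, mul_sum]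
    rw [← sum_antidiagonal_assoc (fun i j l => a.coeff i * ((σ ^ i) (b.coeff j) *
      (σ ^ i) ((σ ^ j) (c.coeff l))))]
    refine sum_congr rfl fun p _ => sum_congr rfl fun q hq => ?_
    rw [← HasAntidiagonal.mem_antidiagonal.1 hq, pow_add, RingHom.mul_def, RingHom.comp_apply,
      mul_assoc]
  zsmul := (· • ·)
  zsmul_zero' a := zero_smul ℤ a
  zsmul_succ' n a := SubNegMonoid.zsmul_succ' n a
  zsmul_neg' n a := SubNegMonoid.zsmul_neg' n a
  nsmul := (· • ·)
  nsmul_zero a := AddMonoid.nsmul_zero a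
  nsmul_succ n a := AddMonoid.nsmul_succ n a
  neg_add_cancel := neg_add_cancel
  sub_eq_add_neg := sub_eq_add_neg

lemma coeff_mul_zero (a b : TwistedSeries σ) : (a * b).coeff 0 = a.coeff 0 * b.coeff 0 := by
  simp [coeff_mul]

lemma coeff_two (k : ℕ) : (2 : TwistedSeries σ).coeff k = if k = 0 then 2 else 0 := by
  rw [← one_add_one_eq_two, coeff_add, coeff_one]
  split_ifs <;> norm_num

lemma coeff_two_mul (a : TwistedSeries σ) (k : ℕ) : (2 * a).coeff k = 2 * a.coeff k := by
  rw [two_mul, coeff_add, two_mul]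

/-- A ring homomorphism compatible with the twists acts on coefficients. -/
def map {τ : S →+* S} (f : R →+* S) (hf : ∀ a, f (σ a) = τ (f a)) :
    TwistedSeries σ →+* TwistedSeries τ where
  toFun a := ⟨fun k => f (a.coeff k)⟩
  map_zero' := by ext; simp
  map_one' := by ext k; simp only [coeff_one]; split_ifs <;> simp
  map_add' a b := by ext; simp
  map_mul' a b := by
    have h : ∀ i a, f ((σ ^ i) a) = (τ ^ i) (f a) := by
      intro i
      induction i with
      | zero => intro a; rfl
      | succ i ih => intro a; simp only [pow_succ', RingHom.mul_def, RingHom.comp_apply, hf, ih]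
    ext k
    simp only [coeff_mul, map_sum, map_mul, h]

@[simp] lemma coeff_map {τ : S →+* S} (f : R →+* S) (hf : ∀ a, f (σ a) = τ (f a))
    (a : TwistedSeries σ) (k : ℕ) : (map f hf a).coeff k = f (a.coeff k) := rfl

/-- The coefficients of a right inverse of a twisted power series with constant term `1`. -/
def invCoeff (a : TwistedSeries σ) : ℕ → R
  | 0 => 1
  | k + 1 => -∑ p : Fin (k + 1), a.coeff (k + 1 - p) * (σ ^ (k + 1 - p.1)) (invCoeff a p)

lemma exists_mul_eq_one (a : TwistedSeries σ) (ha : a.coeff 0 = 1) :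
    ∃ b : TwistedSeries σ, b.coeff 0 = 1 ∧ a * b = 1 := by
  refine ⟨⟨invCoeff a⟩, by simp [invCoeff], ?_⟩
  ext k
  cases k with
  | zero => simp [coeff_mul, ha, invCoeff]
  | succ k =>
    rw [coeff_mul, ← Finset.Nat.sum_antidiagonal_swap,
      Finset.Nat.sum_antidiagonal_eq_sum_range_succ_mk, Finset.sum_range_succ]
    simp only [Prod.swap_prod_mk]
    rw [Nat.sub_self, ha, pow_zero, invCoeff, coeff_one, if_neg (by omega)]
    rw [Finset.sum_range]
    simp

lemma isUnit_of_coeff_zero (a : TwistedSeries σ) (ha : a.coeff 0 = 1) : IsUnit a := by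
  obtain ⟨b, hb, hab⟩ := exists_mul_eq_one a ha
  obtain ⟨c, -, hbc⟩ := exists_mul_eq_one b hb
  have hac : a = c := by rw [← mul_one a, ← hbc, ← mul_assoc, hab, one_mul]
  exact ⟨⟨a, b, hab, by rw [hac, hbc]⟩, rfl⟩

end TwistedSeries

end Twisted

/-! ### Functional equations for logarithms -/

section FunctionalEquation

open Finset

/-- A sequence `ℓ` in `K ⊇ R` satisfies the functional equation with coefficients `U` in `R`:
in the ring of twisted power series `(1 + U) ℓ = 2`, where `U = 1 + ⋯`, and the twist `σ` of `R` is
a lift of the Frobenius. -/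
structure FunctionalEquation {R K : Type*} [CommRing R] [CommRing K] (ι : R →+* K) (σ : R →+* R)
    (τ : K →+* K) (U : TwistedSeries σ) (ℓ : ℕ → K) : Prop where
  inj : Function.Injective ι
  comm : ∀ a, ι (σ a) = τ (ι a)
  frob : ∀ a, (2 : R) ∣ σ a - a ^ 2
  coeff_zero : U.coeff 0 = 1
  mul_eq : (1 + TwistedSeries.map ι comm U) * (⟨ℓ⟩ : TwistedSeries τ) = 2

variable {R K : Type*} [CommRing R] [CommRing K] {ι : R →+* K}
  {σ : R →+* R} {τ : K →+* K} {U : TwistedSeries σ} {ℓ : ℕ → K}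

/-- A congruence modulo `2` improves under iterated squaring. -/
lemma two_pow_dvd_pow_sub_pow {S : Type*} [CommRing S] {a b : S} (h : (2 : S) ∣ a - b) (j : ℕ) :
    (2 : S) ^ (j + 1) ∣ a ^ 2 ^ j - b ^ 2 ^ j := by
  induction j with
  | zero => simpa using h
  | succ j ih =>
    have h2 : (2 : S) ∣ a ^ 2 ^ j + b ^ 2 ^ j := by
      have : a ^ 2 ^ j + b ^ 2 ^ j = (a ^ 2 ^ j - b ^ 2 ^ j) + 2 * b ^ 2 ^ j := by ring
      rw [this]
      exact dvd_add ((dvd_pow_self _ (by omega)).trans ih) (dvd_mul_right _ _)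
    have : a ^ 2 ^ (j + 1) - b ^ 2 ^ (j + 1)
        = (a ^ 2 ^ j - b ^ 2 ^ j) * (a ^ 2 ^ j + b ^ 2 ^ j) := by ring
    rw [this, pow_succ]
    exact mul_dvd_mul ih h2

lemma two_dvd_iterate_sub_pow {S : Type*} [CommRing S] {σ : S →+* S}
    (h : ∀ a, (2 : S) ∣ σ a - a ^ 2) (i : ℕ) (a : S) : (2 : S) ∣ (σ ^ i) a - a ^ 2 ^ i := by
  induction i with
  | zero => simp
  | succ i ih =>
    have h1 := map_dvd σ ih
    rw [map_ofNat, map_sub, map_pow] at h1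
    have h2 : (2 : S) ∣ (σ a) ^ 2 ^ i - (a ^ 2) ^ 2 ^ i := (h a).trans (sub_dvd_pow_sub_pow _ _ _)
    have h3 : (σ ^ (i + 1)) a - a ^ 2 ^ (i + 1)
        = (σ ((σ ^ i) a) - (σ a) ^ 2 ^ i) + ((σ a) ^ 2 ^ i - (a ^ 2) ^ 2 ^ i) := by
      rw [pow_succ' σ, RingHom.mul_def, RingHom.comp_apply]
      ring
    rw [h3]
    exact dvd_add h1 h2

namespace FunctionalEquation

variable (H : FunctionalEquation ι σ τ U ℓ)

include H

lemma map_iterate (i : ℕ) (a : R) : ι ((σ ^ i) a) = (τ ^ i) (ι a) := by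
  induction i with
  | zero => rfl
  | succ i ih => simp only [pow_succ', RingHom.mul_def, RingHom.comp_apply, H.comm, ih]

lemma coeff_eq (k : ℕ) :
    ℓ k + ∑ p ∈ antidiagonal k, ι (U.coeff p.1) * (τ ^ p.1) (ℓ p.2) = if k = 0 then 2 else 0 := by
  have := congrArg (fun a => TwistedSeries.coeff a k) H.mul_eq
  simp only [TwistedSeries.coeff_two, add_mul, one_mul, TwistedSeries.coeff_add] at this
  simpa only [TwistedSeries.coeff_mul, TwistedSeries.coeff_map] using this

/-- The functional equation as a recursion. -/
lemma two_mul_log (k : ℕ) (hk : k ≠ 0) :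
    2 * ℓ k = -∑ p ∈ (antidiagonal k).erase (0, k), ι (U.coeff p.1) * (τ ^ p.1) (ℓ p.2) := by
  have := H.coeff_eq k
  rw [if_neg hk, ← add_sum_erase _ _ (show (0, k) ∈ antidiagonal k by simp)] at this
  simp only [H.coeff_zero, map_one, pow_zero, one_mul, RingHom.one_def, RingHom.id_apply] at this
  linear_combination this

variable [IsDomain K] [CharZero K]

lemma torsionFree {a b : R} (h : 2 * a = 2 * b) : a = b := by
  apply H.inj
  have := congrArg ι h
  rw [map_mul, map_mul, map_ofNat] at this
  exact mul_left_cancel₀ two_ne_zero this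

lemma log_zero : ℓ 0 = 1 := by
  have := H.coeff_eq 0
  simp only [Nat.antidiagonal_zero, sum_singleton, H.coeff_zero, map_one, pow_zero, if_true,
    one_mul, RingHom.one_def, RingHom.id_apply] at this
  rw [← two_mul] at this
  exact mul_left_cancel₀ two_ne_zero (by rw [this, mul_one])

/-- The coefficient `ℓ k` has denominator dividing `2 ^ k`. -/
lemma exists_two_pow_mul_log (k : ℕ) : ∃ c : R, ι c = 2 ^ k * ℓ k := by
  induction k using Nat.strong_induction_on with
  | _ k ih =>
    rcases Nat.eq_zero_or_pos k with rfl | hk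
    · exact ⟨1, by simp [H.log_zero]⟩
    · have : 2 ^ k * ℓ k ∈ ι.range := by
        obtain ⟨k, rfl⟩ : ∃ j, k = j + 1 := ⟨k - 1, by omega⟩
        rw [pow_succ, mul_assoc, H.two_mul_log _ hk.ne', mul_neg, mul_sum]
        refine neg_mem (sum_mem fun p hp => ?_)
        simp only [mem_erase, HasAntidiagonal.mem_antidiagonal] at hp
        have hp1 : p.1 ≠ 0 := fun h => hp.1 (Prod.ext h (by simp; omega))
        obtain ⟨c, hc⟩ := ih p.2 (by omega)
        refine ⟨U.coeff p.1 * (2 ^ (k - p.2) * (σ ^ p.1) c), ?_⟩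
        have hk' : k = (k - p.2) + p.2 := by omega
        rw [map_mul, map_mul, H.map_iterate, hc, map_mul (τ ^ p.1), map_pow, map_pow,
          map_ofNat, map_ofNat]
        conv_rhs => rw [hk', pow_add]
        ring
      obtain ⟨c, hc⟩ := this
      exact ⟨c, hc⟩

/-- The twisted power series `(1 + U) ∑ ℓ_j b^(2^j) φ^j` is twice a series with coefficients `d_j`
in `R`. Here `d_0 = b`, and `d_j` is `U_j (σ^j(b) - b^(2^j)) / 2` modulo `U_1, …, U_(j-1)`. -/
lemma exists_curve_coeff (b : R) (j : ℕ) : ∃ d : R,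
    ι (2 * d) = ℓ j * ι b ^ 2 ^ j +
      ∑ p ∈ antidiagonal j, ι (U.coeff p.1) * (τ ^ p.1) (ℓ p.2 * ι b ^ 2 ^ p.2) ∧
    (j = 0 → d = b) ∧
    ∀ e, 0 < j → 2 * e = (σ ^ j) b - b ^ 2 ^ j →
      d - U.coeff j * e ∈ Ideal.span (U.coeff '' (Set.Ico 1 j)) := by
  -- Up to multiples of the functional equation for `ℓ` itself, the summand for `(i, l)` is
  -- `U_i σ^i(ℓ_l) (σ^i(b)^(2^l) - b^(2^j))`, which is divisible by `2`.
  have key : ∀ p : ℕ × ℕ, ∃ e : R, p.1 + p.2 = j → (p.1 = 0 → e = 0) ∧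
      ι (2 * (U.coeff p.1 * e)) = ι (U.coeff p.1) * (τ ^ p.1) (ℓ p.2 * ι b ^ 2 ^ p.2)
        - ι b ^ 2 ^ j * (ι (U.coeff p.1) * (τ ^ p.1) (ℓ p.2)) ∧
      (p.2 = 0 → 2 * e = (σ ^ j) b - b ^ 2 ^ j) := by
    intro p
    obtain ⟨c, hc⟩ := H.exists_two_pow_mul_log p.2
    obtain ⟨f, hf⟩ := two_pow_dvd_pow_sub_pow (two_dvd_iterate_sub_pow H.frob p.1 b) p.2
    by_cases hp : p.1 + p.2 = j
    swap
    · exact ⟨0, fun h => absurd h hp⟩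
    subst hp
    have hf' := congrArg ι hf
    rw [map_sub, map_pow, H.map_iterate, map_pow ι, map_pow ι, map_mul, map_pow ι, map_ofNat,
      ← pow_mul, ← pow_add] at hf'
    have h1 : ι (2 * (U.coeff p.1 * ((σ ^ p.1) c * f))) =
        ι (U.coeff p.1) * (τ ^ p.1) (ℓ p.2 * ι b ^ 2 ^ p.2)
        - ι b ^ 2 ^ (p.1 + p.2) * (ι (U.coeff p.1) * (τ ^ p.1) (ℓ p.2)) := by
      have h2 : (τ ^ p.1) (ι c) = 2 ^ p.2 * (τ ^ p.1) (ℓ p.2) := by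
        rw [hc, map_mul, map_pow, map_ofNat]
      rw [map_mul, map_mul, map_mul, H.map_iterate, h2, map_ofNat, map_mul, map_pow]
      linear_combination (- ι (U.coeff p.1) * (τ ^ p.1) (ℓ p.2)) * hf'
    refine ⟨(σ ^ p.1) c * f, fun _ => ⟨fun h0 => ?_, h1, fun h0 => ?_⟩⟩
    · have : (2 : R) ^ (p.2 + 1) * f = 0 := by rw [← hf]; simp [h0]
      have hf0 : f = 0 := by
        apply H.inj
        have := congrArg ι this
        rw [map_mul, map_pow, map_ofNat, map_zero] at this
        rw [map_zero]
        exact (mul_eq_zero.1 this).resolve_left (pow_ne_zero _ two_ne_zero)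
      rw [hf0, mul_zero]
    · have hc1 : c = 1 := by
        apply H.inj
        rw [hc, h0, H.log_zero]; simp
      rw [hc1, map_one, one_mul]
      rw [h0] at hf ⊢
      simpa using hf.symm
  choose e he using key
  have hsum : ∀ j', j = j' → ι (2 * ((if j' = 0 then b else 0) +
      ∑ p ∈ antidiagonal j', U.coeff p.1 * e p)) = ℓ j * ι b ^ 2 ^ j +
      ∑ p ∈ antidiagonal j, ι (U.coeff p.1) * (τ ^ p.1) (ℓ p.2 * ι b ^ 2 ^ p.2) := by
    rintro j' rfl
    have h3 : ∑ p ∈ antidiagonal j, ι (2 * (U.coeff p.1 * e p)) =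
        ∑ p ∈ antidiagonal j, ι (U.coeff p.1) * (τ ^ p.1) (ℓ p.2 * ι b ^ 2 ^ p.2) -
        ι b ^ 2 ^ j * ∑ p ∈ antidiagonal j, ι (U.coeff p.1) * (τ ^ p.1) (ℓ p.2) := by
      rw [mul_sum, ← sum_sub_distrib]
      exact sum_congr rfl fun p hp => (he p (HasAntidiagonal.mem_antidiagonal.1 hp)).2.1
    have h4 := H.coeff_eq j
    rw [mul_add, mul_sum, map_add, map_sum, h3]
    split_ifs at h4 ⊢ with hj
    · subst hj
      simp only [pow_zero, pow_one, map_mul, map_ofNat] at *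
      linear_combination - ι b * h4
    · simp only [mul_zero, map_zero]
      linear_combination - ι b ^ 2 ^ j * h4
  refine ⟨_, hsum j rfl, fun hj => ?_, fun f hj hf => ?_⟩
  · subst hj
    have := (he (0, 0) rfl).1 rfl
    simp [this]
  · rw [if_neg hj.ne', zero_add, ← add_sum_erase _ _ (show (j, 0) ∈ antidiagonal j by simp)]
    have hef : e (j, 0) = f := H.torsionFree (by rw [(he (j, 0) rfl).2.2 rfl, hf])
    rw [hef, add_sub_cancel_left]
    refine sum_mem fun p hp => ?_
    simp only [mem_erase, HasAntidiagonal.mem_antidiagonal] at hp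
    by_cases hp1 : p.1 = 0
    · rw [(he p hp.2).1 hp1, mul_zero]
      exact zero_mem _
    · have hp2 : p.1 ≠ j := fun h => hp.1 (Prod.ext h (by simp; omega))
      exact Ideal.mul_mem_right _ _ (Ideal.subset_span ⟨p.1, ⟨by omega, by omega⟩, rfl⟩)

/-- The Araki relations `∑ ℓ_i v_j^(2^i) = 2 ℓ_k` hold for a sequence in `R`, congruent to `-U`
modulo `2` and lower terms. -/
lemma exists_araki : ∃ v : ℕ → R, v 0 = 2 ∧
    (∀ k, ∑ p ∈ antidiagonal k, ℓ p.1 * ι (v p.2) ^ 2 ^ p.1 = 2 * ℓ k) ∧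
    ∀ k, 0 < k → v k + U.coeff k ∈ Ideal.span ({2} ∪ U.coeff '' (Set.Ico 1 k)) := by
  choose D hD hD0 hDspan using H.exists_curve_coeff
  -- Multiplication of the relations by `(1 + U) / 2` turns them into `∑_{i + j = k} D(v_j)_i = 0`
  -- for `k > 0`, which can be solved recursively because `D(v_k)_0 = v_k`.
  let vrec : ∀ k : ℕ, (∀ i, i < k → R) → R := fun k f =>
    if k = 0 then 2 else -∑ i : Fin k, D (f i i.2) (k - i)
  let v : ℕ → R := fun k => Nat.strongRec (motive := fun _ => R) vrec k
  have hv : ∀ k, v k = if k = 0 then 2 else -∑ i : Fin k, D (v i) (k - i) := by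
    intro k
    change Nat.strongRec (motive := fun _ => R) vrec k = _
    rw [Nat.strongRec_eq]
  have hv0 : v 0 = 2 := by rw [hv]; simp
  have hsum : ∀ k, k ≠ 0 → ∑ p ∈ antidiagonal k, D (v p.2) p.1 = 0 := by
    intro k hk
    rw [← Nat.sum_antidiagonal_swap, Nat.sum_antidiagonal_eq_sum_range_succ_mk, sum_range_succ]
    simp only [Prod.swap_prod_mk, Nat.sub_self]
    rw [hD0 (v k) 0 rfl, hv k, if_neg hk, sum_range, add_neg_cancel]
  refine ⟨v, hv0, ?_, ?_⟩
  · have hunit : IsUnit (⟨ℓ⟩ : TwistedSeries τ) :=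
      TwistedSeries.isUnit_of_coeff_zero _ H.log_zero
    obtain ⟨L, hL⟩ := hunit
    set W : TwistedSeries τ := ⟨fun k => ∑ p ∈ antidiagonal k, ℓ p.1 * ι (v p.2) ^ 2 ^ p.1⟩
    -- The equation `W = 2 ℓ` follows by cancelling `1 + U = 2 ℓ⁻¹`.
    have hW : (1 + TwistedSeries.map ι H.comm U) * W = 2 * 2 := by
      ext k
      have h1 : ((1 + TwistedSeries.map ι H.comm U) * W).coeff k =
          ∑ p ∈ antidiagonal k, ι (2 * D (v p.2) p.1) := by
        simp only [hD, sum_add_distrib, add_mul, one_mul, TwistedSeries.coeff_add]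
        congr 1
        simp only [TwistedSeries.coeff_mul, TwistedSeries.coeff_map, W, map_sum, mul_sum]
        exact (sum_antidiagonal_assoc (fun a b c => ι (U.coeff a) *
          (τ ^ a) (ℓ b * ι (v c) ^ 2 ^ b)) k).symm
      rw [h1, TwistedSeries.coeff_two_mul, TwistedSeries.coeff_two, ← map_sum, ← mul_sum]
      split_ifs with hk
      · subst hk
        simp [hD0, hv0, map_ofNat]
      · rw [hsum k hk]; simp
    have h2 : (1 + TwistedSeries.map ι H.comm U) = 2 * (↑L⁻¹ : TwistedSeries τ) := by
      rw [← H.mul_eq, ← hL, mul_assoc, Units.mul_inv, mul_one]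
    have h3 : (2 : TwistedSeries τ) * ((↑L⁻¹ : TwistedSeries τ) * W) = 2 * 2 := by
      rw [← mul_assoc, ← h2, hW]
    have h4 : (↑L⁻¹ : TwistedSeries τ) * W = 2 := by
      ext k
      have := congrArg (fun a => TwistedSeries.coeff a k) h3
      simp only [TwistedSeries.coeff_two_mul] at this
      exact mul_left_cancel₀ two_ne_zero this
    have h5 : W = 2 * ⟨ℓ⟩ := by
      rw [← hL, two_mul, ← mul_two, ← h4, Units.mul_inv_cancel_left]
    intro k
    have := congrArg (fun a => TwistedSeries.coeff a k) h5
    simpa only [TwistedSeries.coeff_two_mul] using this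
  · intro k hk
    have hIle : Ideal.span (U.coeff '' (Set.Ico 1 k)) ≤
        Ideal.span ({2} ∪ U.coeff '' (Set.Ico 1 k)) := Ideal.span_mono Set.subset_union_right
    have h2mem : (2 : R) ∈ Ideal.span ({2} ∪ U.coeff '' (Set.Ico 1 k)) :=
      Ideal.subset_span (Or.inl rfl)
    -- The curve of the constant `2` contributes `U_k (2 - 2^(2^k)) / 2`.
    have hD2 : D 2 k - U.coeff k * (1 - 2 ^ (2 ^ k - 1)) ∈
        Ideal.span (U.coeff '' (Set.Ico 1 k)) := by
      refine hDspan 2 k _ hk ?_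
      have : 2 ^ k = (2 ^ k - 1) + 1 := by have := Nat.one_le_two_pow (n := k); omega
      rw [map_ofNat, mul_sub, mul_one]
      conv_rhs => rw [this, pow_succ']
    have hrest : ∀ i : ℕ, i < k → i ≠ 0 → D (v i) (k - i) ∈
        Ideal.span ({2} ∪ U.coeff '' (Set.Ico 1 k)) := by
      intro i hi hi0
      obtain ⟨e, he⟩ := two_dvd_iterate_sub_pow H.frob (k - i) (v i)
      have h := hDspan (v i) (k - i) e (by omega) he.symm
      have hmono : Ideal.span (U.coeff '' (Set.Ico 1 (k - i))) ≤
          Ideal.span ({2} ∪ U.coeff '' (Set.Ico 1 k)) :=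
        Ideal.span_mono (Set.subset_union_of_subset_right
          (Set.image_mono (Set.Ico_subset_Ico_right (Nat.sub_le _ _))) _)
      have hU : U.coeff (k - i) * e ∈ Ideal.span ({2} ∪ U.coeff '' (Set.Ico 1 k)) :=
        Ideal.mul_mem_right _ _ (Ideal.subset_span (Or.inr ⟨k - i, ⟨by omega, by omega⟩, rfl⟩))
      have := add_mem (hmono h) hU
      rwa [sub_add_cancel] at this
    obtain ⟨k, rfl⟩ : ∃ j, k = j + 1 := ⟨k - 1, by omega⟩
    have hvk : v (k + 1) = -(∑ i ∈ range k, D (v (i + 1)) (k + 1 - (i + 1)) + D 2 (k + 1)) := by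
      rw [hv, if_neg hk.ne', Fin.sum_univ_eq_sum_range (fun i => D (v i) (k + 1 - i)),
        sum_range_succ', hv0, Nat.sub_zero]
    have hpow : (2 : R) ∣ 2 ^ (2 ^ (k + 1) - 1) :=
      dvd_pow_self _ (by have := Nat.one_lt_two_pow (n := k + 1) (by omega); omega)
    obtain ⟨q, hq⟩ := hpow
    have : v (k + 1) + U.coeff (k + 1) = -∑ i ∈ range k, D (v (i + 1)) (k + 1 - (i + 1))
        - (D 2 (k + 1) - U.coeff (k + 1) * (1 - 2 ^ (2 ^ (k + 1) - 1)))
        + 2 * (U.coeff (k + 1) * q) := by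
      rw [hvk, hq]; ring
    rw [this]
    refine add_mem (sub_mem (neg_mem (sum_mem fun i hi => ?_)) (hIle hD2))
      (Ideal.mul_mem_right _ _ h2mem)
    exact hrest _ (by simpa using hi) (by omega)

/-- The Araki relations determine the sequence. -/
lemma araki_unique {v w : ℕ → R}
    (hv : ∀ k, ∑ p ∈ antidiagonal k, ℓ p.1 * ι (v p.2) ^ 2 ^ p.1 = 2 * ℓ k)
    (hw : ∀ k, ∑ p ∈ antidiagonal k, ℓ p.1 * ι (w p.2) ^ 2 ^ p.1 = 2 * ℓ k) : v = w := by
  funext k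
  induction k using Nat.strong_induction_on with
  | _ k ih =>
    have h := (hv k).trans (hw k).symm
    rw [← add_sum_erase _ _ (show (0, k) ∈ antidiagonal k by simp),
      ← add_sum_erase _ _ (show (0, k) ∈ antidiagonal k by simp)] at h
    have h2 : ∑ p ∈ (antidiagonal k).erase (0, k), ℓ p.1 * ι (v p.2) ^ 2 ^ p.1 =
        ∑ p ∈ (antidiagonal k).erase (0, k), ℓ p.1 * ι (w p.2) ^ 2 ^ p.1 := by
      refine sum_congr rfl fun p hp => ?_
      simp only [mem_erase, HasAntidiagonal.mem_antidiagonal] at hp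
      have hp1 : p.1 ≠ 0 := fun h => hp.1 (Prod.ext h (by simp; omega))
      rw [ih p.2 (by omega)]
    rw [h2] at h
    have h3 := add_right_cancel h
    simp only [H.log_zero, pow_zero, pow_one, one_mul] at h3
    exact H.inj h3

end FunctionalEquation

/-- Two sequences generate the same ideals if they agree up to sign modulo `2` and lower terms. -/
lemma span_two_union_eq {a b : ℕ → R}
    (h : ∀ k, 0 < k → a k + b k ∈ Ideal.span ({2} ∪ b '' (Set.Ico 1 k))) (k : ℕ) :
    Ideal.span ({2} ∪ a '' (Set.Ico 1 k)) = Ideal.span ({2} ∪ b '' (Set.Ico 1 k)) := by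
  induction k with
  | zero => simp
  | succ k ih =>
    rcases Nat.eq_zero_or_pos k with rfl | hk
    · simp
    · have hins : Set.Ico 1 (k + 1) = insert k (Set.Ico 1 k) := by
        ext i; simp only [Set.mem_Ico, Set.mem_insert_iff]; omega
      simp only [hins, Set.image_insert_eq, Set.union_insert, Ideal.span_insert, ih]
      have hk' := h k hk
      set I := Ideal.span ({2} ∪ b '' (Set.Ico 1 k))
      apply le_antisymm
      · refine sup_le ((Ideal.span_singleton_le_iff_mem _).2 ?_) le_sup_right
        have : a k = -b k + (a k + b k) := by ring
        rw [this]
        exact Ideal.add_mem _ (Ideal.mem_sup_left (neg_mem (Ideal.mem_span_singleton_self _)))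
          (Ideal.mem_sup_right hk')
      · refine sup_le ((Ideal.span_singleton_le_iff_mem _).2 ?_) le_sup_right
        have : b k = -a k + (a k + b k) := by ring
        rw [this]
        exact Ideal.add_mem _ (Ideal.mem_sup_left (neg_mem (Ideal.mem_span_singleton_self _)))
          (Ideal.mem_sup_right hk')

/-- The coefficients of a twisted power series and of its inverse agree up to sign modulo `2` and
lower terms. -/
lemma coeff_add_coeff_inv_mem {T U : TwistedSeries σ} (hT : T.coeff 0 = 1) (hU : U.coeff 0 = 1)
    (hTU : T * U = 1) (k : ℕ) (hk : 0 < k) :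
    U.coeff k + T.coeff k ∈ Ideal.span ({2} ∪ T.coeff '' (Set.Ico 1 k)) := by
  have h := congrArg (fun a => TwistedSeries.coeff a k) hTU
  simp only [TwistedSeries.coeff_mul, TwistedSeries.coeff_one, if_neg hk.ne'] at h
  rw [← add_sum_erase _ _ (show (0, k) ∈ antidiagonal k by simp),
    ← add_sum_erase _ _ (show (k, 0) ∈ (antidiagonal k).erase (0, k) by simp [hk.ne'])] at h
  simp only [hT, hU, pow_zero, one_mul, map_one, mul_one, RingHom.one_def, RingHom.id_apply,
    ← add_assoc] at h
  rw [eq_neg_of_add_eq_zero_left h]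
  refine neg_mem (sum_mem fun p hp => Ideal.mul_mem_right _ _ (Ideal.subset_span (Or.inr ?_)))
  simp only [mem_erase, HasAntidiagonal.mem_antidiagonal] at hp
  have hp1 : p.1 ≠ 0 := fun h => hp.2.1 (Prod.ext h (by simp; omega))
  have hp2 : p.1 ≠ k := fun h => hp.1 (Prod.ext h (by simp; omega))
  exact ⟨p.1, ⟨by omega, by omega⟩, rfl⟩

end FunctionalEquation

/-! ### Substitution and congruences of power series modulo terms of high degree -/

section Order

variable {τ R : Type*} [CommRing R]

/-- The ideal of power series all of whose terms have degree at least `d`. -/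
def ordIdeal (τ R : Type*) [CommRing R] (d : ℕ) : Ideal (MvPowerSeries τ R) where
  carrier := {f | (d : ℕ∞) ≤ f.order}
  zero_mem' := by simp
  add_mem' ha hb := (le_min ha hb).trans MvPowerSeries.min_order_le_add
  smul_mem' c _ hf := by
    rw [smul_eq_mul]
    exact (le_add_of_nonneg_of_le bot_le hf).trans MvPowerSeries.le_order_mul

lemma mem_ordIdeal {d : ℕ} {f : MvPowerSeries τ R} :
    f ∈ ordIdeal τ R d ↔ (d : ℕ∞) ≤ f.order := Iff.rfl

lemma mem_ordIdeal_iff {d : ℕ} {f : MvPowerSeries τ R} :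
    f ∈ ordIdeal τ R d ↔ ∀ e : τ →₀ ℕ, e.degree < d → MvPowerSeries.coeff e f = 0 :=
  ⟨fun h _ he => MvPowerSeries.coeff_of_lt_order (lt_of_lt_of_le (by exact_mod_cast he) h),
    fun h => MvPowerSeries.nat_le_order h⟩

lemma ordIdeal_antitone {c d : ℕ} (h : c ≤ d) : ordIdeal τ R d ≤ ordIdeal τ R c :=
  fun _ hf => le_trans (by exact_mod_cast h) (mem_ordIdeal.1 hf)

lemma mul_mem_ordIdeal {c d : ℕ} {f g : MvPowerSeries τ R} (hf : f ∈ ordIdeal τ R c)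
    (hg : g ∈ ordIdeal τ R d) : f * g ∈ ordIdeal τ R (c + d) := by
  rw [mem_ordIdeal] at *
  push_cast
  exact (add_le_add hf hg).trans MvPowerSeries.le_order_mul

lemma mem_ordIdeal_one {f : MvPowerSeries τ R} (hf : f.constantCoeff = 0) :
    f ∈ ordIdeal τ R 1 := by
  rw [mem_ordIdeal, Nat.cast_one]
  exact MvPowerSeries.one_le_order_iff_constCoeff_eq_zero.2 hf

lemma pow_mem_ordIdeal {f : MvPowerSeries τ R} (hf : f.constantCoeff = 0) (n : ℕ) :
    f ^ n ∈ ordIdeal τ R n := by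
  induction n with
  | zero => simp [mem_ordIdeal]
  | succ n ih => rw [pow_succ]; exact mul_mem_ordIdeal ih (mem_ordIdeal_one hf)

lemma eq_of_sub_mem_ordIdeal {f g : MvPowerSeries τ R} (h : ∀ d, f - g ∈ ordIdeal τ R d) :
    f = g := by
  ext e
  have := mem_ordIdeal_iff.1 (h (e.degree + 1)) e (by omega)
  rwa [map_sub, sub_eq_zero] at this

lemma subst_sub_subst_mem_ordIdeal {d : ℕ} {a b : MvPowerSeries τ R}
    (ha : a.constantCoeff = 0) (hb : b.constantCoeff = 0) (h : a - b ∈ ordIdeal τ R d)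
    (L : PowerSeries R) : L.subst a - L.subst b ∈ ordIdeal τ R d := by
  rw [mem_ordIdeal_iff]
  intro e he
  rw [map_sub, sub_eq_zero,
    PowerSeries.coeff_subst (PowerSeries.HasSubst.of_constantCoeff_zero ha),
    PowerSeries.coeff_subst (PowerSeries.HasSubst.of_constantCoeff_zero hb)]
  refine finsum_congr fun n => ?_
  congr 1
  rw [← sub_eq_zero, ← map_sub]
  exact mem_ordIdeal_iff.1 (Ideal.mem_of_dvd _ (sub_dvd_pow_sub_pow a b n) h) e he

lemma sub_mem_ordIdeal_iff_X_pow_dvd {d : ℕ} {f g : PowerSeries R} :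
    f - g ∈ ordIdeal Unit R d ↔ ∀ i < d, PowerSeries.coeff i f = PowerSeries.coeff i g := by
  rw [mem_ordIdeal_iff]
  constructor
  · intro h i hi
    have := h (Finsupp.single () i) (by simpa using hi)
    rwa [map_sub, sub_eq_zero] at this
  · intro h e he
    obtain ⟨i, rfl⟩ : ∃ i, e = Finsupp.single () i := ⟨e (), by ext; simp⟩
    rw [map_sub, sub_eq_zero]
    exact h i (by simpa using he)

lemma constantCoeff_subst_zero {a : MvPowerSeries τ R} (ha : a.constantCoeff = 0)
    {L : PowerSeries R} (hL : L.constantCoeff = 0) : (L.subst a).constantCoeff = 0 :=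
  PowerSeries.constantCoeff_subst_eq_zero ha L hL

lemma constantCoeff_subst_zero' {a : PowerSeries R} (ha : a.constantCoeff = 0)
    {L : PowerSeries R} (hL : L.constantCoeff = 0) :
    PowerSeries.constantCoeff (L.subst a) = 0 :=
  PowerSeries.constantCoeff_subst_eq_zero ha L hL

lemma hasSubst_pair {a b : MvPowerSeries τ R} (ha : a.constantCoeff = 0)
    (hb : b.constantCoeff = 0) : MvPowerSeries.HasSubst ![a, b] :=
  MvPowerSeries.hasSubst_of_constantCoeff_zero fun s => by fin_cases s <;> simpa

lemma constantCoeff_subst_pair {a b : MvPowerSeries τ R} (ha : a.constantCoeff = 0)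
    (hb : b.constantCoeff = 0) {f : MvPowerSeries (Fin 2) R} (hf : f.constantCoeff = 0) :
    (f.subst ![a, b]).constantCoeff = 0 :=
  MvPowerSeries.constantCoeff_subst_eq_zero (hasSubst_pair ha hb)
    (fun s => by fin_cases s <;> simpa) hf

lemma powerSeries_subst_subst_pair {a b : MvPowerSeries τ R} (ha : a.constantCoeff = 0)
    (hb : b.constantCoeff = 0) {f : MvPowerSeries (Fin 2) R} (hf : f.constantCoeff = 0)
    (L : PowerSeries R) : (L.subst f).subst ![a, b] = L.subst (f.subst ![a, b]) := by
  rw [PowerSeries.subst, PowerSeries.subst]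
  exact MvPowerSeries.subst_comp_subst_apply
    (PowerSeries.HasSubst.of_constantCoeff_zero hf).const (hasSubst_pair ha hb) L

lemma map_subst_pair {S : Type*} [CommRing S] (h : R →+* S) {a b : MvPowerSeries τ R}
    (ha : a.constantCoeff = 0) (hb : b.constantCoeff = 0) (f : MvPowerSeries (Fin 2) R) :
    (f.subst ![a, b]).map h = (f.map h).subst ![a.map h, b.map h] := by
  rw [MvPowerSeries.map_subst (hasSubst_pair ha hb)]
  congr 1
  ext1 i
  fin_cases i <;> rfl

lemma mvPowerSeries_map_injective {S : Type*} [CommRing S] {h : R →+* S}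
    (hh : Function.Injective h) : Function.Injective (MvPowerSeries.map (σ := τ) h) := by
  intro a b hab
  ext e
  apply hh
  rw [← MvPowerSeries.coeff_map, hab, MvPowerSeries.coeff_map]

/-- The map of power series given by a series `x + ⋯` reflects congruences. -/
lemma sub_mem_ordIdeal_of_subst {d : ℕ} {a b : MvPowerSeries τ R}
    (ha : a.constantCoeff = 0) (hb : b.constantCoeff = 0) {L : PowerSeries R}
    (hL : L.constantCoeff = 0) (hL1 : L.coeff 1 = 1)
    (h : L.subst a - L.subst b ∈ ordIdeal τ R d) : a - b ∈ ordIdeal τ R d := by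
  have hu : IsUnit (L.coeff 1) := hL1 ▸ isUnit_one
  have hinv : ∀ c : MvPowerSeries τ R, c.constantCoeff = 0 →
      (L.substInvOfIsUnit hu).subst (L.subst c) = c := by
    intro c hc
    rw [← PowerSeries.subst_comp_subst_apply (PowerSeries.HasSubst.of_constantCoeff_zero' hL)
      (PowerSeries.HasSubst.of_constantCoeff_zero hc), PowerSeries.subst_substInvOfIsUnit_left _ hL,
      PowerSeries.subst_X (PowerSeries.HasSubst.of_constantCoeff_zero hc)]
  rw [← hinv a ha, ← hinv b hb]
  exact subst_sub_subst_mem_ordIdeal (constantCoeff_subst_zero ha hL)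
    (constantCoeff_subst_zero hb hL) h _

lemma subst_injective {a b : MvPowerSeries τ R}
    (ha : a.constantCoeff = 0) (hb : b.constantCoeff = 0) {L : PowerSeries R}
    (hL : L.constantCoeff = 0) (hL1 : L.coeff 1 = 1) (h : L.subst a = L.subst b) : a = b :=
  eq_of_sub_mem_ordIdeal fun d => sub_mem_ordIdeal_of_subst ha hb hL hL1 (by simp [h])

lemma exists_subst_eq {b : MvPowerSeries τ R} (hb : b.constantCoeff = 0) {L : PowerSeries R}
    (hL : L.constantCoeff = 0) (hL1 : L.coeff 1 = 1) :
    ∃ a : MvPowerSeries τ R, a.constantCoeff = 0 ∧ L.subst a = b := by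
  have hu : IsUnit (L.coeff 1) := hL1 ▸ isUnit_one
  refine ⟨(L.substInvOfIsUnit hu).subst b, constantCoeff_subst_zero hb (by simp), ?_⟩
  rw [← PowerSeries.subst_comp_subst_apply (PowerSeries.HasSubst.substInvOfIsUnit _ _)
      (PowerSeries.HasSubst.of_constantCoeff_zero hb),
      PowerSeries.subst_substInvOfIsUnit_right _ hL,
      PowerSeries.subst_X (PowerSeries.HasSubst.of_constantCoeff_zero hb)]

lemma exists_compositional_inverse {L : PowerSeries R} (hL : L.constantCoeff = 0)
    (hL1 : L.coeff 1 = 1) : ∃ η : PowerSeries R, η.constantCoeff = 0 ∧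
      L.subst η = PowerSeries.X ∧ η.subst L = PowerSeries.X := by
  have hu : IsUnit (L.coeff 1) := hL1 ▸ isUnit_one
  exact ⟨L.substInvOfIsUnit hu, by simp, PowerSeries.subst_substInvOfIsUnit_right _ hL hu,
    PowerSeries.subst_substInvOfIsUnit_left _ hL hu⟩

lemma subst_subst_assoc {η : PowerSeries R} (hη : η.constantCoeff = 0) (L : PowerSeries R)
    {c : MvPowerSeries τ R} (hc : c.constantCoeff = 0) :
    L.subst (η.subst c) = PowerSeries.subst c (L.subst η : PowerSeries R) := by
  rw [← PowerSeries.subst_comp_subst_apply (PowerSeries.HasSubst.of_constantCoeff_zero' hη)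
    (PowerSeries.HasSubst.of_constantCoeff_zero hc)]

lemma subst_subst_eq_self {L η : PowerSeries R} (hη : η.constantCoeff = 0)
    (h : L.subst η = PowerSeries.X) {c : MvPowerSeries τ R} (hc : c.constantCoeff = 0) :
    L.subst (η.subst c) = c := by
  rw [← PowerSeries.subst_comp_subst_apply (PowerSeries.HasSubst.of_constantCoeff_zero' hη)
    (PowerSeries.HasSubst.of_constantCoeff_zero hc), h,
    PowerSeries.subst_X (PowerSeries.HasSubst.of_constantCoeff_zero hc)]

/-- A series `x + ⋯` can be cancelled on the right. -/
lemma subst_left_cancel {θ A B : PowerSeries R} (hθ : θ.constantCoeff = 0)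
    (hθ1 : θ.coeff 1 = 1) (h : A.subst θ = B.subst θ) : A = B := by
  obtain ⟨η, hη, hηθ, -⟩ := exists_compositional_inverse hθ hθ1
  have hs : PowerSeries.HasSubst θ := PowerSeries.HasSubst.of_constantCoeff_zero' hθ
  have hs' : PowerSeries.HasSubst η := PowerSeries.HasSubst.of_constantCoeff_zero hη
  have := congrArg (PowerSeries.subst η) h
  rwa [PowerSeries.subst_comp_subst_apply hs hs', PowerSeries.subst_comp_subst_apply hs hs', hηθ,
    PowerSeries.X_subst, PowerSeries.X_subst] at this

end Order

/-! ### Logarithms of formal group laws -/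

section Log

variable {τ K : Type*} [CommRing K]

/-- The series `∑ ℓ_i x^(2^i)`. -/
def typicalSeries (ℓ : ℕ → K) : PowerSeries K :=
  PowerSeries.mk fun d => if 2 ^ Nat.log 2 d = d then ℓ (Nat.log 2 d) else 0

@[simp] lemma coeff_typicalSeries_two_pow (ℓ : ℕ → K) (i : ℕ) :
    PowerSeries.coeff (2 ^ i) (typicalSeries ℓ) = ℓ i := by
  simp [typicalSeries, Nat.log_pow]

lemma coeff_typicalSeries_of_ne (ℓ : ℕ → K) (d : ℕ) (hd : ∀ i, d ≠ 2 ^ i) :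
    PowerSeries.coeff d (typicalSeries ℓ) = 0 := by
  rw [typicalSeries, PowerSeries.coeff_mk, if_neg fun h => hd _ h.symm]

@[simp] lemma coeff_one_typicalSeries (ℓ : ℕ → K) :
    PowerSeries.coeff 1 (typicalSeries ℓ) = ℓ 0 := by
  simpa using coeff_typicalSeries_two_pow ℓ 0

@[simp] lemma constantCoeff_typicalSeries (ℓ : ℕ → K) :
    PowerSeries.constantCoeff (typicalSeries ℓ) = 0 := by
  rw [← PowerSeries.coeff_zero_eq_constantCoeff_apply]
  exact coeff_typicalSeries_of_ne ℓ 0 fun i => (by positivity : (2 : ℕ) ^ i ≠ 0).symm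

lemma eq_typicalSeries {L : PowerSeries K}
    (h : ∀ d : ℕ, (¬ ∃ i : ℕ, d = 2 ^ i) → PowerSeries.coeff d L = 0) :
    L = typicalSeries fun i => PowerSeries.coeff (2 ^ i) L := by
  ext d
  by_cases hd : ∃ i : ℕ, d = 2 ^ i
  · obtain ⟨i, rfl⟩ := hd
    simp
  · rw [h d hd, coeff_typicalSeries_of_ne _ _ fun i hi => hd ⟨i, hi⟩]

lemma map_typicalSeries {K' : Type*} [CommRing K'] (f : K →+* K') (ℓ : ℕ → K) :
    (typicalSeries ℓ).map f = typicalSeries fun i => f (ℓ i) := by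
  ext d
  simp only [typicalSeries, PowerSeries.coeff_map, PowerSeries.coeff_mk]
  split_ifs <;> simp

lemma typicalSeries_injective : Function.Injective (typicalSeries : (ℕ → K) → PowerSeries K) := by
  intro a b h
  funext i
  rw [← coeff_typicalSeries_two_pow a, h, coeff_typicalSeries_two_pow]

lemma X_pow_dvd_typicalSeries_sub (ℓ : ℕ → K) (M : ℕ) : (PowerSeries.X : PowerSeries K) ^ 2 ^ M ∣
    typicalSeries ℓ -
      ∑ i ∈ Finset.range M, PowerSeries.C (ℓ i) * (PowerSeries.X : PowerSeries K) ^ 2 ^ i := by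
  rw [PowerSeries.X_pow_dvd_iff]
  intro d hd
  rw [map_sub, map_sum, sub_eq_zero]
  simp only [PowerSeries.coeff_C_mul, PowerSeries.coeff_X_pow]
  by_cases h : ∃ i, d = 2 ^ i
  · obtain ⟨i, rfl⟩ := h
    have hi : i < M := (Nat.pow_lt_pow_iff_right (by norm_num)).1 hd
    rw [coeff_typicalSeries_two_pow, Finset.sum_eq_single i]
    · simp
    · intro j _ hj
      rw [if_neg fun h => hj (Nat.pow_right_injective le_rfl h).symm, mul_zero]
    · intro h
      exact absurd (Finset.mem_range.2 hi) h
  · push Not at h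
    rw [coeff_typicalSeries_of_ne _ _ h, Finset.sum_eq_zero]
    intro i _
    rw [if_neg (h i), mul_zero]

/-- Substitution into `∑ ℓ_i x^(2^i)` is approximated by partial sums. -/
lemma subst_typicalSeries_sub_mem (ℓ : ℕ → K) (M : ℕ) {a : MvPowerSeries τ K}
    (ha : a.constantCoeff = 0) :
    (typicalSeries ℓ).subst a - ∑ i ∈ Finset.range M, MvPowerSeries.C (ℓ i) * a ^ 2 ^ i ∈
      ordIdeal τ K (2 ^ M) := by
  have hs : PowerSeries.HasSubst a := PowerSeries.HasSubst.of_constantCoeff_zero ha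
  obtain ⟨r, hr⟩ := X_pow_dvd_typicalSeries_sub ℓ M
  have h := congrArg (PowerSeries.subst a) hr
  rw [PowerSeries.subst_sub hs, PowerSeries.subst_mul hs, PowerSeries.subst_pow hs,
    PowerSeries.subst_X hs] at h
  have h2 : PowerSeries.subst a
      (∑ i ∈ Finset.range M, PowerSeries.C (ℓ i) * (PowerSeries.X : PowerSeries K) ^ 2 ^ i) =
      ∑ i ∈ Finset.range M, MvPowerSeries.C (ℓ i) * a ^ 2 ^ i := by
    rw [← PowerSeries.coe_substAlgHom hs, map_sum]
    refine Finset.sum_congr rfl fun i _ => ?_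
    rw [PowerSeries.coe_substAlgHom hs, PowerSeries.subst_mul hs, PowerSeries.subst_pow hs,
      PowerSeries.subst_X hs, PowerSeries.subst_C]
  rw [h2] at h
  rw [h]
  exact Ideal.mul_mem_right _ _ (pow_mem_ordIdeal ha _)

/-- Over a domain of characteristic zero an additive power series is linear: compare the
coefficients of `x y^(d-1)`. -/
lemma eq_C_mul_X_of_subst_add [IsDomain K] [CharZero K] {M : PowerSeries K}
    (hM : M.subst (MvPowerSeries.X 0 + MvPowerSeries.X 1 : MvPowerSeries (Fin 2) K) =
      M.subst (MvPowerSeries.X 0 : MvPowerSeries (Fin 2) K) +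
        M.subst (MvPowerSeries.X 1 : MvPowerSeries (Fin 2) K))
    (hM0 : PowerSeries.constantCoeff M = 0) :
    M = PowerSeries.C (PowerSeries.coeff 1 M) * PowerSeries.X := by
  classical
  ext d
  rw [PowerSeries.coeff_C_mul, PowerSeries.coeff_X]
  rcases Nat.lt_or_ge d 2 with hd | hd
  · interval_cases d
    · simpa using hM0
    · simp
  · have h := congrArg (MvPowerSeries.coeff (Finsupp.single 0 1 + Finsupp.single 1 (d - 1))) hM
    have h0 : (Finsupp.single 0 1 + Finsupp.single 1 (d - 1) : Fin 2 →₀ ℕ) 0 = 1 := by simp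
    have h1 : (Finsupp.single 0 1 + Finsupp.single 1 (d - 1) : Fin 2 →₀ ℕ) 1 = d - 1 := by simp
    rw [PowerSeries.coeff_subst_X_zero_add_X_one, map_add, PowerSeries.coeff_subst_single,
      PowerSeries.coeff_subst_single, h0, h1, if_neg, if_neg, Nat.choose_one_right,
      show 1 + (d - 1) = d by omega, add_zero, mul_eq_zero, Nat.cast_eq_zero] at h
    · rw [h.resolve_left (by omega), if_neg (by omega), mul_zero]
    · intro h
      have := DFunLike.congr_fun h 0
      rw [h0] at this
      simp at this
    · intro h
      have := DFunLike.congr_fun h 1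
      rw [h1] at this
      simp at this
      omega

/-- The power series `L = x + ⋯` is a logarithm of `F`, that is, `L(F(x, y)) = L(x) + L(y)`. -/
structure IsLog (F : FormalGroup K) (L : PowerSeries K) : Prop where
  constantCoeff : PowerSeries.constantCoeff L = 0
  coeff_one : PowerSeries.coeff 1 L = 1
  subst_eq : L.subst F.toPowerSeries =
    L.subst (MvPowerSeries.X 0 : MvPowerSeries (Fin 2) K) +
      L.subst (MvPowerSeries.X 1 : MvPowerSeries (Fin 2) K)

lemma isStrictIso_additive_iff {F : FormalGroup K} {L : PowerSeries K} :
    IsStrictIso F FormalGroup.𝔾ₐ L ↔ IsLog F L := by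
  have key : PowerSeries.constantCoeff L = 0 →
      (FormalGroup.𝔾ₐ : FormalGroup K).toPowerSeries.subst
        ![L.subst (MvPowerSeries.X 0 : MvPowerSeries (Fin 2) K),
          L.subst (MvPowerSeries.X 1 : MvPowerSeries (Fin 2) K)] =
      L.subst (MvPowerSeries.X 0 : MvPowerSeries (Fin 2) K) +
      L.subst (MvPowerSeries.X 1 : MvPowerSeries (Fin 2) K) := by
    intro h0
    have hs := hasSubst_pair (R := K)
      (constantCoeff_subst_zero (MvPowerSeries.constantCoeff_X (0 : Fin 2)) h0)
      (constantCoeff_subst_zero (MvPowerSeries.constantCoeff_X (1 : Fin 2)) h0)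
    rw [FormalGroup.𝔾ₐ_toPowerSeries, MvPowerSeries.subst_add hs, MvPowerSeries.subst_X hs,
      MvPowerSeries.subst_X hs]
    rfl
  constructor
  · rintro ⟨h0, h1, h2⟩
    exact ⟨h0, h1, by rw [h2, key h0]⟩
  · rintro ⟨h0, h1, h2⟩
    exact ⟨h0, h1, by rw [h2, key h0]⟩

namespace IsLog

variable {F : FormalGroup K} {L L' : PowerSeries K} (hL : IsLog F L)

include hL

lemma subst_add {a b : MvPowerSeries τ K} (ha : a.constantCoeff = 0) (hb : b.constantCoeff = 0) :
    L.subst (F.toPowerSeries.subst ![a, b]) = L.subst a + L.subst b := by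
  have hs := hasSubst_pair ha hb
  rw [← powerSeries_subst_subst_pair ha hb F.zero_constantCoeff, hL.subst_eq,
    MvPowerSeries.subst_add hs,
    powerSeries_subst_subst_pair ha hb (MvPowerSeries.constantCoeff_X _),
    powerSeries_subst_subst_pair ha hb (MvPowerSeries.constantCoeff_X _),
    MvPowerSeries.subst_X hs, MvPowerSeries.subst_X hs]
  rfl

lemma map {K' : Type*} [CommRing K'] (f : K →+* K') : IsLog (F.map f) (L.map f) where
  constantCoeff := by
    rw [← PowerSeries.coeff_zero_eq_constantCoeff_apply, PowerSeries.coeff_map,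
      PowerSeries.coeff_zero_eq_constantCoeff_apply, hL.constantCoeff, map_zero]
  coeff_one := by rw [PowerSeries.coeff_map, hL.coeff_one, map_one]
  subst_eq := by
    have h := congrArg (MvPowerSeries.map f) hL.subst_eq
    rw [map_add, PowerSeries.map_subst (PowerSeries.HasSubst.of_constantCoeff_zero
      F.zero_constantCoeff), PowerSeries.map_subst (PowerSeries.HasSubst.X _),
      PowerSeries.map_subst (PowerSeries.HasSubst.X _), MvPowerSeries.map_X,
      MvPowerSeries.map_X] at h
    exact h

/-- A formal group law is determined by its logarithm. -/
lemma formalGroup_ext {F' : FormalGroup K} (hL' : IsLog F' L) : F = F' :=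
  FormalGroup.ext (subst_injective F.zero_constantCoeff F'.zero_constantCoeff hL.constantCoeff
    hL.coeff_one (by rw [hL.subst_eq, hL'.subst_eq]))

/-- Over a domain of characteristic zero the logarithm of a formal group law is unique, since
`L' ∘ L⁻¹` is additive. -/
lemma eq [IsDomain K] [CharZero K] (hL' : IsLog F L') : L = L' := by
  obtain ⟨η, hη, hLη, hηL⟩ := exists_compositional_inverse hL.constantCoeff hL.coeff_one
  have hsη : PowerSeries.HasSubst η := PowerSeries.HasSubst.of_constantCoeff_zero hη
  have hsL : PowerSeries.HasSubst L := PowerSeries.HasSubst.of_constantCoeff_zero hL.constantCoeff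
  have hX : ∀ i : Fin 2, (MvPowerSeries.X i : MvPowerSeries (Fin 2) K).constantCoeff = 0 :=
    fun i => MvPowerSeries.constantCoeff_X i
  have hXX :
      (MvPowerSeries.X 0 + MvPowerSeries.X 1 : MvPowerSeries (Fin 2) K).constantCoeff = 0 := by
    rw [map_add, hX, hX, add_zero]
  have hcomp : ∀ (P : PowerSeries K) (c : MvPowerSeries (Fin 2) K), c.constantCoeff = 0 →
      P.subst (PowerSeries.subst c η) = PowerSeries.subst c (P.subst η : PowerSeries K) :=
    fun P c hc => subst_subst_assoc hη P hc
  have hLc : ∀ c : MvPowerSeries (Fin 2) K, c.constantCoeff = 0 →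
      L.subst (PowerSeries.subst c η) = c := fun c hc => subst_subst_eq_self hη hLη hc
  have hηc : ∀ c : MvPowerSeries (Fin 2) K, c.constantCoeff = 0 →
      (PowerSeries.subst c η).constantCoeff = 0 := fun c hc => constantCoeff_subst_zero hc hη
  -- With `η = L⁻¹` one has `F(η(x), η(y)) = η(x + y)`, so that `L' ∘ η` is additive.
  have hF : F.toPowerSeries.subst ![PowerSeries.subst (MvPowerSeries.X 0) η,
      PowerSeries.subst (MvPowerSeries.X 1) η] =
      PowerSeries.subst (MvPowerSeries.X 0 + MvPowerSeries.X 1 : MvPowerSeries (Fin 2) K) η := by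
    refine subst_injective (constantCoeff_subst_pair (hηc _ (hX 0)) (hηc _ (hX 1))
      F.zero_constantCoeff) (hηc _ hXX) hL.constantCoeff hL.coeff_one ?_
    rw [hL.subst_add (hηc _ (hX 0)) (hηc _ (hX 1)), hLc _ (hX 0), hLc _ (hX 1), hLc _ hXX]
  have hM := eq_C_mul_X_of_subst_add (M := L'.subst η) (by
    rw [← hcomp _ _ hXX, ← hcomp _ _ (hX 0), ← hcomp _ _ (hX 1), ← hF,
      hL'.subst_add (hηc _ (hX 0)) (hηc _ (hX 1))])
    (constantCoeff_subst_zero' hη hL'.constantCoeff)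
  have hML : PowerSeries.subst L (PowerSeries.subst η L') = L' := by
    rw [PowerSeries.subst_comp_subst_apply hsη hsL, hηL, PowerSeries.X_subst]
  rw [hM, PowerSeries.subst_mul hsL, PowerSeries.subst_C, PowerSeries.subst_X hsL] at hML
  have h1 := congrArg (PowerSeries.coeff 1) hML
  rw [hL'.coeff_one] at h1
  erw [PowerSeries.coeff_C_mul] at h1
  rw [hL.coeff_one, mul_one] at h1
  rw [h1, map_one, one_mul] at hML
  exact hML

end IsLog

end Log

/-! ### Formal sums -/

section FormalSum

variable {R S : Type*} [CommRing R] [CommRing S]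

lemma constantCoeff_C_mul_X_pow (c : R) (i : ℕ) :
    PowerSeries.constantCoeff (PowerSeries.C c * (PowerSeries.X : PowerSeries R) ^ 2 ^ i) = 0 := by
  simp

lemma constantCoeff_partialFormalSum (F : FormalGroup R) {g : ℕ → PowerSeries R}
    (hg : ∀ i, PowerSeries.constantCoeff (g i) = 0) (M : ℕ) :
    PowerSeries.constantCoeff (partialFormalSum F g M) = 0 := by
  induction M with
  | zero => simp [partialFormalSum]
  | succ M ih => exact constantCoeff_subst_pair (τ := Unit) ih (hg M) F.zero_constantCoeff

lemma map_partialFormalSum (h : R →+* S) (F : FormalGroup R) {g : ℕ → PowerSeries R}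
    (hg : ∀ i, PowerSeries.constantCoeff (g i) = 0) (M : ℕ) :
    (partialFormalSum F g M).map h = partialFormalSum (F.map h) (fun i => (g i).map h) M := by
  induction M with
  | zero => simp [partialFormalSum]
  | succ M ih =>
    have := map_subst_pair (τ := Unit) h (constantCoeff_partialFormalSum F hg M) (hg M)
      F.toPowerSeries
    rw [partialFormalSum, partialFormalSum, ← ih]
    exact this

lemma map_formalSum (h : R →+* S) (F : FormalGroup R) (c : ℕ → R) :
    (formalSum F c).map h = formalSum (F.map h) (fun i => h (c i)) := by
  ext d
  rw [PowerSeries.coeff_map, formalSum, formalSum, PowerSeries.coeff_mk, PowerSeries.coeff_mk,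
    ← PowerSeries.coeff_map, map_partialFormalSum h F fun i => constantCoeff_C_mul_X_pow (c i) i]
  simp

variable {K : Type*} [CommRing K] {F : FormalGroup K} {L : PowerSeries K}

lemma IsLog.subst_partialFormalSum (hL : IsLog F L) {g : ℕ → PowerSeries K}
    (hg : ∀ i, PowerSeries.constantCoeff (g i) = 0) (M : ℕ) :
    L.subst (partialFormalSum F g M) = ∑ i ∈ Finset.range M, L.subst (g i) := by
  induction M with
  | zero =>
    rw [partialFormalSum, Finset.sum_range_zero]
    exact PowerSeries.subst_zero_of_constantCoeff_zero hL.constantCoeff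
  | succ M ih =>
    rw [partialFormalSum, Finset.sum_range_succ, ← ih]
    exact hL.subst_add (τ := Unit) (constantCoeff_partialFormalSum F hg M) (hg M)

lemma constantCoeff_formalSum (F : FormalGroup R) (c : ℕ → R) :
    PowerSeries.constantCoeff (formalSum F c) = 0 := by
  rw [← PowerSeries.coeff_zero_eq_constantCoeff_apply, formalSum, PowerSeries.coeff_mk,
    PowerSeries.coeff_zero_eq_constantCoeff_apply]
  exact constantCoeff_partialFormalSum F (fun i => constantCoeff_C_mul_X_pow (c i) i) _

/-- The logarithm of a monomial. -/
lemma subst_C_mul_X_pow (ℓ : ℕ → K) (c : K) (i : ℕ) :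
    (typicalSeries ℓ).subst (PowerSeries.C c * (PowerSeries.X : PowerSeries K) ^ 2 ^ i) =
      typicalSeries fun k => if i ≤ k then ℓ (k - i) * c ^ 2 ^ (k - i) else 0 := by
  ext e
  rw [PowerSeries.coeff_subst' (PowerSeries.HasSubst.of_constantCoeff_zero'
    (constantCoeff_C_mul_X_pow c i))]
  have hterm : ∀ n, PowerSeries.coeff n (typicalSeries ℓ) • PowerSeries.coeff e
      ((PowerSeries.C c * (PowerSeries.X : PowerSeries K) ^ 2 ^ i) ^ n) =
      PowerSeries.coeff n (typicalSeries ℓ) * (c ^ n * if e = 2 ^ i * n then 1 else 0) := by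
    intro n
    rw [mul_pow, ← map_pow, PowerSeries.coeff_C_mul, ← pow_mul, PowerSeries.coeff_X_pow,
      smul_eq_mul]
  simp only [hterm]
  by_cases he : ∃ n, e = 2 ^ i * n
  · obtain ⟨n, rfl⟩ := he
    rw [finsum_eq_single _ n, if_pos rfl, mul_one]
    · by_cases hn : ∃ j, n = 2 ^ j
      · obtain ⟨j, rfl⟩ := hn
        rw [← pow_add, coeff_typicalSeries_two_pow, coeff_typicalSeries_two_pow,
          if_pos (Nat.le_add_right _ _), Nat.add_sub_cancel_left]
      · rw [coeff_typicalSeries_of_ne _ n fun j hj => hn ⟨j, hj⟩, zero_mul,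
          coeff_typicalSeries_of_ne]
        intro k hk
        obtain ⟨j, -, hj⟩ := (Nat.dvd_prime_pow Nat.prime_two).1 (Dvd.intro_left _ hk)
        exact hn ⟨j, hj⟩
    · intro n' hn'
      rw [if_neg, mul_zero, mul_zero]
      intro h
      exact hn' (Nat.eq_of_mul_eq_mul_left (by positivity) h).symm
  · have : ∀ n, (if e = 2 ^ i * n then (1 : K) else 0) = 0 := fun n => if_neg fun h => he ⟨n, h⟩
    simp only [this, mul_zero, finsum_zero]
    by_cases hk : ∃ k, e = 2 ^ k
    · obtain ⟨k, rfl⟩ := hk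
      rw [coeff_typicalSeries_two_pow, if_neg]
      intro hik
      exact he ⟨2 ^ (k - i), by rw [← pow_add, Nat.add_sub_cancel' hik]⟩
    · rw [coeff_typicalSeries_of_ne _ _ fun k hk' => hk ⟨k, hk'⟩]

lemma typicalSeries_sub_mem {a b : ℕ → K} {d : ℕ} (h : ∀ k < d, a k = b k) :
    typicalSeries a - typicalSeries b ∈ ordIdeal Unit K d := by
  rw [sub_mem_ordIdeal_iff_X_pow_dvd]
  intro i hi
  by_cases hk : ∃ k, i = 2 ^ k
  · obtain ⟨k, rfl⟩ := hk
    rw [coeff_typicalSeries_two_pow, coeff_typicalSeries_two_pow,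
      h k (Nat.lt_two_pow_self.trans hi)]
  · rw [coeff_typicalSeries_of_ne _ _ fun k hk' => hk ⟨k, hk'⟩,
      coeff_typicalSeries_of_ne _ _ fun k hk' => hk ⟨k, hk'⟩]

lemma sum_typicalSeries {α : Type*} (s : Finset α) (f : α → ℕ → K) :
    ∑ i ∈ s, typicalSeries (f i) = typicalSeries fun k => ∑ i ∈ s, f i k := by
  ext d
  rw [map_sum]
  simp only [typicalSeries, PowerSeries.coeff_mk]
  split_ifs <;> simp

/-- The logarithm of a formal sum `∑^F c_i x^(2^i)`. -/
lemma subst_formalSum {ℓ : ℕ → K} (hL : IsLog F (typicalSeries ℓ)) (c : ℕ → K) :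
    (typicalSeries ℓ).subst (formalSum F c) =
      typicalSeries fun k =>
        ∑ p ∈ Finset.HasAntidiagonal.antidiagonal k, ℓ p.1 * c p.2 ^ 2 ^ p.1 := by
  set g : ℕ → PowerSeries K := fun i => PowerSeries.C (c i) * PowerSeries.X ^ 2 ^ i with hgdef
  have hg : ∀ i, PowerSeries.constantCoeff (g i) = 0 := fun i => constantCoeff_C_mul_X_pow (c i) i
  have hP := constantCoeff_partialFormalSum F hg
  have hlog : ∀ M, (typicalSeries ℓ).subst (partialFormalSum F g M) = typicalSeries fun k =>
      ∑ i ∈ Finset.range M, if i ≤ k then ℓ (k - i) * c i ^ 2 ^ (k - i) else 0 := by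
    intro M
    rw [hL.subst_partialFormalSum hg, ← sum_typicalSeries]
    exact Finset.sum_congr rfl fun i _ => subst_C_mul_X_pow ℓ (c i) i
  have hsum : ∀ M k, k < M → (∑ i ∈ Finset.range M,
      if i ≤ k then ℓ (k - i) * c i ^ 2 ^ (k - i) else 0) =
      ∑ p ∈ Finset.HasAntidiagonal.antidiagonal k, ℓ p.1 * c p.2 ^ 2 ^ p.1 := by
    intro M k hk
    rw [← Finset.Nat.sum_antidiagonal_swap, Finset.Nat.sum_antidiagonal_eq_sum_range_succ_mk,
      ← Finset.sum_filter]
    refine Finset.sum_congr ?_ fun _ _ => rfl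
    ext i
    simp only [Finset.mem_filter, Finset.mem_range]
    omega
  -- The coefficients of low degree of the partial sums are stable since those of their logarithms
  -- are.
  have hstab : ∀ d, formalSum F c - partialFormalSum F g d ∈ ordIdeal Unit K d := by
    intro d
    rw [sub_mem_ordIdeal_iff_X_pow_dvd]
    intro i hi
    rw [formalSum, PowerSeries.coeff_mk]
    have h : partialFormalSum F g (i + 1) - partialFormalSum F g d ∈ ordIdeal Unit K (i + 1) := by
      refine sub_mem_ordIdeal_of_subst (hP _) (hP _) hL.constantCoeff hL.coeff_one ?_
      rw [hlog, hlog]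
      exact typicalSeries_sub_mem fun k hk => by rw [hsum _ k hk, hsum _ k (by omega)]
    exact sub_mem_ordIdeal_iff_X_pow_dvd.1 h i (by omega)
  refine eq_of_sub_mem_ordIdeal (τ := Unit) fun d => ?_
  have h1 := subst_sub_subst_mem_ordIdeal (τ := Unit) (constantCoeff_formalSum F c) (hP d)
    (hstab d) (typicalSeries ℓ)
  rw [hlog] at h1
  have h2 := typicalSeries_sub_mem (K := K) (d := d) (fun k hk => hsum d k hk)
  have := add_mem h1 h2
  rwa [sub_add_sub_cancel] at this

end FormalSum

/-! ### Formal group laws with a given logarithm -/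

section Existence

variable {ν R K : Type*} [CommRing R] [CommRing K] {ι : R →+* K}

lemma subst_sub_self_mem {L : PowerSeries K} (hL : PowerSeries.constantCoeff L = 0)
    (hL1 : PowerSeries.coeff 1 L = 1) {a : MvPowerSeries ν K} (ha : a.constantCoeff = 0) :
    L.subst a - a ∈ ordIdeal ν K 2 := by
  have hs : PowerSeries.HasSubst a := PowerSeries.HasSubst.of_constantCoeff_zero ha
  obtain ⟨r, hr⟩ : (PowerSeries.X : PowerSeries K) ^ 2 ∣ L - PowerSeries.X := by
    rw [PowerSeries.X_pow_dvd_iff]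
    intro d hd
    rw [map_sub, PowerSeries.coeff_X]
    interval_cases d
    · simpa using hL
    · simp [hL1]
  have h := congrArg (PowerSeries.subst a) hr
  rw [PowerSeries.subst_sub hs, PowerSeries.subst_mul hs, PowerSeries.subst_pow hs,
    PowerSeries.subst_X hs] at h
  rw [h]
  exact Ideal.mul_mem_right _ _ (pow_mem_ordIdeal ha 2)

/-- A series `Φ` over `R` with `L(Φ) = L(X) + L(Y)` over an extension is a formal group law. -/
lemma exists_formalGroup (hι : Function.Injective ι) {L : PowerSeries K}
    (hL : PowerSeries.constantCoeff L = 0) (hL1 : PowerSeries.coeff 1 L = 1)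
    {Φ : MvPowerSeries (Fin 2) R} (hΦ : Φ.constantCoeff = 0)
    (h : L.subst (Φ.map ι) = L.subst (MvPowerSeries.X 0 : MvPowerSeries (Fin 2) K) +
      L.subst (MvPowerSeries.X 1 : MvPowerSeries (Fin 2) K)) :
    ∃ F : FormalGroup R, F.IsComm ∧ IsLog (F.map ι) L := by
  have hX : ∀ {α : Type} (i : α), (MvPowerSeries.X i : MvPowerSeries α R).constantCoeff = 0 :=
    fun i => MvPowerSeries.constantCoeff_X i
  have hXK : ∀ i : Fin 2, (MvPowerSeries.X i : MvPowerSeries (Fin 2) K).constantCoeff = 0 :=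
    fun i => MvPowerSeries.constantCoeff_X i
  have hmap0 : ∀ {α : Type} {a : MvPowerSeries α R}, a.constantCoeff = 0 →
      (a.map ι).constantCoeff = 0 := by
    intro α a ha
    rw [MvPowerSeries.constantCoeff_map, ha, map_zero]
  have hΦK : (Φ.map ι).constantCoeff = 0 := hmap0 hΦ
  have hlog : ∀ {α : Type} {a b : MvPowerSeries α K}, a.constantCoeff = 0 →
      b.constantCoeff = 0 → L.subst ((Φ.map ι).subst ![a, b]) = L.subst a + L.subst b := by
    intro α a b ha hb
    have hs := hasSubst_pair ha hb
    rw [← powerSeries_subst_subst_pair ha hb hΦK, h, MvPowerSeries.subst_add hs,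
      powerSeries_subst_subst_pair ha hb (hXK _), powerSeries_subst_subst_pair ha hb (hXK _),
      MvPowerSeries.subst_X hs, MvPowerSeries.subst_X hs]
    rfl
  have hpair : ∀ {α : Type} {a b : MvPowerSeries α R}, a.constantCoeff = 0 →
      b.constantCoeff = 0 → (Φ.subst ![a, b]).constantCoeff = 0 :=
    fun ha hb => constantCoeff_subst_pair ha hb hΦ
  have hlogR : ∀ {α : Type} {a b : MvPowerSeries α R}, a.constantCoeff = 0 →
      b.constantCoeff = 0 →
      L.subst ((Φ.subst ![a, b]).map ι) = L.subst (a.map ι) + L.subst (b.map ι) := by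
    intro α a b ha hb
    rw [map_subst_pair ι ha hb, hlog (hmap0 ha) (hmap0 hb)]
  -- The axioms can be tested after applying `L`, which turns `Φ` into addition.
  have hext : ∀ {α : Type} {a b : MvPowerSeries α R}, a.constantCoeff = 0 →
      b.constantCoeff = 0 → L.subst (a.map ι) = L.subst (b.map ι) → a = b := fun ha hb hab =>
    mvPowerSeries_map_injective hι (subst_injective (hmap0 ha) (hmap0 hb) hL hL1 hab)
  have hlin : ∀ i : Fin 2, Φ.coeff (Finsupp.single i 1) = 1 := by
    intro i
    apply hι
    have h1 := add_mem (sub_mem (subst_sub_self_mem hL hL1 (hXK 0))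
      (subst_sub_self_mem hL hL1 hΦK)) (subst_sub_self_mem hL hL1 (hXK 1))
    have h2 : Φ.map ι - (MvPowerSeries.X 0 + MvPowerSeries.X 1) ∈ ordIdeal (Fin 2) K 2 := by
      convert h1 using 1
      rw [h]; ring
    have h3 := mem_ordIdeal_iff.1 h2 (Finsupp.single i 1) (by simp)
    rw [map_sub, sub_eq_zero, MvPowerSeries.coeff_map, map_add] at h3
    rw [h3, map_one]
    fin_cases i <;> simp [MvPowerSeries.coeff_index_single_X]
  let F : FormalGroup R :=
    { toPowerSeries := Φ
      zero_constantCoeff := hΦ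
      lin_coeff_X := hlin 0
      lin_coeff_Y := hlin 1
      assoc := by
        refine hext (hpair (hpair (hX _) (hX _)) (hX _)) (hpair (hX _) (hpair (hX _) (hX _))) ?_
        rw [hlogR (hpair (hX _) (hX _)) (hX _), hlogR (hX _) (hX _),
          hlogR (hX _) (hpair (hX _) (hX _)), hlogR (hX _) (hX _), add_assoc] }
  refine ⟨F, ⟨?_⟩, ⟨hL, hL1, h⟩⟩
  refine hext hΦ (hpair (hX _) (hX _)) ?_
  rw [hlogR (hX _) (hX _), MvPowerSeries.map_X, MvPowerSeries.map_X, add_comm]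
  exact h

end Existence

/-! ### Integrality of the formal group law of a logarithm with a functional equation -/

section Integrality

open Finset

variable {ν R K : Type*} [CommRing R] [CommRing K]

lemma exists_coeff_eq (r : (ν →₀ ℕ) → R) :
    ∃ f : MvPowerSeries ν R, ∀ e, MvPowerSeries.coeff e f = r e :=
  ⟨fun e => r e, fun _ => rfl⟩

/-- The endomorphism `∑ a_e X^e ↦ ∑ σ(a_e) X^(2e)` of the ring of power series. -/
def frobSeries (ν : Type*) (σ : R →+* R) : MvPowerSeries ν R →+* MvPowerSeries ν R :=
  ((MvPowerSeries.expand 2 two_ne_zero : MvPowerSeries ν R →ₐ[R] MvPowerSeries ν R) :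
    MvPowerSeries ν R →+* MvPowerSeries ν R).comp (MvPowerSeries.map σ)

lemma frobSeries_apply (σ : R →+* R) (a : MvPowerSeries ν R) :
    frobSeries ν σ a = MvPowerSeries.expand 2 two_ne_zero (MvPowerSeries.map σ a) := rfl

@[simp] lemma frobSeries_C (σ : R →+* R) (a : R) :
    frobSeries ν σ (MvPowerSeries.C a) = MvPowerSeries.C (σ a) := by
  rw [frobSeries_apply, MvPowerSeries.map_C, MvPowerSeries.expand_C]

lemma frobSeries_pow_C (σ : R →+* R) (i : ℕ) (a : R) :
    (frobSeries ν σ ^ i) (MvPowerSeries.C a) = MvPowerSeries.C ((σ ^ i) a) := by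
  induction i with
  | zero => rfl
  | succ i ih => simp only [pow_succ', RingHom.mul_def, RingHom.comp_apply, ih, frobSeries_C]

lemma frobSeries_pow_X (σ : R →+* R) (i : ℕ) (s : ν) :
    (frobSeries ν σ ^ i) (MvPowerSeries.X s) = MvPowerSeries.X s ^ 2 ^ i := by
  induction i with
  | zero => simp
  | succ i ih =>
    rw [pow_succ', RingHom.mul_def, RingHom.comp_apply, ih, map_pow, frobSeries_apply,
      MvPowerSeries.map_X, MvPowerSeries.expand_X, ← pow_mul, pow_succ']

lemma frobSeries_mem_ordIdeal (σ : R →+* R) {d : ℕ} {a : MvPowerSeries ν R}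
    (ha : a ∈ ordIdeal ν R d) : frobSeries ν σ a ∈ ordIdeal ν R (2 * d) := by
  rw [mem_ordIdeal] at *
  rw [frobSeries_apply, MvPowerSeries.order_expand, nsmul_eq_mul]
  push_cast
  exact mul_le_mul_right (ha.trans (MvPowerSeries.le_order_map σ)) _

lemma frobSeries_pow_mem_ordIdeal (σ : R →+* R) (i : ℕ) {d : ℕ} {a : MvPowerSeries ν R}
    (ha : a ∈ ordIdeal ν R d) : (frobSeries ν σ ^ i) a ∈ ordIdeal ν R (2 ^ i * d) := by
  induction i with
  | zero => simpa using ha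
  | succ i ih =>
    rw [pow_succ' (2 : ℕ), pow_succ', RingHom.mul_def, RingHom.comp_apply, mul_assoc]
    exact frobSeries_mem_ordIdeal σ ih

lemma map_frobSeries_pow {ι : R →+* K} {σ : R →+* R} {τ : K →+* K} (h : ∀ a, ι (σ a) = τ (ι a))
    (i : ℕ) (a : MvPowerSeries ν R) :
    MvPowerSeries.map ι ((frobSeries ν σ ^ i) a) =
      (frobSeries ν τ ^ i) (MvPowerSeries.map ι a) := by
  induction i with
  | zero => rfl
  | succ i ih =>
    simp only [pow_succ', RingHom.mul_def, RingHom.comp_apply, ← ih]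
    rw [frobSeries_apply, frobSeries_apply, MvPowerSeries.map_expand]
    congr 1
    ext e
    simp [h]

/-- `frobSeries` is a lift of the Frobenius if the twist is one. -/
lemma two_dvd_frobSeries_sub_pow {σ : R →+* R} (hσ : ∀ a, (2 : R) ∣ σ a - a ^ 2)
    (a : MvPowerSeries ν R) : (2 : MvPowerSeries ν R) ∣ frobSeries ν σ a - a ^ 2 := by
  let I : Ideal R := Ideal.span {2}
  let q := Ideal.Quotient.mk I
  have hq2 : q 2 = 0 := Ideal.Quotient.eq_zero_iff_mem.2 (Ideal.mem_span_singleton_self _)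
  by_cases hI : Nontrivial (R ⧸ I)
  swap
  -- If `2` is a unit of `R`, there is nothing to show.
  · have h1 : (1 : R) ∈ I := by
      rw [← Ideal.Quotient.eq_zero_iff_mem]
      exact @Subsingleton.elim _ (not_nontrivial_iff_subsingleton.1 hI) _ _
    obtain ⟨r, hr⟩ := Ideal.mem_span_singleton.1 h1
    refine ⟨MvPowerSeries.C r * (frobSeries ν σ a - a ^ 2), ?_⟩
    have : (2 : MvPowerSeries ν R) * MvPowerSeries.C r = 1 := by
      rw [← map_ofNat MvPowerSeries.C 2, ← map_mul, ← hr, map_one]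
    rw [← mul_assoc, this, one_mul]
  have : CharP (R ⧸ I) 2 := by
    refine CharTwo.of_one_ne_zero_of_two_eq_zero one_ne_zero ?_
    rw [← map_ofNat q 2]
    exact hq2
  have : ExpChar (R ⧸ I) 2 := ExpChar.prime Nat.prime_two
  have hfrob : ∀ c, q (σ c) = frobenius (R ⧸ I) 2 (q c) := by
    intro c
    rw [frobenius_def, ← map_pow, ← sub_eq_zero, ← map_sub]
    exact Ideal.Quotient.eq_zero_iff_mem.2 (Ideal.mem_span_singleton.2 (hσ c))
  have h0 : MvPowerSeries.map q (frobSeries ν σ a - a ^ 2) = 0 := by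
    rw [map_sub, map_pow, sub_eq_zero, ← MvPowerSeries.map_frobenius_expand 2 two_ne_zero,
      MvPowerSeries.map_expand, frobSeries_apply, MvPowerSeries.map_expand]
    congr 1
    ext e
    simp only [MvPowerSeries.coeff_map, hfrob]
  have hc : ∀ e, ∃ r, MvPowerSeries.coeff e (frobSeries ν σ a - a ^ 2) = 2 * r := by
    intro e
    have := congrArg (MvPowerSeries.coeff e) h0
    rw [MvPowerSeries.coeff_map, map_zero] at this
    exact Ideal.mem_span_singleton.1 (Ideal.Quotient.eq_zero_iff_mem.1 this)
  choose r hr using hc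
  obtain ⟨b, hb⟩ := exists_coeff_eq r
  refine ⟨b, ?_⟩
  ext e
  rw [hr, ← map_ofNat MvPowerSeries.C 2, MvPowerSeries.coeff_C_mul, hb]

namespace FunctionalEquation

variable {ι : R →+* K} {σ : R →+* R} {τ : K →+* K} {U : TwistedSeries σ} {ℓ : ℕ → K}
  (H : FunctionalEquation ι σ τ U ℓ)

/-- The sum over `i + j < M` of `ι(U_i) τ^i(ℓ_j) (φ^i(a)^(2^j) - a^(2^(i+j)))`, where `φ` is
`frobSeries`. It is the difference between `(1 + ∑ U_i φ^i) L(a)` and `2a` up to terms of degree at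
least `M`, and it vanishes if `a` is a variable. -/
def defect (U : TwistedSeries σ) (ι : R →+* K) (τ : K →+* K) (ℓ : ℕ → K) (M : ℕ)
    (a : MvPowerSeries ν K) : MvPowerSeries ν K :=
  ∑ k ∈ range M, ∑ p ∈ HasAntidiagonal.antidiagonal k,
    MvPowerSeries.C (ι (U.coeff p.1) * (τ ^ p.1) (ℓ p.2)) *
      (((frobSeries ν τ ^ p.1) a) ^ 2 ^ p.2 - a ^ 2 ^ k)

include H

/-- The operator `1 + ∑ U_i φ^i` maps `L(a)` to `2a`, up to the defect of `a` and terms of high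
degree, because `∑_{i+j=k} U_i φ^i(ℓ_j) = 2 δ_{k,0} - ℓ_k`. -/
lemma subst_add_sum_sub_mem {a : MvPowerSeries ν K} (ha : a.constantCoeff = 0) (M : ℕ)
    (hM : 0 < M) :
    (typicalSeries ℓ).subst a + ∑ i ∈ range M, MvPowerSeries.C (ι (U.coeff i)) *
      (frobSeries ν τ ^ i) ((typicalSeries ℓ).subst a) - 2 * a - defect U ι τ ℓ M a ∈
      ordIdeal ν K M := by
  set L := (typicalSeries ℓ).subst a
  set P := ∑ j ∈ range M, MvPowerSeries.C (ℓ j) * a ^ 2 ^ j with hP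
  set T : ℕ → ℕ → MvPowerSeries ν K := fun i j =>
    MvPowerSeries.C (ι (U.coeff i) * (τ ^ i) (ℓ j)) * ((frobSeries ν τ ^ i) a) ^ 2 ^ j with hT
  have hLP : L - P ∈ ordIdeal ν K M :=
    ordIdeal_antitone Nat.lt_two_pow_self.le (subst_typicalSeries_sub_mem ℓ M ha)
  have h1 : ∀ i, MvPowerSeries.C (ι (U.coeff i)) * (frobSeries ν τ ^ i) L -
      ∑ j ∈ range M, T i j ∈ ordIdeal ν K M := by
    intro i
    have hi := frobSeries_pow_mem_ordIdeal τ i hLP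
    have hi' := Ideal.mul_mem_left _ (MvPowerSeries.C (ι (U.coeff i)))
      (ordIdeal_antitone (Nat.le_mul_of_pos_left M (by positivity)) hi)
    convert hi' using 1
    rw [map_sub, mul_sub, hP, map_sum, mul_sum]
    congr 1
    refine sum_congr rfl fun j _ => ?_
    simp only [hT]
    rw [map_mul (frobSeries ν τ ^ i), frobSeries_pow_C, map_pow, map_mul, mul_assoc]
  have hTmem : ∀ i j, M ≤ i + j → T i j ∈ ordIdeal ν K M := by
    intro i j hij
    refine Ideal.mul_mem_left _ _ ?_
    have h := frobSeries_pow_mem_ordIdeal τ i (mem_ordIdeal_one ha)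
    have h2 : ∀ n, ((frobSeries ν τ ^ i) a) ^ n ∈ ordIdeal ν K (n * (2 ^ i * 1)) := by
      intro n
      induction n with
      | zero => simp [mem_ordIdeal]
      | succ n ih => rw [pow_succ, add_mul, one_mul]; exact mul_mem_ordIdeal ih h
    refine ordIdeal_antitone ?_ (h2 (2 ^ j))
    rw [mul_one, ← pow_add]
    exact hij.trans ((by omega : i + j = j + i) ▸ Nat.lt_two_pow_self.le)
  -- The double sum over a square differs from the one over a triangle by terms of high degree.
  have h2 : ∑ i ∈ range M, ∑ j ∈ range M, T i j -
      ∑ k ∈ range M, ∑ p ∈ HasAntidiagonal.antidiagonal k, T p.1 p.2 ∈ ordIdeal ν K M := by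
    rw [← sum_product', ← sum_filter_add_sum_filter_not (range M ×ˢ range M)
      (fun x => x.1 + x.2 < M)]
    have : ∑ x ∈ (range M ×ˢ range M) with x.1 + x.2 < M, T x.1 x.2 =
        ∑ k ∈ range M, ∑ p ∈ HasAntidiagonal.antidiagonal k, T p.1 p.2 := by
      rw [sum_sigma']
      refine sum_nbij' (fun x => ⟨x.1 + x.2, x⟩) (fun y => y.2) ?_ ?_ ?_ ?_ ?_
      · rintro ⟨i, j⟩ h
        simp only [mem_filter, mem_product, mem_range, mem_sigma,
          HasAntidiagonal.mem_antidiagonal] at h ⊢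
        exact ⟨h.2, trivial⟩
      · rintro ⟨k, ⟨i, j⟩⟩ h
        simp only [mem_filter, mem_product, mem_range, mem_sigma,
          HasAntidiagonal.mem_antidiagonal] at h ⊢
        omega
      · rintro ⟨i, j⟩ h
        rfl
      · rintro ⟨k, ⟨i, j⟩⟩ h
        simp only [mem_sigma, HasAntidiagonal.mem_antidiagonal] at h
        obtain ⟨-, rfl⟩ := h
        rfl
      · rintro ⟨i, j⟩ h
        rfl
    rw [this, add_sub_cancel_left]
    refine sum_mem fun x hx => hTmem _ _ ?_
    simp only [mem_filter, not_lt] at hx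
    exact hx.2
  have h3 : ∑ k ∈ range M, (MvPowerSeries.C (ℓ k) * a ^ 2 ^ k +
      ∑ p ∈ HasAntidiagonal.antidiagonal k,
        MvPowerSeries.C (ι (U.coeff p.1) * (τ ^ p.1) (ℓ p.2)) * a ^ 2 ^ k) = 2 * a := by
    have : ∀ k, MvPowerSeries.C (ℓ k) * a ^ 2 ^ k + ∑ p ∈ HasAntidiagonal.antidiagonal k,
        MvPowerSeries.C (ι (U.coeff p.1) * (τ ^ p.1) (ℓ p.2)) * a ^ 2 ^ k =
        MvPowerSeries.C (if k = 0 then 2 else 0) * a ^ 2 ^ k := by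
      intro k
      rw [← H.coeff_eq k, map_add, map_sum, add_mul, sum_mul]
    simp only [this]
    rw [sum_eq_single_of_mem 0 (mem_range.2 hM)]
    · rw [if_pos rfl, pow_zero, pow_one, map_ofNat]
    · intro k _ hk
      rw [if_neg hk, map_zero, zero_mul]
  have h4 := add_mem (add_mem hLP (sum_mem fun i (_ : i ∈ range M) => h1 i)) h2
  convert h4 using 1
  rw [← h3, defect, hP]
  simp only [mul_sub, sum_add_distrib, sum_sub_distrib, hT]
  ring

/-- The defect of a series over `R` is twice a series over `R`: the denominator `2^j` of `ℓ_j` is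
compensated by the congruence `φ^i(a)^(2^j) ≡ a^(2^(i+j))` modulo `2^(j+1)`. -/
lemma exists_two_mul_eq_defect [IsDomain K] [CharZero K] (M : ℕ) (g : MvPowerSeries ν R) :
    ∃ δ : MvPowerSeries ν R,
      2 * MvPowerSeries.map ι δ = defect U ι τ ℓ M (MvPowerSeries.map ι g) := by
  have key : ∀ k (p : ℕ × ℕ), ∃ δ : MvPowerSeries ν R, p.1 + p.2 = k →
      2 * MvPowerSeries.map ι δ = MvPowerSeries.C (ι (U.coeff p.1) * (τ ^ p.1) (ℓ p.2)) *
      (((frobSeries ν τ ^ p.1) (MvPowerSeries.map ι g)) ^ 2 ^ p.2 -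
        (MvPowerSeries.map ι g) ^ 2 ^ k) := by
    intro k p
    obtain ⟨c, hc⟩ := H.exists_two_pow_mul_log p.2
    obtain ⟨f, hf⟩ := two_pow_dvd_pow_sub_pow (two_dvd_iterate_sub_pow
      (two_dvd_frobSeries_sub_pow (ν := ν) H.frob) p.1 g) p.2
    refine ⟨MvPowerSeries.C (U.coeff p.1 * (σ ^ p.1) c) * f, ?_⟩
    rintro rfl
    have hf' := congrArg (MvPowerSeries.map ι) hf
    rw [map_sub, map_pow, map_frobSeries_pow H.comm, map_pow (MvPowerSeries.map ι),
      map_pow (MvPowerSeries.map ι), map_mul, map_pow (MvPowerSeries.map ι), map_ofNat,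
      ← pow_mul, ← pow_add] at hf'
    rw [hf', map_mul, MvPowerSeries.map_C, map_mul ι, H.map_iterate, hc, map_mul (τ ^ p.1),
      map_pow (τ ^ p.1), map_ofNat (τ ^ p.1)]
    simp only [map_mul, map_pow, map_ofNat]
    ring
  choose δ hδ using key
  refine ⟨∑ k ∈ range M, ∑ p ∈ HasAntidiagonal.antidiagonal k, δ k p, ?_⟩
  rw [defect, map_sum, mul_sum]
  refine sum_congr rfl fun k _ => ?_
  rw [map_sum, mul_sum]
  exact sum_congr rfl fun p hp => hδ k p (HasAntidiagonal.mem_antidiagonal.1 hp)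

omit H in
/-- The terms of degree `r` of the defect only depend on the terms of lower degree. -/
lemma defect_sub_defect_mem {r M : ℕ} (hr : 0 < r) {a b : MvPowerSeries ν K}
    (ha : a.constantCoeff = 0) (hb : b.constantCoeff = 0) (hab : a - b ∈ ordIdeal ν K r) :
    defect U ι τ ℓ M a - defect U ι τ ℓ M b ∈ ordIdeal ν K (r + 1) := by
  have hsq : ∀ k, k ≠ 0 → a ^ 2 ^ k - b ^ 2 ^ k ∈ ordIdeal ν K (r + 1) := by
    intro k hk
    obtain ⟨k, rfl⟩ := Nat.exists_eq_succ_of_ne_zero hk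
    have h1 : a ^ 2 - b ^ 2 ∈ ordIdeal ν K (r + 1) := by
      rw [show a ^ 2 - b ^ 2 = (a - b) * (a + b) by ring]
      exact mul_mem_ordIdeal hab (mem_ordIdeal_one (by rw [map_add, ha, hb, add_zero]))
    rw [pow_succ', pow_mul, pow_mul]
    exact Ideal.mem_of_dvd _ (sub_dvd_pow_sub_pow _ _ _) h1
  rw [defect, defect, ← sum_sub_distrib]
  refine sum_mem fun k _ => ?_
  rw [← sum_sub_distrib]
  refine sum_mem fun p hp => ?_
  rw [← mul_sub]
  refine Ideal.mul_mem_left _ _ ?_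
  have hk := HasAntidiagonal.mem_antidiagonal.1 hp
  by_cases hp0 : p.1 = 0
  · have : p.2 = k := by omega
    simp [hp0, this]
  · have h1 : (frobSeries ν τ ^ p.1) a - (frobSeries ν τ ^ p.1) b ∈ ordIdeal ν K (r + 1) := by
      rw [← map_sub]
      refine ordIdeal_antitone ?_ (frobSeries_pow_mem_ordIdeal τ p.1 hab)
      have : 2 ^ 1 ≤ 2 ^ p.1 := Nat.pow_le_pow_right (by norm_num) (by omega)
      nlinarith
    rw [sub_sub_sub_comm]
    exact sub_mem (Ideal.mem_of_dvd _ (sub_dvd_pow_sub_pow _ _ _) h1) (hsq k (by omega))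

/-- The formal sum `f = L⁻¹(∑ L(X_i))` of variables has coefficients in `R`. As the defects of the
variables vanish, `2f` is `2 ∑ X_i` minus the defect of `f`, which determines the coefficients of
`f` degree by degree. -/
lemma exists_map_eq_of_subst_eq [IsDomain K] [CharZero K] (s : Finset ν)
    {f : MvPowerSeries ν K} (hf : f.constantCoeff = 0)
    (h : (typicalSeries ℓ).subst f =
      ∑ i ∈ s, (typicalSeries ℓ).subst (MvPowerSeries.X i : MvPowerSeries ν K)) :
    ∃ Φ : MvPowerSeries ν R, MvPowerSeries.map ι Φ = f := by
  have hX : ∀ i : ν, (MvPowerSeries.X i : MvPowerSeries ν K).constantCoeff = 0 :=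
    fun i => MvPowerSeries.constantCoeff_X i
  have hdX : ∀ (M : ℕ) (i : ν), defect U ι τ ℓ M (MvPowerSeries.X i) = 0 := by
    intro M i
    refine sum_eq_zero fun k _ => sum_eq_zero fun p hp => ?_
    rw [frobSeries_pow_X, ← pow_mul, ← pow_add, HasAntidiagonal.mem_antidiagonal.1 hp, sub_self,
      mul_zero]
  have hrel : ∀ M, 0 < M → 2 * (∑ i ∈ s, MvPowerSeries.X i - f) - defect U ι τ ℓ M f ∈
      ordIdeal ν K M := by
    intro M hM
    have h1 := H.subst_add_sum_sub_mem hf M hM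
    have h2 := sum_mem (t := s) fun i (_ : i ∈ s) => H.subst_add_sum_sub_mem (hX i) M hM
    have h3 := sub_mem h1 h2
    convert h3 using 1
    simp only [hdX, sub_zero, sum_sub_distrib, sum_add_distrib, h, ← mul_sum]
    rw [sum_comm]
    simp only [← mul_sum, ← map_sum]
    ring
  have hstep : ∀ r, 0 < r → ∃ g : MvPowerSeries ν R, g.constantCoeff = 0 ∧
      f - MvPowerSeries.map ι g ∈ ordIdeal ν K r := by
    intro r hr
    induction r, hr using Nat.le_induction with
    | base => exact ⟨0, by simp, by simpa using mem_ordIdeal_one hf⟩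
    | succ r hr ih =>
      obtain ⟨g, hg, hfg⟩ := ih
      have hgK : (MvPowerSeries.map ι g).constantCoeff = 0 := by
        rw [MvPowerSeries.constantCoeff_map, hg, map_zero]
      obtain ⟨δ, hδ⟩ := H.exists_two_mul_eq_defect (r + 1) g
      have h1 := hrel (r + 1) (by omega)
      have h2 := defect_sub_defect_mem (U := U) (ι := ι) (τ := τ) (ℓ := ℓ) (M := r + 1) hr hf hgK
        hfg
      rw [← hδ] at h2
      -- If `δ` is half of the defect of `g`, then `∑ X_i - δ` approximates `f` better than `g`
      -- does.
      have h3 : 2 * (f - MvPowerSeries.map ι (∑ i ∈ s, MvPowerSeries.X i - δ)) ∈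
          ordIdeal ν K (r + 1) := by
        have := neg_mem (add_mem h1 h2)
        convert this using 1
        simp only [map_sub, map_sum, MvPowerSeries.map_X]
        ring
      have h4 : f - MvPowerSeries.map ι (∑ i ∈ s, MvPowerSeries.X i - δ) ∈
          ordIdeal ν K (r + 1) := by
        rw [mem_ordIdeal_iff] at h3 ⊢
        intro e he
        have := h3 e he
        rw [← map_ofNat MvPowerSeries.C 2, MvPowerSeries.coeff_C_mul] at this
        exact (mul_eq_zero.1 this).resolve_left two_ne_zero
      refine ⟨_, ?_, h4⟩
      have h5 := mem_ordIdeal_iff.1 h4 0 (by simp)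
      rw [map_sub, MvPowerSeries.coeff_zero_eq_constantCoeff_apply, hf, zero_sub, neg_eq_zero,
        MvPowerSeries.coeff_map] at h5
      rw [← MvPowerSeries.coeff_zero_eq_constantCoeff_apply]
      exact H.inj (by rw [h5, map_zero])
  have hcoeff : ∀ e, ∃ c, ι c = MvPowerSeries.coeff e f := by
    intro e
    obtain ⟨g, -, hg⟩ := hstep (e.degree + 1) (by omega)
    have := mem_ordIdeal_iff.1 hg e (by omega)
    rw [map_sub, sub_eq_zero, MvPowerSeries.coeff_map] at this
    exact ⟨_, this.symm⟩
  choose c hc using hcoeff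
  obtain ⟨Φ, hΦ⟩ := exists_coeff_eq c
  refine ⟨Φ, ?_⟩
  ext e
  rw [MvPowerSeries.coeff_map, ← hc, hΦ]

/-- Functional equation lemma: a logarithm with a functional equation belongs to a commutative
formal group law over `R`. -/
theorem exists_formalGroup [IsDomain K] [CharZero K] :
    ∃ F : FormalGroup R, F.IsComm ∧ IsLog (F.map ι) (typicalSeries ℓ) := by
  have h0 := constantCoeff_typicalSeries ℓ
  have h1 : PowerSeries.coeff 1 (typicalSeries ℓ) = 1 := by
    rw [coeff_one_typicalSeries, H.log_zero]
  have hX : ∀ i : Fin 2, ((typicalSeries ℓ).subst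
      (MvPowerSeries.X i : MvPowerSeries (Fin 2) K)).constantCoeff = 0 :=
    fun i => constantCoeff_subst_zero (MvPowerSeries.constantCoeff_X i) h0
  obtain ⟨f, hf, hLf⟩ := exists_subst_eq (b := (typicalSeries ℓ).subst
      (MvPowerSeries.X 0 : MvPowerSeries (Fin 2) K) +
      (typicalSeries ℓ).subst (MvPowerSeries.X 1 : MvPowerSeries (Fin 2) K))
      (by rw [map_add, hX, hX, add_zero]) h0 h1
  obtain ⟨Φ, rfl⟩ := H.exists_map_eq_of_subst_eq Finset.univ hf
    (by rw [hLf, Fin.sum_univ_two])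
  refine RealLubinTate.exists_formalGroup H.inj h0 h1 ?_ hLf
  apply H.inj
  rw [← MvPowerSeries.constantCoeff_map, hf, map_zero]

end FunctionalEquation

end Integrality

/-! ### The logarithm of the canonical formal group law -/

section Orbit

variable {B : Type*} [CommRing B] {n : ℕ} {g : B →+* B} {orb : Fin (2 ^ (n - 1)) → B}

lemma pow_apply_orbit (hg : ∀ r, g (orb r) = gammaOrbit n orb r) (s r : ℕ)
    (h : r + s < 2 ^ (n - 1)) :
    (g ^ s) (orb ⟨r, by omega⟩) = orb ⟨r + s, h⟩ := by
  induction s with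
  | zero => rfl
  | succ s ih =>
    rw [pow_succ', RingHom.mul_def, RingHom.comp_apply, ih (by omega), hg, gammaOrbit,
      dif_pos (by simpa [add_assoc] using h)]
    simp [add_assoc]

lemma pow_two_pow_apply_orbit (hg : ∀ r, g (orb r) = gammaOrbit n orb r)
    (r : Fin (2 ^ (n - 1))) : (g ^ 2 ^ (n - 1)) (orb r) = -orb r := by
  obtain ⟨r, hr⟩ := r
  have h1 : g ^ 2 ^ (n - 1) = g ^ r * (g * g ^ (2 ^ (n - 1) - 1 - r)) := by
    rw [← pow_succ', ← pow_add]
    congr 1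
    omega
  have h2 := pow_apply_orbit hg (2 ^ (n - 1) - 1 - r) r (by omega)
  have h3 := pow_apply_orbit hg r 0 (by omega)
  rw [h1, RingHom.mul_def, RingHom.mul_def, RingHom.comp_apply, RingHom.comp_apply]
  rw [h2, hg, gammaOrbit, dif_neg (by simp; omega), map_neg, h3]
  simp

end Orbit

section CanonicalLog

open Finset

variable (n : ℕ)

/-- The ring `ℚ ⊗ 𝓡_n`, as a polynomial ring. -/
abbrev RatRing : Type := MvPolynomial (ℕ × Fin (2 ^ (n - 1))) ℚ

/-- The inclusion `ℤ_(2) → ℚ`. -/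
def zLocToRat : ZLocTwo →+* ℚ :=
  IsLocalization.lift (M := (Ideal.span {(2 : ℤ)}).primeCompl) (g := Int.castRingHom ℚ) fun y => by
    rw [isUnit_iff_ne_zero, eq_intCast, Int.cast_ne_zero]
    exact fun h => y.2 (h ▸ zero_mem _)

lemma zLocToRat_injective : Function.Injective zLocToRat := by
  refine (IsLocalization.lift_injective_iff _).2 fun x y => ?_
  have hinj : Function.Injective (algebraMap ℤ ZLocTwo) :=
    IsLocalization.injective ZLocTwo
      (Ideal.primeCompl_le_nonZeroDivisors (Ideal.span {(2 : ℤ)}))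
  rw [hinj.eq_iff, eq_intCast, eq_intCast, Int.cast_inj]

lemma two_dvd_sub_sq (c : ZLocTwo) : (2 : ZLocTwo) ∣ c - c ^ 2 := by
  obtain ⟨⟨x, y⟩, hxy⟩ := IsLocalization.surj (Ideal.span {(2 : ℤ)}).primeCompl c
  have hu : IsUnit (algebraMap ℤ ZLocTwo y) := IsLocalization.map_units _ y
  have hyodd : ¬ Even (y : ℤ) := fun h =>
    y.2 (Ideal.mem_span_singleton.2 (even_iff_two_dvd.1 h))
  have heven : Even (x * y - x ^ 2) := by
    rw [Int.even_sub, Int.even_mul, Int.even_pow]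
    simp [hyodd]
  obtain ⟨z, hz⟩ := even_iff_two_dvd.1 heven
  have h : (c - c ^ 2) * algebraMap ℤ ZLocTwo y ^ 2 = 2 * algebraMap ℤ ZLocTwo z := by
    have := congrArg (algebraMap ℤ ZLocTwo) hz
    simp only [map_sub, map_mul, map_pow, map_ofNat] at this
    rw [← this, ← hxy]
    ring
  exact (hu.pow 2).dvd_mul_right.1 (Dvd.intro _ h.symm)

/-- The inclusion `𝓡_n → ℚ ⊗ 𝓡_n`. -/
def toRat : RRing n →+* RatRing n := MvPolynomial.map zLocToRat

lemma toRat_injective : Function.Injective (toRat n) :=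
  MvPolynomial.map_injective _ zLocToRat_injective

@[simp] lemma toRat_X (x : ℕ × Fin (2 ^ (n - 1))) :
    toRat n (MvPolynomial.X x) = MvPolynomial.X x := MvPolynomial.map_X _ _

/-- The action of `γ` on `ℚ ⊗ 𝓡_n`. -/
def gammaRat : RatRing n →+* RatRing n :=
  (MvPolynomial.aeval fun x : ℕ × Fin (2 ^ (n - 1)) =>
    gammaOrbit n (fun r => (MvPolynomial.X (x.1, r) : RatRing n)) x.2 :
      RatRing n →ₐ[ℚ] RatRing n).toRingHom

lemma gammaR_X (i : ℕ) (r : Fin (2 ^ (n - 1))) : gammaR n (MvPolynomial.X (i, r)) =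
    gammaOrbit n (fun r => (MvPolynomial.X (i, r) : RRing n)) r := by
  simp [gammaR]

lemma gammaRat_X (i : ℕ) (r : Fin (2 ^ (n - 1))) : gammaRat n (MvPolynomial.X (i, r)) =
    gammaOrbit n (fun r => (MvPolynomial.X (i, r) : RatRing n)) r := by
  simp [gammaRat]

lemma toRat_gammaR (a : RRing n) : toRat n (gammaR n a) = gammaRat n (toRat n a) := by
  have : (toRat n).comp (gammaR n) = (gammaRat n).comp (toRat n) := by
    refine MvPolynomial.ringHom_ext' ?_ fun x => ?_
    · exact IsLocalization.ringHom_ext (Ideal.span {(2 : ℤ)}).primeCompl (RingHom.ext_int _ _)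
    · rw [RingHom.comp_apply, RingHom.comp_apply, toRat_X, gammaR_X, gammaRat_X]
      unfold gammaOrbit
      split_ifs <;> simp
  exact RingHom.congr_fun this a

lemma toRat_gammaR_pow (s : ℕ) (a : RRing n) :
    toRat n ((gammaR n ^ s) a) = (gammaRat n ^ s) (toRat n a) := by
  induction s with
  | zero => rfl
  | succ s ih => simp only [pow_succ', RingHom.mul_def, RingHom.comp_apply, toRat_gammaR, ih]

/-- The lift of the Frobenius of `𝓡_n` with `X ↦ X^2` for all variables. -/
def sigmaR : RRing n →+* RRing n := (MvPolynomial.expand 2 : RRing n →ₐ[ZLocTwo] RRing n).toRingHom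

/-- The extension of `sigmaR` to `ℚ ⊗ 𝓡_n`. -/
def sigmaRat : RatRing n →+* RatRing n :=
  (MvPolynomial.expand 2 : RatRing n →ₐ[ℚ] RatRing n).toRingHom

lemma toRat_sigmaR (a : RRing n) : toRat n (sigmaR n a) = sigmaRat n (toRat n a) :=
  MvPolynomial.map_expand _ _ _

lemma sigmaR_X (x : ℕ × Fin (2 ^ (n - 1))) :
    sigmaR n (MvPolynomial.X x) = MvPolynomial.X x ^ 2 := MvPolynomial.expand_X _ _

lemma sigmaRat_X (x : ℕ × Fin (2 ^ (n - 1))) :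
    sigmaRat n (MvPolynomial.X x) = MvPolynomial.X x ^ 2 := MvPolynomial.expand_X _ _

lemma two_dvd_sigmaR_sub_sq (a : RRing n) : (2 : RRing n) ∣ sigmaR n a - a ^ 2 := by
  induction a using MvPolynomial.induction_on with
  | C c =>
    obtain ⟨d, hd⟩ := two_dvd_sub_sq c
    refine ⟨MvPolynomial.C d, ?_⟩
    have : sigmaR n (MvPolynomial.C c) = MvPolynomial.C c := MvPolynomial.expand_C _ _
    rw [this, ← map_pow, ← map_sub, hd, map_mul, map_ofNat]
  | add p q hp hq =>
    have : sigmaR n (p + q) - (p + q) ^ 2 =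
        (sigmaR n p - p ^ 2) + (sigmaR n q - q ^ 2) - 2 * (p * q) := by
      rw [map_add]; ring
    rw [this]
    exact dvd_sub (dvd_add hp hq) (dvd_mul_right _ _)
  | mul_X p x hp =>
    rw [map_mul, sigmaR_X, mul_pow, ← sub_mul]
    exact hp.mul_right _

/-- The action of `γ^(2^(n-1))` changes the sign of all variables. -/
lemma gammaRat_pow_X (x : ℕ × Fin (2 ^ (n - 1))) :
    (gammaRat n ^ 2 ^ (n - 1)) (MvPolynomial.X x) = -MvPolynomial.X x :=
  pow_two_pow_apply_orbit (orb := fun r => (MvPolynomial.X (x.1, r) : RatRing n))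
    (fun r => gammaRat_X n x.1 r) x.2

/-- The elements `γ^s t_i` for `s < 2^(n-1)`. -/
lemma gammaRat_pow_tR (s : ℕ) (hs : s < 2 ^ (n - 1)) (i : ℕ) :
    (gammaRat n ^ s) (toRat n (tR n (i + 1))) = MvPolynomial.X (i, ⟨s, hs⟩) := by
  have := pow_apply_orbit (orb := fun r => (MvPolynomial.X (i, r) : RatRing n))
    (fun r => gammaRat_X n i r) s 0 (by omega)
  simpa [tR] using this

lemma gammaR_pow_tR (s : ℕ) (hs : s < 2 ^ (n - 1)) (i : ℕ) :
    (gammaR n ^ s) (tR n (i + 1)) = MvPolynomial.X (i, ⟨s, hs⟩) :=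
  toRat_injective n (by rw [toRat_gammaR_pow, gammaRat_pow_tR n s hs, toRat_X])

/-- The coefficients `ℓ` of the logarithm `∑ ℓ_k x^(2^k)` of the canonical formal group law. -/
structure IsCanonicalLog (ℓ : ℕ → RatRing n) : Prop where
  zero : ℓ 0 = 1
  recursion : ∀ k, ℓ k = ∑ p ∈ HasAntidiagonal.antidiagonal k,
    gammaRat n (ℓ p.1) * toRat n (tR n p.2) ^ 2 ^ p.1
  neg : ∀ k, k ≠ 0 → (gammaRat n ^ 2 ^ (n - 1)) (ℓ k) = -ℓ k

/-- The part of the recursion for `ℓ_k` that involves lower terms only. -/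
def lowerPart (ℓ : ℕ → RatRing n) (k : ℕ) : RatRing n :=
  ∑ j ∈ range k, gammaRat n (ℓ j) * toRat n (tR n (k - j)) ^ 2 ^ j

lemma sum_antidiagonal_eq_lowerPart (ℓ : ℕ → RatRing n) (k : ℕ) :
    ∑ p ∈ HasAntidiagonal.antidiagonal k, gammaRat n (ℓ p.1) * toRat n (tR n p.2) ^ 2 ^ p.1 =
      lowerPart n ℓ k + gammaRat n (ℓ k) := by
  rw [Nat.sum_antidiagonal_eq_sum_range_succ_mk, sum_range_succ, lowerPart]
  simp [tR]

lemma sum_pow_sub_eq {B : Type*} [CommRing B] (g : B →+* B) (a : B) (M : ℕ) :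
    ∑ s ∈ range M, (g ^ s) (a - g a) = a - (g ^ M) a := by
  have h : ∀ s, (g ^ s) (a - g a) = (g ^ s) a - (g ^ (s + 1)) a := by
    intro s
    rw [map_sub, pow_succ, RingHom.mul_def, RingHom.comp_apply]
  simp only [h, sum_range_sub' (fun s => (g ^ s) a)]
  rfl

namespace IsCanonicalLog

variable {n} {ℓ ℓ' : ℕ → RatRing n}

/-- Summation of `ℓ_k - γ(ℓ_k)` over the orbit expresses `2 ℓ_k` by lower terms. -/
lemma two_mul_eq (h : IsCanonicalLog n ℓ) (k : ℕ) (hk : k ≠ 0) :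
    2 * ℓ k = ∑ s ∈ range (2 ^ (n - 1)), (gammaRat n ^ s) (lowerPart n ℓ k) := by
  have h1 : lowerPart n ℓ k = ℓ k - gammaRat n (ℓ k) := by
    rw [eq_sub_iff_add_eq, ← sum_antidiagonal_eq_lowerPart, ← h.recursion]
  rw [h1, sum_pow_sub_eq, h.neg k hk]
  ring

lemma unique (h : IsCanonicalLog n ℓ) (h' : IsCanonicalLog n ℓ') : ℓ = ℓ' := by
  funext k
  induction k using Nat.strong_induction_on with
  | _ k ih =>
    by_cases hk : k = 0
    · rw [hk, h.zero, h'.zero]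
    · have : lowerPart n ℓ k = lowerPart n ℓ' k :=
        sum_congr rfl fun j hj => by rw [ih j (mem_range.1 hj)]
      refine mul_left_cancel₀ (two_ne_zero : (2 : RatRing n) ≠ 0) ?_
      rw [h.two_mul_eq k hk, h'.two_mul_eq k hk, this]

end IsCanonicalLog

/-- The formula for `2 ℓ_k` in terms of lower terms defines a canonical logarithm. -/
theorem exists_isCanonicalLog : ∃ ℓ, IsCanonicalLog n ℓ := by
  let lrec : ∀ k : ℕ, (∀ i, i < k → RatRing n) → RatRing n := fun k f =>
    if k = 0 then 1 else MvPolynomial.C (1 / 2) * ∑ s ∈ range (2 ^ (n - 1)), (gammaRat n ^ s)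
      (∑ j : Fin k, gammaRat n (f j j.2) * toRat n (tR n (k - j)) ^ 2 ^ j.1)
  let ℓ : ℕ → RatRing n := fun k => Nat.strongRec (motive := fun _ => RatRing n) lrec k
  have hℓ : ∀ k, ℓ k = if k = 0 then 1 else MvPolynomial.C (1 / 2) *
      ∑ s ∈ range (2 ^ (n - 1)), (gammaRat n ^ s) (lowerPart n ℓ k) := by
    intro k
    change Nat.strongRec (motive := fun _ => RatRing n) lrec k = _
    rw [Nat.strongRec_eq, lowerPart,
      sum_range fun j => gammaRat n (ℓ j) * toRat n (tR n (k - j)) ^ 2 ^ j]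
  have hhalf : (2 : RatRing n) * MvPolynomial.C (1 / 2) = 1 := by
    rw [← map_ofNat (MvPolynomial.C : ℚ →+* RatRing n) 2, ← map_mul]
    norm_num
  have hzero : ℓ 0 = 1 := by rw [hℓ, if_pos rfl]
  have hpow : ∀ (s : ℕ) (a : ℚ), (gammaRat n ^ s) (MvPolynomial.C a) = MvPolynomial.C a := by
    intro s a
    induction s with
    | zero => rfl
    | succ s ih =>
      rw [pow_succ', RingHom.mul_def, RingHom.comp_apply, ih]
      exact MvPolynomial.aeval_C _ _
  have hcomm : ∀ (s t : ℕ) (a : RatRing n),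
      (gammaRat n ^ s) ((gammaRat n ^ t) a) = (gammaRat n ^ t) ((gammaRat n ^ s) a) := by
    intro s t a
    rw [← RingHom.comp_apply, ← RingHom.mul_def, ← pow_add, add_comm, pow_add]
    rfl
  have hcomm1 : ∀ (s : ℕ) (a : RatRing n),
      (gammaRat n ^ s) (gammaRat n a) = gammaRat n ((gammaRat n ^ s) a) := by
    intro s a
    simpa using hcomm s 1 a
  -- The summand `γ(ℓ_j) t_(k-j)^(2^j)` of `lowerPart` changes its sign under `γ^N`: for `j = 0`
  -- only the second factor does, for `j > 0` only the first one.
  have hneg : ∀ k, k ≠ 0 → (gammaRat n ^ 2 ^ (n - 1)) (lowerPart n ℓ k) = -lowerPart n ℓ k ∧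
      (gammaRat n ^ 2 ^ (n - 1)) (ℓ k) = -ℓ k := by
    intro k
    induction k using Nat.strong_induction_on with
    | _ k ih =>
      intro hk
      have h1 : (gammaRat n ^ 2 ^ (n - 1)) (lowerPart n ℓ k) = -lowerPart n ℓ k := by
        rw [lowerPart, map_sum, ← sum_neg_distrib]
        refine sum_congr rfl fun j hj => ?_
        have hjk := mem_range.1 hj
        obtain ⟨i, hi⟩ : ∃ i, k - j = i + 1 := ⟨k - j - 1, by omega⟩
        have ht :
            (gammaRat n ^ 2 ^ (n - 1)) (toRat n (tR n (k - j))) = -toRat n (tR n (k - j)) := by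
          rw [hi, tR, toRat_X, gammaRat_pow_X]
        rw [map_mul, map_pow, ht, hcomm1]
        by_cases hj0 : j = 0
        · subst hj0
          rw [hzero, map_one, map_one]
          simp
        · rw [(ih j hjk hj0).2, map_neg, Even.neg_pow ((Nat.even_pow.2 ⟨even_two, hj0⟩))]
          ring
      refine ⟨h1, ?_⟩
      rw [hℓ, if_neg hk, map_mul, hpow, map_sum, ← mul_neg, ← sum_neg_distrib]
      congr 1
      refine sum_congr rfl fun s _ => ?_
      rw [hcomm, h1, map_neg]
  refine ⟨ℓ, hzero, fun k => ?_, fun k hk => (hneg k hk).2⟩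
  rw [sum_antidiagonal_eq_lowerPart]
  by_cases hk : k = 0
  · subst hk
    simp [hzero, lowerPart]
  · rw [← sub_eq_iff_eq_add]
    refine mul_left_cancel₀ (two_ne_zero : (2 : RatRing n) ≠ 0) ?_
    have h2 : 2 * ℓ k = ∑ s ∈ range (2 ^ (n - 1)), (gammaRat n ^ s) (lowerPart n ℓ k) := by
      rw [hℓ, if_neg hk, ← mul_assoc, hhalf, one_mul]
    have h3 : 2 * gammaRat n (ℓ k) =
        ∑ s ∈ range (2 ^ (n - 1)), (gammaRat n ^ s) (gammaRat n (lowerPart n ℓ k)) := by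
      rw [← map_ofNat (gammaRat n) 2, ← map_mul, h2, map_sum]
      simp only [hcomm1]
    rw [mul_sub, h2, h3, ← sum_sub_distrib]
    simp only [← map_sub]
    rw [sum_pow_sub_eq, (hneg k hk).1]
    ring

/-! ### The functional equation of the canonical logarithm -/

/-- The twisted power series `T_s = ∑ γ^s(t_i) φ^i`, where `t_0 = 1`. -/
def twistT (s : ℕ) : TwistedSeries (sigmaR n) := ⟨fun i => (gammaR n ^ s) (tR n i)⟩

/-- The product `T_(s-1) ⋯ T_1 T_0` of the twisted power series `T_s = ∑ γ^s(t_i) φ^i`. -/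
def twistProd : ℕ → TwistedSeries (sigmaR n)
  | 0 => 1
  | s + 1 => twistT n s * twistProd s

lemma coeff_zero_twistProd (s : ℕ) : (twistProd n s).coeff 0 = 1 := by
  induction s with
  | zero => rfl
  | succ s ih => rw [twistProd, TwistedSeries.coeff_mul_zero, ih]; simp [twistT, tR]

lemma sigmaRat_pow_gammaRat_pow_tR (s : ℕ) (hs : s < 2 ^ (n - 1)) (i j : ℕ) :
    (sigmaRat n ^ j) ((gammaRat n ^ s) (toRat n (tR n i))) =
      (gammaRat n ^ s) (toRat n (tR n i)) ^ 2 ^ j := by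
  cases i with
  | zero => simp [tR]
  | succ i =>
    rw [gammaRat_pow_tR n s hs]
    induction j with
    | zero => simp
    | succ j ih =>
      rw [pow_succ', RingHom.mul_def, RingHom.comp_apply, ih, map_pow, sigmaRat_X, ← pow_mul,
        pow_succ']

variable {n} {ℓ : ℕ → RatRing n}

namespace IsCanonicalLog

/-- The relation `ℓ = γ^s(ℓ) T_(s-1) ⋯ T_0`. -/
lemma eq_mul_twistProd (h : IsCanonicalLog n ℓ) (s : ℕ) (hs : s ≤ 2 ^ (n - 1)) :
    (⟨ℓ⟩ : TwistedSeries (sigmaRat n)) = ⟨fun k => (gammaRat n ^ s) (ℓ k)⟩ *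
      TwistedSeries.map (toRat n) (toRat_sigmaR n) (twistProd n s) := by
  induction s with
  | zero => rw [twistProd, map_one, mul_one]; rfl
  | succ s ih =>
    rw [ih (by omega), twistProd, map_mul, ← mul_assoc]
    congr 1
    refine TwistedSeries.ext (funext fun k => ?_)
    rw [TwistedSeries.coeff_mul]
    simp only [TwistedSeries.coeff_map, twistT, toRat_gammaR_pow]
    conv_lhs => rw [h.recursion k, map_sum]
    refine sum_congr rfl fun p _ => ?_
    rw [map_mul, map_pow, sigmaRat_pow_gammaRat_pow_tR n s (by omega), pow_succ (gammaRat n),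
      RingHom.mul_def, RingHom.comp_apply]

/-- The functional equation `(1 + T⁻¹) ℓ = 2`, where `T = T_(N-1) ⋯ T_0`. It holds because
`ℓ = γ^N(ℓ) T` and `γ^N(ℓ) = 2 - ℓ`. -/
theorem exists_functionalEquation (h : IsCanonicalLog n ℓ) : ∃ U : TwistedSeries (sigmaR n),
    twistProd n (2 ^ (n - 1)) * U = 1 ∧
      FunctionalEquation (toRat n) (sigmaR n) (sigmaRat n) U ℓ := by
  set T := twistProd n (2 ^ (n - 1)) with hT
  obtain ⟨U, hU0, hTU⟩ := TwistedSeries.exists_mul_eq_one T (coeff_zero_twistProd n _)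
  refine ⟨U, hTU, toRat_injective n, toRat_sigmaR n, two_dvd_sigmaR_sub_sq n, hU0, ?_⟩
  set L : TwistedSeries (sigmaRat n) := ⟨ℓ⟩
  set T' := TwistedSeries.map (toRat n) (toRat_sigmaR n) T
  set U' := TwistedSeries.map (toRat n) (toRat_sigmaR n) U
  have hTU' : T' * U' = 1 := by rw [← map_mul, hTU, map_one]
  have hneg : (⟨fun k => (gammaRat n ^ 2 ^ (n - 1)) (ℓ k)⟩ : TwistedSeries (sigmaRat n)) =
      2 - L := by
    refine TwistedSeries.ext (funext fun k => ?_)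
    rw [TwistedSeries.coeff_sub, TwistedSeries.coeff_two]
    split_ifs with hk
    · subst hk
      simp only [L, h.zero, map_one]
      norm_num
    · simp only [L, h.neg k hk, zero_sub]
  have h1 : L = (2 - L) * T' := by
    have := h.eq_mul_twistProd _ le_rfl
    rwa [hneg] at this
  have h2 : L * (1 + U') = 2 := by
    have : L * U' = 2 - L := by
      conv_lhs => rw [h1, mul_assoc, hTU', mul_one]
    rw [mul_add, mul_one, this]
    abel
  -- From `ℓ (1 + U) = 2` one passes to `(1 + U) ℓ = 2` by conjugation with the unit `ℓ`.
  obtain ⟨L', hL'⟩ := TwistedSeries.isUnit_of_coeff_zero L h.zero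
  have h3 : (1 + U') = ↑L'⁻¹ * 2 := by
    rw [← h2, ← hL', Units.inv_mul_cancel_left]
  rw [h3, mul_assoc, two_mul, ← mul_two, ← hL', Units.inv_mul_cancel_left]

end IsCanonicalLog

end CanonicalLog

/-! ### Strict isomorphisms and logarithms -/

section StrictIso

variable {R K : Type*} [CommRing R] [CommRing K]

lemma constantCoeff_map_eq_zero (f : R →+* K) {ψ : PowerSeries R}
    (h : PowerSeries.constantCoeff ψ = 0) : PowerSeries.constantCoeff (ψ.map f) = 0 := by
  rw [← PowerSeries.coeff_zero_eq_constantCoeff_apply, PowerSeries.coeff_map,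
    PowerSeries.coeff_zero_eq_constantCoeff_apply, h, map_zero]

lemma hasSubst_X_pair {ψ : PowerSeries R} (h : PowerSeries.constantCoeff ψ = 0) (i : Fin 2) :
    (ψ.subst (MvPowerSeries.X i : MvPowerSeries (Fin 2) R)).constantCoeff = 0 :=
  constantCoeff_subst_zero (MvPowerSeries.constantCoeff_X i) h

lemma map_subst_X (f : R →+* K) (ψ : PowerSeries R) (i : Fin 2) :
    (ψ.subst (MvPowerSeries.X i : MvPowerSeries (Fin 2) R)).map f =
      (ψ.map f).subst (MvPowerSeries.X i : MvPowerSeries (Fin 2) K) := by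
  rw [PowerSeries.map_subst (PowerSeries.HasSubst.X _), MvPowerSeries.map_X]

/-- Whether a power series is a strict isomorphism can be tested over a larger ring. -/
lemma isStrictIso_map_iff {f : R →+* K} (hf : Function.Injective f) {F G : FormalGroup R}
    {ψ : PowerSeries R} : IsStrictIso (F.map f) (G.map f) (ψ.map f) ↔ IsStrictIso F G ψ := by
  unfold IsStrictIso
  have h0 : PowerSeries.constantCoeff (ψ.map f) = 0 ↔ PowerSeries.constantCoeff ψ = 0 := by
    rw [← PowerSeries.coeff_zero_eq_constantCoeff_apply, PowerSeries.coeff_map,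
      PowerSeries.coeff_zero_eq_constantCoeff_apply, map_eq_zero_iff f hf]
  have h1 : PowerSeries.coeff 1 (ψ.map f) = 1 ↔ PowerSeries.coeff 1 ψ = 1 := by
    rw [PowerSeries.coeff_map, map_eq_one_iff f hf]
  rw [h0, h1]
  refine and_congr_right fun hc => and_congr_right fun _ => ?_
  rw [← (mvPowerSeries_map_injective hf).eq_iff,
    map_subst_pair f (hasSubst_X_pair hc 0) (hasSubst_X_pair hc 1),
    PowerSeries.map_subst (PowerSeries.HasSubst.of_constantCoeff_zero F.zero_constantCoeff),
    map_subst_X, map_subst_X]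
  rfl

/-- If `L` is the logarithm of `G`, then `ψ` is a strict isomorphism `F → G` if and only if
`L ∘ ψ` is a logarithm of `F`. -/
lemma isStrictIso_iff_isLog {F G : FormalGroup K} {L ψ : PowerSeries K} (hL : IsLog G L)
    (h0 : PowerSeries.constantCoeff ψ = 0) :
    IsStrictIso F G ψ ↔ IsLog F (L.subst ψ : PowerSeries K) := by
  have hc : PowerSeries.constantCoeff (L.subst ψ : PowerSeries K) = 0 :=
    constantCoeff_subst_zero' h0 hL.constantCoeff
  have h1 : PowerSeries.coeff 1 (L.subst ψ : PowerSeries K) = PowerSeries.coeff 1 ψ := by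
    have := subst_sub_self_mem (ν := Unit) hL.constantCoeff hL.coeff_one h0
    exact sub_mem_ordIdeal_iff_X_pow_dvd.1 this 1 one_lt_two
  have h2 := hL.subst_add (hasSubst_X_pair h0 0) (hasSubst_X_pair h0 1)
  rw [subst_subst_assoc h0 _ (MvPowerSeries.constantCoeff_X _),
    subst_subst_assoc h0 _ (MvPowerSeries.constantCoeff_X _)] at h2
  have h3 := subst_subst_assoc h0 L F.zero_constantCoeff
  constructor
  · rintro ⟨-, hψ1, hψ⟩
    refine ⟨hc, h1.trans hψ1, ?_⟩
    rw [← h2, ← h3, hψ]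
  · intro h
    refine ⟨h0, h1.symm.trans h.coeff_one, ?_⟩
    refine subst_injective (constantCoeff_subst_zero F.zero_constantCoeff h0)
      (constantCoeff_subst_pair (hasSubst_X_pair h0 0) (hasSubst_X_pair h0 1) G.zero_constantCoeff)
      hL.constantCoeff hL.coeff_one ?_
    rw [h3, h2, h.subst_eq]

end StrictIso

/-! ### The canonical formal group law in terms of its logarithm -/

section CanonicalFormalGroup

open Finset

variable {n : ℕ} {F : FormalGroup (RRing n)} {ℓ : ℕ → RatRing n}

lemma map_gammaR_map (F : FormalGroup (RRing n)) :
    (F.map (gammaR n)).map (toRat n) = (F.map (toRat n)).map (gammaRat n) := by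
  refine FormalGroup.ext ?_
  rw [FormalGroup.map_toPowerSeries, FormalGroup.map_toPowerSeries, FormalGroup.map_toPowerSeries,
    FormalGroup.map_toPowerSeries]
  ext e
  simp only [MvPowerSeries.coeff_map, toRat_gammaR]

lemma subst_psiGamma (hL : IsLog (F.map (toRat n)) (typicalSeries ℓ)) :
    (typicalSeries fun k => gammaRat n (ℓ k)).subst ((psiGamma n F).map (toRat n)) =
      typicalSeries fun k => ∑ p ∈ HasAntidiagonal.antidiagonal k,
        gammaRat n (ℓ p.1) * toRat n (tR n p.2) ^ 2 ^ p.1 := by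
  rw [psiGamma, map_formalSum, map_gammaR_map]
  refine subst_formalSum ?_ _
  rw [← map_typicalSeries]
  exact hL.map _

/-- The condition that `ψ_γ` is a strict isomorphism `F → F^γ`, that is, `L^γ ∘ ψ_γ = L`, in terms
of the coefficients of the logarithm. -/
lemma isStrictIso_psiGamma_iff (hL : IsLog (F.map (toRat n)) (typicalSeries ℓ)) :
    IsStrictIso F (F.map (gammaR n)) (psiGamma n F) ↔
      ∀ k, ℓ k = ∑ p ∈ HasAntidiagonal.antidiagonal k,
        gammaRat n (ℓ p.1) * toRat n (tR n p.2) ^ 2 ^ p.1 := by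
  have hL' :
      IsLog ((F.map (gammaR n)).map (toRat n)) (typicalSeries fun k => gammaRat n (ℓ k)) := by
    rw [map_gammaR_map, ← map_typicalSeries]
    exact hL.map _
  have hψ : PowerSeries.constantCoeff (psiGamma n F) = 0 := constantCoeff_formalSum _ _
  rw [← isStrictIso_map_iff (toRat_injective n), isStrictIso_iff_isLog hL'
    (constantCoeff_map_eq_zero _ hψ), subst_psiGamma hL]
  constructor
  · intro h k
    exact congrFun (typicalSeries_injective (hL.eq h)) k
  · intro h
    convert hL using 2
    exact funext fun k => (h k).symm

lemma constantCoeff_iterateConj {R : Type*} [CommRing R] (γ : R →+* R) {ψ : PowerSeries R}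
    (h : PowerSeries.constantCoeff ψ = 0) (s : ℕ) :
    PowerSeries.constantCoeff (iterateConj γ ψ s) = 0 := by
  induction s with
  | zero => exact PowerSeries.constantCoeff_X
  | succ s ih => exact constantCoeff_subst_zero' ih (constantCoeff_map_eq_zero _ h)

lemma map_subst' {R K : Type*} [CommRing R] [CommRing K] (f : R →+* K) {a : PowerSeries R}
    (ha : PowerSeries.constantCoeff a = 0) (L : PowerSeries R) :
    (L.subst a : PowerSeries R).map f = (L.map f).subst (a.map f) :=
  PowerSeries.map_subst (PowerSeries.HasSubst.of_constantCoeff_zero' ha) L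

/-- The composite `θ` of `s` conjugates of `ψ_γ` satisfies `L^{γ^s} ∘ θ = L`. -/
lemma subst_iterateConj (hL : IsLog (F.map (toRat n)) (typicalSeries ℓ))
    (hrec : ∀ k, ℓ k = ∑ p ∈ HasAntidiagonal.antidiagonal k,
        gammaRat n (ℓ p.1) * toRat n (tR n p.2) ^ 2 ^ p.1) (s : ℕ) :
    (typicalSeries fun k => (gammaRat n ^ s) (ℓ k)).subst
      ((iterateConj (gammaR n) (psiGamma n F) s).map (toRat n)) = typicalSeries ℓ := by
  have hψ : PowerSeries.constantCoeff (psiGamma n F) = 0 := constantCoeff_formalSum _ _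
  induction s with
  | zero =>
    rw [iterateConj, PowerSeries.map_X]
    exact PowerSeries.X_subst _
  | succ s ih =>
    have hs := constantCoeff_iterateConj (gammaR n) hψ s
    rw [iterateConj]
    refine (congrArg (fun y => PowerSeries.subst y _) (map_subst' (toRat n) hs _)).trans ?_
    rw [subst_subst_assoc (constantCoeff_map_eq_zero _ (constantCoeff_map_eq_zero _ hψ)) _
        (constantCoeff_map_eq_zero _ hs)]
    have h1 : (PowerSeries.map (gammaR n ^ s) (psiGamma n F)).map (toRat n) =
        ((psiGamma n F).map (toRat n)).map (gammaRat n ^ s) := by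
      ext e
      simp only [PowerSeries.coeff_map, toRat_gammaR_pow]
    have h2 : (typicalSeries fun k => (gammaRat n ^ (s + 1)) (ℓ k)) =
        (typicalSeries fun k => gammaRat n (ℓ k)).map (gammaRat n ^ s) := by
      rw [map_typicalSeries]
      simp only [pow_succ, RingHom.mul_def, RingHom.comp_apply]
    rw [h1, h2, ← map_subst' _ (constantCoeff_map_eq_zero _ hψ), subst_psiGamma hL]
    simp only [← hrec]
    refine Eq.trans ?_ ih
    rw [← map_typicalSeries]
    rfl

/-- Substituting `-θ` into a series supported in the degrees `2^k`. -/
lemma typicalSeries_subst_neg {K : Type*} [CommRing K] (ℓ : ℕ → K) {θ : PowerSeries K}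
    (hθ : PowerSeries.constantCoeff θ = 0) :
    ((typicalSeries ℓ).subst (-θ) : PowerSeries K) =
      (typicalSeries fun k => if k = 0 then -ℓ k else ℓ k).subst θ := by
  have h0 : PowerSeries.constantCoeff (-PowerSeries.X : PowerSeries K) = 0 := by simp
  have h1 : (-θ : PowerSeries K) = (-PowerSeries.X : PowerSeries K).subst θ := by
    have hs := PowerSeries.HasSubst.of_constantCoeff_zero' hθ
    rw [← PowerSeries.coe_substAlgHom hs, map_neg, PowerSeries.coe_substAlgHom hs,
      PowerSeries.subst_X hs]
  have h2 : ((typicalSeries ℓ).subst (-PowerSeries.X : PowerSeries K) : PowerSeries K) =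
      typicalSeries fun k => if k = 0 then -ℓ k else ℓ k := by
    have : (-PowerSeries.X : PowerSeries K) =
        PowerSeries.C (-1) * (PowerSeries.X : PowerSeries K) ^ 2 ^ 0 := by simp
    rw [this, subst_C_mul_X_pow]
    congr 1
    funext k
    rw [if_pos (Nat.zero_le _), Nat.sub_zero]
    split_ifs with hk
    · simp [hk]
    · rw [Even.neg_one_pow (Nat.even_pow.2 ⟨even_two, hk⟩), mul_one]
  rw [h1, subst_subst_assoc h0 _ hθ, h2]

/-- Let `θ` be the composite of the `N` conjugates of `ψ_γ`. By `L^{γ^N} ∘ θ = L`, the series `-θ`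
is the formal inversion if and only if `L(-θ) = -L^{γ^N}(θ)`, and `θ` can be cancelled. -/
lemma isFormalInversion_iff (hL : IsLog (F.map (toRat n)) (typicalSeries ℓ))
    (hrec : ∀ k, ℓ k = ∑ p ∈ HasAntidiagonal.antidiagonal k,
        gammaRat n (ℓ p.1) * toRat n (tR n p.2) ^ 2 ^ p.1) :
    IsFormalInversion F (-(iterateConj (gammaR n) (psiGamma n F) (2 ^ (n - 1)))) ↔
      ∀ k, k ≠ 0 → (gammaRat n ^ 2 ^ (n - 1)) (ℓ k) = -ℓ k := by
  set N := 2 ^ (n - 1)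
  set θ := iterateConj (gammaR n) (psiGamma n F) N with hθdef
  have hθ : PowerSeries.constantCoeff θ = 0 :=
    constantCoeff_iterateConj _ (constantCoeff_formalSum _ _) N
  have hnθ : PowerSeries.constantCoeff (-θ) = 0 := by rw [map_neg, hθ, neg_zero]
  have hθ' : PowerSeries.constantCoeff (θ.map (toRat n)) = 0 := constantCoeff_map_eq_zero _ hθ
  have hnθ' : PowerSeries.constantCoeff (-θ.map (toRat n)) = 0 := by rw [map_neg, hθ', neg_zero]
  have hL0 : ℓ 0 = 1 := by simpa using hL.coeff_one
  have hsub := subst_iterateConj hL hrec N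
  have hLN : IsLog ((F.map (toRat n)).map (gammaRat n ^ N))
      (typicalSeries fun k => (gammaRat n ^ N) (ℓ k)) := by
    rw [← map_typicalSeries]
    exact hL.map _
  have hθ1 : PowerSeries.coeff 1 (θ.map (toRat n)) = 1 := by
    have := subst_sub_self_mem (ν := Unit) hLN.constantCoeff hLN.coeff_one hθ'
    rw [hsub] at this
    exact (sub_mem_ordIdeal_iff_X_pow_dvd.1 this 1 one_lt_two).symm.trans hL.coeff_one
  have hX : PowerSeries.constantCoeff (PowerSeries.X : PowerSeries (RRing n)) = 0 :=
    PowerSeries.constantCoeff_X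
  have hX' : PowerSeries.constantCoeff (PowerSeries.X : PowerSeries (RatRing n)) = 0 :=
    PowerSeries.constantCoeff_X
  have step1 : F.toPowerSeries.subst ![(PowerSeries.X : PowerSeries (RRing n)), -θ] = 0 ↔
      (F.map (toRat n)).toPowerSeries.subst
        ![(PowerSeries.X : PowerSeries (RatRing n)), -θ.map (toRat n)] = 0 := by
    rw [← (mvPowerSeries_map_injective (toRat_injective n)).eq_iff,
      map_subst_pair (τ := Unit) (toRat n) hX hnθ, map_zero]
    have e1 : MvPowerSeries.map (toRat n) (PowerSeries.X : PowerSeries (RRing n)) =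
      (PowerSeries.X : PowerSeries (RatRing n)) := PowerSeries.map_X _
    have e2 : MvPowerSeries.map (toRat n) (-θ) = -θ.map (toRat n) := map_neg _ _
    rw [e1, e2]
    rfl
  have step2 : (F.map (toRat n)).toPowerSeries.subst
        ![(PowerSeries.X : PowerSeries (RatRing n)), -θ.map (toRat n)] = 0 ↔
      ((typicalSeries ℓ).subst (-θ.map (toRat n)) : PowerSeries (RatRing n)) =
        -typicalSeries ℓ := by
    have h1 := hL.subst_add (τ := Unit) hX' hnθ'
    have h2 : ((typicalSeries ℓ).subst (PowerSeries.X : PowerSeries (RatRing n)) :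
        PowerSeries (RatRing n)) = typicalSeries ℓ := PowerSeries.X_subst _
    have h3 : ((typicalSeries ℓ).subst (0 : PowerSeries (RatRing n)) :
        PowerSeries (RatRing n)) = 0 :=
      PowerSeries.subst_zero_of_constantCoeff_zero hL.constantCoeff
    have h4 : (typicalSeries ℓ).subst (MvPowerSeries.subst ![(PowerSeries.X :
        PowerSeries (RatRing n)), -θ.map (toRat n)] (F.map (toRat n)).toPowerSeries) =
        typicalSeries ℓ +
          ((typicalSeries ℓ).subst (-θ.map (toRat n)) : PowerSeries (RatRing n)) :=
      h1.trans (congrArg (· + _) h2)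
    constructor
    · intro h
      rw [h] at h4
      exact (neg_eq_of_add_eq_zero_right (h4.symm.trans h3)).symm
    · intro h
      refine subst_injective (τ := Unit) (constantCoeff_subst_pair (τ := Unit) hX' hnθ'
        (FormalGroup.zero_constantCoeff _)) (map_zero _) hL.constantCoeff hL.coeff_one ?_
      rw [h4, h, add_neg_cancel]
      exact h3.symm
  have step3 : (-typicalSeries ℓ : PowerSeries (RatRing n)) =
      (typicalSeries fun k => -(gammaRat n ^ N) (ℓ k)).subst (θ.map (toRat n)) := by
    have hs := PowerSeries.HasSubst.of_constantCoeff_zero' hθ'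
    have : (typicalSeries fun k => -(gammaRat n ^ N) (ℓ k)) =
        -typicalSeries fun k => (gammaRat n ^ N) (ℓ k) := by
      ext d
      rw [map_neg]
      by_cases hd : ∃ i, d = 2 ^ i
      · obtain ⟨i, rfl⟩ := hd
        simp only [coeff_typicalSeries_two_pow]
      · have hd' : ∀ i, d ≠ 2 ^ i := fun i hi => hd ⟨i, hi⟩
        simp only [coeff_typicalSeries_of_ne _ _ hd', neg_zero]
    rw [this, ← PowerSeries.coe_substAlgHom hs, map_neg, PowerSeries.coe_substAlgHom hs, hsub]
  rw [IsFormalInversion, and_iff_right hnθ, step1, step2, typicalSeries_subst_neg _ hθ', step3]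
  constructor
  · intro h k hk
    have := congrFun (typicalSeries_injective (subst_left_cancel hθ' hθ1 h)) k
    simp only [if_neg hk] at this
    exact neg_eq_iff_eq_neg.1 this.symm
  · intro h
    congr 2
    funext k
    split_ifs with hk
    · rw [hk, hL0, map_one]
    · rw [h k hk, neg_neg]

/-- `2`-typicality in terms of a ring `K` with the universal property of `ℚ ⊗ R`. -/
lemma isTwoTypical_iff_of_universal {R K : Type} [CommRing R] [CommRing K] [Algebra ℚ K]
    {ι : R →+* K} (hι : ∀ (S : Type) [CommRing S] [Algebra ℚ S] (g : R →+* S),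
      ∃ e : K →+* S, e.comp ι = g) {F : FormalGroup R} :
    IsTwoTypical F ↔ ∃ ℓ : ℕ → K, IsLog (F.map ι) (typicalSeries ℓ) := by
  set inc : R →+* TensorProduct ℤ ℚ R :=
    (Algebra.TensorProduct.includeRight : R →ₐ[ℤ] TensorProduct ℤ ℚ R).toRingHom with hinc
  have hmap : ∀ {A B : Type} [CommRing A] [CommRing B] (f : R →+* A) (g : A →+* B)
      (h : R →+* B), g.comp f = h → (F.map f).map g = F.map h := by
    rintro A B _ _ f g h rfl
    refine FormalGroup.ext ?_
    rw [FormalGroup.map_toPowerSeries, FormalGroup.map_toPowerSeries,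
      FormalGroup.map_toPowerSeries]
    ext e
    simp only [MvPowerSeries.coeff_map, RingHom.comp_apply]
  constructor
  · rintro ⟨L, hL, hL2⟩
    rw [isStrictIso_additive_iff] at hL
    let e : TensorProduct ℤ ℚ R →ₐ[ℤ] K :=
      Algebra.TensorProduct.lift (algebraMap ℚ K).toIntAlgHom ι.toIntAlgHom
        fun _ _ => Commute.all _ _
    have he : e.toRingHom.comp inc = ι := by
      ext a
      change Algebra.TensorProduct.lift _ _ (fun _ _ => Commute.all _ _) (1 ⊗ₜ[ℤ] a) = _
      rw [Algebra.TensorProduct.lift_tmul, map_one, one_mul]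
      rfl
    rw [eq_typicalSeries hL2] at hL
    refine ⟨fun i => e.toRingHom (PowerSeries.coeff (2 ^ i) L), ?_⟩
    rw [← hmap inc e.toRingHom ι he, ← map_typicalSeries]
    exact hL.map _
  · rintro ⟨ℓ, hℓ⟩
    obtain ⟨e, he⟩ := hι _ inc
    refine ⟨typicalSeries fun i => e (ℓ i), ?_, fun d hd => coeff_typicalSeries_of_ne _ _
      fun i hi => hd ⟨i, hi⟩⟩
    rw [isStrictIso_additive_iff, ← map_typicalSeries]
    change IsLog (F.map inc) _
    rw [← hmap ι e inc he]
    exact hℓ.map _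

lemma isTwoTypical_iff :
    IsTwoTypical F ↔ ∃ ℓ : ℕ → RatRing n, IsLog (F.map (toRat n)) (typicalSeries ℓ) := by
  refine isTwoTypical_iff_of_universal fun S _ _ g =>
    ⟨MvPolynomial.eval₂Hom (algebraMap ℚ S) fun x => g (MvPolynomial.X x), ?_⟩
  refine MvPolynomial.ringHom_ext' ?_ fun x => ?_
  · exact IsLocalization.ringHom_ext (Ideal.span {(2 : ℤ)}).primeCompl (RingHom.ext_int _ _)
  · rw [RingHom.comp_apply, toRat_X]
    exact MvPolynomial.eval₂Hom_X' _ _ _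

/-- A commutative formal group law over `𝓡_n` is canonical if and only if its logarithm has the
form `∑ ℓ_k x^(2^k)` with coefficients satisfying the recursion of a canonical logarithm. -/
theorem isCanonicalFormalGroup_iff : IsCanonicalFormalGroup n F ↔
    F.IsComm ∧ ∃ ℓ, IsCanonicalLog n ℓ ∧ IsLog (F.map (toRat n)) (typicalSeries ℓ) := by
  constructor
  · intro h
    obtain ⟨ℓ, hL⟩ := isTwoTypical_iff.1 h.twoTypical
    have hrec := (isStrictIso_psiGamma_iff hL).1 h.strictIso
    refine ⟨h.comm, ℓ, ⟨?_, hrec, (isFormalInversion_iff hL hrec).1 h.inversion⟩, hL⟩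
    simpa using hL.coeff_one
  · rintro ⟨hc, ℓ, hℓ, hL⟩
    exact ⟨hc, isTwoTypical_iff.2 ⟨ℓ, hL⟩, (isStrictIso_psiGamma_iff hL).2 hℓ.recursion,
      (isFormalInversion_iff hL hℓ.recursion).2 hℓ.neg⟩

theorem existsUnique_isCanonicalFormalGroup (n : ℕ) :
    ∃! F : FormalGroup (RRing n), IsCanonicalFormalGroup n F := by
  obtain ⟨ℓ, hℓ⟩ := exists_isCanonicalLog n
  obtain ⟨U, -, hU⟩ := hℓ.exists_functionalEquation
  obtain ⟨F, hF, hL⟩ := hU.exists_formalGroup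
  refine ⟨F, isCanonicalFormalGroup_iff.2 ⟨hF, ℓ, hℓ, hL⟩, fun F' hF' => ?_⟩
  obtain ⟨-, ℓ', hℓ', hL'⟩ := isCanonicalFormalGroup_iff.1 hF'
  obtain rfl := hℓ.unique hℓ'
  have := congrArg FormalGroup.toPowerSeries (hL'.formalGroup_ext hL)
  exact FormalGroup.ext (mvPowerSeries_map_injective (toRat_injective n) this)

/-- The relation `[2]_F(x) = ∑^F v_i x^(2^i)` in terms of the coefficients of the logarithm. -/
lemma isArakiSequence_iff (hL : IsLog (F.map (toRat n)) (typicalSeries ℓ)) (v : ℕ → RRing n) :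
    IsArakiSequence F v ↔ ∀ k, ∑ p ∈ HasAntidiagonal.antidiagonal k,
      ℓ p.1 * toRat n (v p.2) ^ 2 ^ p.1 = 2 * ℓ k := by
  have hX : PowerSeries.constantCoeff (PowerSeries.X : PowerSeries (RRing n)) = 0 :=
    PowerSeries.constantCoeff_X
  have hX' : PowerSeries.constantCoeff (PowerSeries.X : PowerSeries (RatRing n)) = 0 :=
    PowerSeries.constantCoeff_X
  have e1 : MvPowerSeries.map (toRat n) (PowerSeries.X : PowerSeries (RRing n)) =
    (PowerSeries.X : PowerSeries (RatRing n)) := PowerSeries.map_X _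
  have e2 : MvPowerSeries.map (toRat n) (formalSum F v) =
    formalSum (F.map (toRat n)) fun i => toRat n (v i) := map_formalSum _ _ _
  rw [IsArakiSequence, ← (mvPowerSeries_map_injective (toRat_injective n)).eq_iff,
    map_subst_pair (τ := Unit) (toRat n) hX hX, e1, e2]
  have h1 := hL.subst_add (τ := Unit) hX' hX'
  have h2 : ((typicalSeries ℓ).subst (PowerSeries.X : PowerSeries (RatRing n)) :
      PowerSeries (RatRing n)) = typicalSeries ℓ := PowerSeries.X_subst _
  have h3 : (typicalSeries ℓ).subst (MvPowerSeries.subst ![(PowerSeries.X :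
      PowerSeries (RatRing n)), (PowerSeries.X : PowerSeries (RatRing n))]
        (F.map (toRat n)).toPowerSeries) = (typicalSeries fun k => 2 * ℓ k) := by
    refine h1.trans ((congrArg₂ (· + ·) h2 h2).trans ?_)
    ext d
    rw [map_add]
    by_cases hd : ∃ i, d = 2 ^ i
    · obtain ⟨i, rfl⟩ := hd
      simp only [coeff_typicalSeries_two_pow, two_mul]
    · have hd' : ∀ i, d ≠ 2 ^ i := fun i hi => hd ⟨i, hi⟩
      simp only [coeff_typicalSeries_of_ne _ _ hd', add_zero]
  have h4 := subst_formalSum hL fun i => toRat n (v i)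
  constructor
  · intro h k
    have h5 := h3.symm.trans ((congrArg (fun y => (typicalSeries ℓ).subst y) h).trans h4)
    exact (congrFun (typicalSeries_injective h5) k).symm
  · intro h
    refine subst_injective (τ := Unit) (constantCoeff_subst_pair (τ := Unit) hX' hX'
      (F.map (toRat n)).zero_constantCoeff) (constantCoeff_formalSum _ _) hL.constantCoeff
      hL.coeff_one ?_
    refine h3.trans (Eq.trans ?_ h4.symm)
    simp only [h]

end CanonicalFormalGroup

/-! ### Degrees of the Araki elements -/

section Homogeneous

open Finset

/-- The image of a weighted homogeneous polynomial under a homomorphism that sends the variables to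
homogeneous elements of the same degrees is homogeneous. -/
lemma eval₂Hom_mem_graded {ν R S A : Type*} [CommSemiring R] [CommSemiring S] [CommRing A]
    [Algebra S A] (𝒜 : ℤ → Submodule S A) [SetLike.GradedMonoid 𝒜] {w : ν → ℤ} {f : R →+* A}
    (hf : ∀ c, f c ∈ 𝒜 0) {g : ν → A} (hg : ∀ x, g x ∈ 𝒜 (w x)) {p : MvPolynomial ν R} {d : ℤ}
    (hp : MvPolynomial.IsWeightedHomogeneous w p d) : MvPolynomial.eval₂Hom f g p ∈ 𝒜 d := by
  rw [MvPolynomial.coe_eval₂Hom, MvPolynomial.eval₂_eq]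
  refine Submodule.sum_mem _ fun e he => ?_
  have h := SetLike.prod_pow_mem_graded 𝒜 (F := e.support) (i := w) (g := g) e fun x _ => hg x
  have h2 := SetLike.mul_mem_graded (hf (MvPolynomial.coeff e p)) h
  have h3 := hp (MvPolynomial.mem_support_iff.1 he)
  rw [Finsupp.weight_apply, Finsupp.sum] at h3
  rwa [zero_add, h3] at h2

/-- The degrees `|γ^r t_i| = 2 (2^i - 1)` of the variables of `𝓡_n`. -/
def weightR (n : ℕ) (x : ℕ × Fin (2 ^ (n - 1))) : ℤ := 2 * (2 ^ (x.1 + 1) - 1)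

variable {n : ℕ}

lemma isWeightedHomogeneous_gammaRat {a : RatRing n} {d : ℤ}
    (ha : MvPolynomial.IsWeightedHomogeneous (weightR n) a d) :
    MvPolynomial.IsWeightedHomogeneous (weightR n) (gammaRat n a) d := by
  rw [← MvPolynomial.mem_weightedHomogeneousSubmodule]
  have := MvPolynomial.weightedGradedAlgebra ℚ (weightR n)
  refine eval₂Hom_mem_graded (MvPolynomial.weightedHomogeneousSubmodule ℚ (weightR n))
    (fun c => MvPolynomial.isWeightedHomogeneous_C _ _) (fun x => ?_) ha
  rw [gammaOrbit]
  split_ifs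
  · exact MvPolynomial.isWeightedHomogeneous_X _ _ _
  · exact (MvPolynomial.isWeightedHomogeneous_X _ _ _).neg

lemma isWeightedHomogeneous_gammaRat_pow (s : ℕ) {a : RatRing n} {d : ℤ}
    (ha : MvPolynomial.IsWeightedHomogeneous (weightR n) a d) :
    MvPolynomial.IsWeightedHomogeneous (weightR n) ((gammaRat n ^ s) a) d := by
  induction s with
  | zero => exact ha
  | succ s ih =>
    rw [pow_succ', RingHom.mul_def, RingHom.comp_apply]
    exact isWeightedHomogeneous_gammaRat ih

lemma isWeightedHomogeneous_sum {α : Type*} {s : Finset α} {f : α → RatRing n} {d : ℤ}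
    (h : ∀ i ∈ s, MvPolynomial.IsWeightedHomogeneous (weightR n) (f i) d) :
    MvPolynomial.IsWeightedHomogeneous (weightR n) (∑ i ∈ s, f i) d :=
  Submodule.sum_mem (MvPolynomial.weightedHomogeneousSubmodule ℚ (weightR n) d) h

lemma isWeightedHomogeneous_ofNat (c : ℕ) [c.AtLeastTwo] :
    MvPolynomial.IsWeightedHomogeneous (weightR n) (OfNat.ofNat c : RatRing n) 0 := by
  rw [← map_ofNat (MvPolynomial.C : ℚ →+* RatRing n)]
  exact MvPolynomial.isWeightedHomogeneous_C _ _

/-- `ab^(2^i)` has degree `2 (2^(i+j) - 1)` if `a` and `b` have degrees `2 (2^i - 1)` and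
`2 (2^j - 1)`. -/
lemma isWeightedHomogeneous_mul_pow {i j k : ℕ} (hk : i + j = k) {a b : RatRing n}
    (ha : MvPolynomial.IsWeightedHomogeneous (weightR n) a (2 * (2 ^ i - 1)))
    (hb : MvPolynomial.IsWeightedHomogeneous (weightR n) b (2 * (2 ^ j - 1))) :
    MvPolynomial.IsWeightedHomogeneous (weightR n) (a * b ^ 2 ^ i) (2 * (2 ^ k - 1)) := by
  convert ha.mul (hb.pow (2 ^ i)) using 1
  subst hk
  rw [nsmul_eq_mul]
  push_cast
  ring

lemma IsCanonicalLog.isWeightedHomogeneous {ℓ : ℕ → RatRing n} (h : IsCanonicalLog n ℓ) (k : ℕ) :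
    MvPolynomial.IsWeightedHomogeneous (weightR n) (ℓ k) (2 * (2 ^ k - 1)) := by
  induction k using Nat.strong_induction_on with
  | _ k ih =>
    by_cases hk : k = 0
    · subst hk
      rw [h.zero]
      exact MvPolynomial.isWeightedHomogeneous_one _ _
    · have h2 : ℓ k = MvPolynomial.C (1 / 2) * (2 * ℓ k) := by
        rw [← mul_assoc, ← map_ofNat (MvPolynomial.C : ℚ →+* RatRing n) 2, ← map_mul]
        norm_num
      rw [h2, h.two_mul_eq k hk]
      refine MvPolynomial.IsWeightedHomogeneous.C_mul
        (isWeightedHomogeneous_sum fun s _ => isWeightedHomogeneous_gammaRat_pow s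
          (isWeightedHomogeneous_sum fun j hj => ?_)) _
      have hjk := mem_range.1 hj
      refine isWeightedHomogeneous_mul_pow (by omega : j + (k - j) = k)
        (isWeightedHomogeneous_gammaRat (ih j hjk)) ?_
      obtain ⟨i, hi⟩ : ∃ i, k - j = i + 1 := ⟨k - j - 1, by omega⟩
      rw [hi, tR, toRat_X]
      exact MvPolynomial.isWeightedHomogeneous_X _ _ _

/-- The Araki element `v_k` is homogeneous of degree `2 (2^k - 1)`. -/
lemma IsCanonicalLog.isWeightedHomogeneous_araki {ℓ : ℕ → RatRing n} (h : IsCanonicalLog n ℓ)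
    {v : ℕ → RRing n} (hv : ∀ k, ∑ p ∈ HasAntidiagonal.antidiagonal k,
      ℓ p.1 * toRat n (v p.2) ^ 2 ^ p.1 = 2 * ℓ k) (k : ℕ) :
    MvPolynomial.IsWeightedHomogeneous (weightR n) (v k) (2 * (2 ^ k - 1)) := by
  have key : MvPolynomial.IsWeightedHomogeneous (weightR n) (toRat n (v k)) (2 * (2 ^ k - 1)) := by
    induction k using Nat.strong_induction_on with
    | _ k ih =>
      have hk := hv k
      rw [Nat.sum_antidiagonal_eq_sum_range_succ_mk, sum_range_succ'] at hk
      simp only [h.zero, pow_zero, pow_one, one_mul, Nat.sub_zero] at hk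
      rw [← eq_sub_iff_add_eq'] at hk
      rw [hk]
      refine MvPolynomial.IsWeightedHomogeneous.sub ?_ (isWeightedHomogeneous_sum fun j hj => ?_)
      · have := (isWeightedHomogeneous_ofNat (n := n) 2).mul (h.isWeightedHomogeneous k)
        rwa [zero_add] at this
      · have hjk := mem_range.1 hj
        exact isWeightedHomogeneous_mul_pow (by omega : j + 1 + (k - (j + 1)) = k)
          (h.isWeightedHomogeneous _) (ih _ (by omega))
  intro e he
  refine key (d := e) ?_
  rw [toRat, MvPolynomial.coeff_map]
  exact (map_ne_zero_iff _ zLocToRat_injective).2 he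

end Homogeneous

/-! ### The Araki elements and the coefficients of `T` -/

section Araki

open Finset

variable {n : ℕ}

/-- The Araki elements of the canonical formal group law agree with the coefficients of
`T = T_(N-1) ⋯ T_0` modulo `2` and the lower coefficients. -/
theorem exists_araki_congr {F : FormalGroup (RRing n)} (hF : IsCanonicalFormalGroup n F) :
    (∃! v : ℕ → RRing n, IsArakiSequence F v) ∧ ∀ v : ℕ → RRing n, IsArakiSequence F v →
      (∀ k, MvPolynomial.IsWeightedHomogeneous (weightR n) (v k) (2 * (2 ^ k - 1))) ∧
      (∀ k, Ideal.span ({2} ∪ v '' Set.Ico 1 k) =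
        Ideal.span ({2} ∪ (twistProd n (2 ^ (n - 1))).coeff '' Set.Ico 1 k)) ∧
      ∀ k, 0 < k → v k - (twistProd n (2 ^ (n - 1))).coeff k ∈
        Ideal.span ({2} ∪ (twistProd n (2 ^ (n - 1))).coeff '' Set.Ico 1 k) := by
  obtain ⟨-, ℓ, hℓ, hL⟩ := isCanonicalFormalGroup_iff.1 hF
  obtain ⟨U, hTU, hU⟩ := hℓ.exists_functionalEquation
  obtain ⟨v, -, hv, hvU⟩ := hU.exists_araki
  have huniq : ∀ w, IsArakiSequence F w → w = v := fun w hw =>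
    hU.araki_unique ((isArakiSequence_iff hL w).1 hw) hv
  refine ⟨⟨v, (isArakiSequence_iff hL v).2 hv, huniq⟩, fun w hw => ?_⟩
  obtain rfl := huniq w hw
  have hUT := coeff_add_coeff_inv_mem (coeff_zero_twistProd n _) hU.coeff_zero hTU
  have hspan := span_two_union_eq hUT
  refine ⟨hℓ.isWeightedHomogeneous_araki hv, fun k => ?_, fun k hk => ?_⟩
  · rw [span_two_union_eq hvU k, hspan]
  · have h1 := hvU k hk
    rw [hspan] at h1
    have := Ideal.sub_mem _ h1 (hUT k hk)
    rwa [add_comm (w k), add_sub_add_left_eq_sub] at this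

end Araki

/-! ### The graded ring `A = W(k)[C_{2^n} · t_1, …, C_{2^n} · t_{m-1}, C_{2^n} · u^{±1}]` -/

section ARing

variable (k : Type*) [Field k] (n m : ℕ)

lemma gammaA_tA (i : Fin (m - 1)) (r : Fin (2 ^ (n - 1))) :
    gammaA k n m (tA k n m i r) = gammaOrbit n (tA k n m i) r := by
  change AddMonoidAlgebra.lift _ _ _ _ (AddMonoidAlgebra.single _ _) = _
  rw [AddMonoidAlgebra.lift_single, one_smul]
  change (Finsupp.single (i, r) 1).prod (fun x c => gammaOrbit n (tA k n m x.1) x.2 ^ c) *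
    ((∏ r, gammaOrbit n (uA k n m) r ^ ((0 : Fin (2 ^ (n - 1)) →₀ ℤ) r) : (ARing k n m)ˣ) :
      ARing k n m) = _
  rw [Finsupp.prod_single_index (h := fun (x : Fin (m - 1) × Fin (2 ^ (n - 1))) (c : ℕ) =>
    gammaOrbit n (tA k n m x.1) x.2 ^ c) (pow_zero _), pow_one]
  simp

lemma gammaA_uA (r : Fin (2 ^ (n - 1))) :
    gammaA k n m (uA k n m r) = gammaOrbit n (fun r => (uA k n m r : ARing k n m)) r := by
  change AddMonoidAlgebra.lift _ _ _ _ (AddMonoidAlgebra.single _ _) = _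
  rw [AddMonoidAlgebra.lift_single, one_smul]
  change (0 : Fin (m - 1) × Fin (2 ^ (n - 1)) →₀ ℕ).prod
      (fun x c => gammaOrbit n (tA k n m x.1) x.2 ^ c) *
    ((∏ x, gammaOrbit n (uA k n m) x ^ (Finsupp.single r (1 : ℤ) x) : (ARing k n m)ˣ) :
      ARing k n m) = _
  rw [Finset.prod_eq_single r (fun b _ hb => by rw [Finsupp.single_eq_of_ne hb, zpow_zero])
    (fun h => absurd (Finset.mem_univ r) h), Finsupp.single_eq_same, zpow_one,
    Finsupp.prod_zero_index, one_mul]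
  unfold gammaOrbit
  split_ifs <;> simp

lemma gammaA_pow_tA (i : Fin (m - 1)) (s : ℕ) (hs : s < 2 ^ (n - 1)) :
    (gammaA k n m ^ s) (tA₀ k n m i) = tA k n m i ⟨s, hs⟩ := by
  have h := pow_apply_orbit (gammaA_tA k n m i) s 0 (by omega)
  simp only [zero_add] at h
  exact h

lemma gammaA_pow_uA (s : ℕ) (hs : s < 2 ^ (n - 1)) :
    (gammaA k n m ^ s) (uA₀ k n m) = uA k n m ⟨s, hs⟩ := by
  have h := pow_apply_orbit (gammaA_uA k n m) s 0 (by omega)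
  simp only [zero_add] at h
  exact h

lemma gammaA_pow_two_pow_uA : (gammaA k n m ^ 2 ^ (n - 1)) (uA₀ k n m) = -uA₀ k n m :=
  pow_two_pow_apply_orbit (gammaA_uA k n m) _

/-- Homomorphisms from `A` are determined by their values on constants and variables. -/
lemma ARing.ringHom_ext {B : Type*} [CommRing B] {f g : ARing k n m →+* B}
    (hC : ∀ w, f (algebraMap (WittVector 2 k) (ARing k n m) w) =
      g (algebraMap (WittVector 2 k) (ARing k n m) w))
    (ht : ∀ i r, f (tA k n m i r) = g (tA k n m i r))
    (hu : ∀ r, f (uA k n m r) = g (uA k n m r)) : f = g := by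
  refine AddMonoidAlgebra.ringHom_ext hC fun e => ?_
  let F : (ARing k n m →+* B) → Expo n m →+ Additive B := fun f =>
    AddMonoidHom.toMultiplicativeLeft.symm ((f : ARing k n m →* B).comp
      (AddMonoidAlgebra.of (WittVector 2 k) (Expo n m)))
  have : F f = F g := by
    rw [← AddMonoidHom.coprod_unique (F f), ← AddMonoidHom.coprod_unique (F g)]
    refine congrArg₂ AddMonoidHom.coprod (Finsupp.addHom_ext' fun x => ?_)
      (Finsupp.addHom_ext' fun r => ?_)
    · exact AddMonoidHom.ext_nat (congrArg Additive.ofMul (ht x.1 x.2))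
    · exact AddMonoidHom.ext_int (congrArg Additive.ofMul (hu r))
  exact congrArg Additive.toMul (DFunLike.congr_fun this e)

/-! ### The ideal `𝔪` of `A` -/

lemma tA_mem_maxA (i : Fin (m - 1)) (r : Fin (2 ^ (n - 1))) : tA k n m i r ∈ maxA k n m :=
  Ideal.subset_span (Or.inl ⟨i, r, r.2, (gammaA_pow_tA k n m i r r.2).symm⟩)

lemma gammaA_pow_sub_mem_maxA (s : ℕ) (hs : s < 2 ^ (n - 1)) :
    (gammaA k n m ^ s) (uA₀ k n m - gammaA k n m (uA₀ k n m)) ∈ maxA k n m :=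
  Ideal.subset_span (Or.inr ⟨s, hs, rfl⟩)

lemma sub_gammaA_pow_mem_maxA (s : ℕ) (hs : s ≤ 2 ^ (n - 1)) :
    uA₀ k n m - (gammaA k n m ^ s) (uA₀ k n m) ∈ maxA k n m := by
  rw [← sum_pow_sub_eq]
  exact Ideal.sum_mem _ fun r hr =>
    gammaA_pow_sub_mem_maxA k n m r ((Finset.mem_range.1 hr).trans_le hs)

lemma uA_sub_mem_maxA (r : Fin (2 ^ (n - 1))) :
    (uA k n m r : ARing k n m) - uA₀ k n m ∈ maxA k n m := by
  rw [← neg_sub, ← gammaA_pow_uA k n m r r.2]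
  exact neg_mem (sub_gammaA_pow_mem_maxA k n m r r.2.le)

/-- The ideal `𝔪` contains `2`, since `2u = u - γ^N u` is the sum of the `γ^r (u - γ u)`. -/
lemma two_mem_maxA : (2 : ARing k n m) ∈ maxA k n m := by
  have h := sub_gammaA_pow_mem_maxA k n m _ le_rfl
  rw [gammaA_pow_two_pow_uA, sub_neg_eq_add, ← two_mul] at h
  exact (Ideal.mul_unit_mem_iff_mem _ (uA k n m _).isUnit).1 h

lemma maxA_le {I : Ideal (ARing k n m)} (h2 : 2 ∈ I) (ht : ∀ i r, tA k n m i r ∈ I)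
    (hu : ∀ r, (uA k n m r : ARing k n m) - uA₀ k n m ∈ I) : maxA k n m ≤ I := by
  refine Ideal.span_le.2 ?_
  rintro x (⟨i, r, hr, rfl⟩ | ⟨r, hr, rfl⟩)
  · rw [gammaA_pow_tA k n m i r hr]
    exact ht _ _
  · have h1 : ∀ s, s ≤ 2 ^ (n - 1) → (gammaA k n m ^ s) (uA₀ k n m) - uA₀ k n m ∈ I := by
      intro s hs
      rcases hs.lt_or_eq with hs | rfl
      · rw [gammaA_pow_uA k n m s hs]
        exact hu _
      · rw [gammaA_pow_two_pow_uA, ← neg_add', ← two_mul]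
        exact neg_mem (I.mul_mem_right _ h2)
    have h3 := sub_mem (h1 r hr.le) (h1 (r + 1) hr)
    rwa [sub_sub_sub_cancel_right, pow_succ, RingHom.mul_def, RingHom.comp_apply, ← map_sub] at h3

lemma maxA_fg : (maxA k n m).FG := by
  refine Submodule.fg_span (Set.Finite.union ?_ ?_)
  · refine (Set.finite_range fun x : Fin (m - 1) × Fin (2 ^ (n - 1)) =>
      (gammaA k n m ^ x.2.1) (tA₀ k n m x.1)).subset ?_
    rintro x ⟨i, r, hr, rfl⟩
    exact ⟨(i, ⟨r, hr⟩), rfl⟩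
  · refine (Set.finite_range fun r : Fin (2 ^ (n - 1)) =>
      (gammaA k n m ^ r.1) (uA₀ k n m - gammaA k n m (uA₀ k n m))).subset ?_
    rintro x ⟨r, hr, rfl⟩
    exact ⟨⟨r, hr⟩, rfl⟩

/-! ### The grading of `A` -/

/-- Half of the degree of a monomial. -/
def halfDegree : Expo n m →+ ℤ :=
  AddMonoidHom.coprod
    (Finsupp.liftAddHom fun x : Fin (m - 1) × Fin (2 ^ (n - 1)) =>
      AddMonoidHom.comp (AddMonoidHom.mulLeft (2 ^ (x.1.1 + 1) - 1 : ℤ)) (Nat.castAddMonoidHom ℤ))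
    (Finsupp.liftAddHom fun _ : Fin (2 ^ (n - 1)) => AddMonoidHom.id ℤ)

lemma expoDegree_eq (e : Expo n m) : expoDegree n m e = 2 * halfDegree n m e := by
  have : expoDegree n m = (AddMonoidHom.mulLeft (2 : ℤ)).comp (halfDegree n m) := by
    ext1 e
    simp [expoDegree, halfDegree, Finsupp.sum, mul_add, Finset.mul_sum, mul_assoc]
  rw [this]
  rfl

lemma tA_mem_gradA (i : Fin (m - 1)) (r : Fin (2 ^ (n - 1))) :
    tA k n m i r ∈ gradA k n m (2 * (2 ^ (i.1 + 1) - 1)) := by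
  have h : expoDegree n m (Finsupp.single (i, r) 1, 0) = 2 * (2 ^ (i.1 + 1) - 1) := by
    simp [expoDegree]
  rw [← h]
  exact AddMonoidAlgebra.single_mem_gradeBy _ _ _

lemma uA_mem_gradA (r : Fin (2 ^ (n - 1))) : (uA k n m r : ARing k n m) ∈ gradA k n m 2 := by
  have h : expoDegree n m (0, Finsupp.single r 1) = 2 := by simp [expoDegree]
  rw [← h]
  exact AddMonoidAlgebra.single_mem_gradeBy _ _ _

lemma algebraMap_mem_gradA (w : WittVector 2 k) :
    algebraMap (WittVector 2 k) (ARing k n m) w ∈ gradA k n m 0 := by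
  rw [Algebra.algebraMap_eq_smul_one]
  exact Submodule.smul_mem _ _ (SetLike.GradedOne.one_mem)

/-- The unit `u^d` of degree `2d`. -/
def uPow (d : ℤ) : (ARing k n m)ˣ where
  val := AddMonoidAlgebra.single (0, Finsupp.single ⟨0, by positivity⟩ d) 1
  inv := AddMonoidAlgebra.single (0, Finsupp.single ⟨0, by positivity⟩ (-d)) 1
  val_inv := by
    rw [AddMonoidAlgebra.single_mul_single, AddMonoidAlgebra.one_def]
    simp [← Prod.mk_zero_zero]
  inv_val := by
    rw [AddMonoidAlgebra.single_mul_single, AddMonoidAlgebra.one_def]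
    simp [← Prod.mk_zero_zero]

lemma uPow_zero : uPow k n m 0 = 1 := by
  ext1
  change AddMonoidAlgebra.single (0, Finsupp.single _ 0) 1 = 1
  rw [Finsupp.single_zero, AddMonoidAlgebra.one_def]
  rfl

lemma uPow_mem_gradA (d : ℤ) : (uPow k n m d : ARing k n m) ∈ gradA k n m (2 * d) := by
  have h : expoDegree n m (0, Finsupp.single ⟨0, by positivity⟩ d) = 2 * d := by
    simp [expoDegree]
  rw [← h]
  exact AddMonoidAlgebra.single_mem_gradeBy _ _ _

lemma mul_uPow_mem_gradA {a : ARing k n m} {d : ℤ} (ha : a ∈ gradA k n m (2 * d)) :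
    a * uPow k n m (-d) ∈ gradA k n m 0 := by
  have := SetLike.mul_mem_graded ha (uPow_mem_gradA k n m (-d))
  rwa [← mul_add, add_neg_cancel, mul_zero] at this

/-- There are no elements of odd degree. -/
lemma exists_eq_two_mul_or_eq_zero {a : ARing k n m} {s : ℤ} (ha : a ∈ gradA k n m s) :
    (∃ d, s = 2 * d) ∨ a = 0 := by
  by_cases h : a = 0
  · exact Or.inr h
  · left
    obtain ⟨e, he⟩ : a.coeff.support.Nonempty := by
      rw [Finsupp.support_nonempty_iff]
      exact fun h0 => h (AddMonoidAlgebra.coeff_injective h0)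
    exact ⟨_, (ha e he).symm.trans (expoDegree_eq n m e)⟩

/-- The ideal `𝔪` is generated by its elements of degree `0`. -/
lemma zeroPartIdeal_maxA : zeroPartIdeal (gradA k n m) (maxA k n m) = maxA k n m := by
  have key : ∀ x ∈ maxA k n m, ∀ d : ℤ, x ∈ gradA k n m (2 * d) →
      x ∈ zeroPartIdeal (gradA k n m) (maxA k n m) := by
    intro x hx d hxd
    rw [← Ideal.mul_unit_mem_iff_mem _ (uPow k n m (-d)).isUnit]
    exact Ideal.subset_span ⟨Ideal.mul_mem_right _ _ hx, mul_uPow_mem_gradA k n m hxd⟩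
  refine le_antisymm (Ideal.span_le.2 fun x hx => hx.1) (Ideal.span_le.2 ?_)
  intro x hx
  have hxm := Ideal.subset_span hx
  rcases hx with ⟨i, r, hr, rfl⟩ | ⟨r, hr, rfl⟩
  · refine key _ hxm (2 ^ (i.1 + 1) - 1) ?_
    rw [gammaA_pow_tA k n m i r hr]
    exact tA_mem_gradA k n m _ _
  · refine key _ hxm 1 ?_
    -- For `s = N` the element `γ^s u` is `-u`.
    have h1 : ∀ s, s ≤ 2 ^ (n - 1) → (gammaA k n m ^ s) (uA₀ k n m) ∈ gradA k n m 2 := by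
      intro s hs
      rcases hs.lt_or_eq with hs | rfl
      · rw [gammaA_pow_uA k n m s hs]
        exact uA_mem_gradA k n m _
      · rw [gammaA_pow_two_pow_uA]
        exact neg_mem (uA_mem_gradA k n m _)
    rw [map_sub, ← RingHom.comp_apply, ← RingHom.mul_def, ← pow_succ, mul_one]
    exact sub_mem (h1 r hr.le) (h1 (r + 1) hr)

/-- The homomorphism `A → A` that specializes `u` to `1` in a way that keeps track of degrees:
it sends `a` of degree `2d` to `a u^(-d)`. -/
def normalize : ARing k n m →+* ARing k n m :=
  AddMonoidAlgebra.mapDomainRingHom (WittVector 2 k)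
    ((AddMonoidHom.fst _ _).prod (AddMonoidHom.snd _ _ -
      (Finsupp.singleAddHom (⟨0, by positivity⟩ : Fin (2 ^ (n - 1)))).comp (halfDegree n m)) :
        Expo n m →+ Expo n m)

lemma normalize_apply {a : ARing k n m} {d : ℤ} (ha : a ∈ gradA k n m (2 * d)) :
    normalize k n m a = a * uPow k n m (-d) := by
  have h1 : a = ∑ e ∈ a.coeff.support, AddMonoidAlgebra.single e (a.coeff e) := by
    apply AddMonoidAlgebra.coeff_injective
    conv_lhs => rw [← Finsupp.sum_single a.coeff]
    rw [Finsupp.sum, AddMonoidAlgebra.coeff_sum]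
    rfl
  conv_lhs => rw [h1]
  conv_rhs => rw [h1]
  rw [map_sum, Finset.sum_mul]
  refine Finset.sum_congr rfl fun e he => ?_
  have h2 := ha e he
  rw [expoDegree_eq, mul_right_inj' two_ne_zero] at h2
  change AddMonoidAlgebra.mapDomain _ _ =
    AddMonoidAlgebra.single _ _ * AddMonoidAlgebra.single _ _
  rw [AddMonoidAlgebra.mapDomain_single, AddMonoidAlgebra.single_mul_single, mul_one]
  congr 1
  refine Prod.ext (add_zero _).symm ?_
  change e.2 - Finsupp.single _ (halfDegree n m e) = e.2 + Finsupp.single _ (-d)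
  rw [h2, Finsupp.single_neg, sub_eq_add_neg]

/-- The augmentation `A → W(k)` with `t_i ↦ 0` and `u ↦ 1`. -/
def augmentation : ARing k n m →ₐ[WittVector 2 k] WittVector 2 k :=
  AddMonoidAlgebra.lift (WittVector 2 k) (WittVector 2 k) (Expo n m)
    { toFun := fun e => if e.toAdd.1 = 0 then 1 else 0
      map_one' := if_pos rfl
      map_mul' := fun e e' => by
        by_cases h1 : e.toAdd.1 = 0 <;> by_cases h2 : e'.toAdd.1 = 0 <;> simp [h1, h2] }

lemma augmentation_tA (i : Fin (m - 1)) (r : Fin (2 ^ (n - 1))) :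
    augmentation k n m (tA k n m i r) = 0 := by
  change AddMonoidAlgebra.lift _ _ _ _ (AddMonoidAlgebra.single _ _) = _
  rw [AddMonoidAlgebra.lift_single]
  simp

lemma augmentation_uA (r : Fin (2 ^ (n - 1))) : augmentation k n m (uA k n m r) = 1 := by
  change AddMonoidAlgebra.lift _ _ _ _ (AddMonoidAlgebra.single _ _) = _
  rw [AddMonoidAlgebra.lift_single]
  simp

lemma maxA_ne_top [CharP k 2] : maxA k n m ≠ ⊤ := by
  let f : ARing k n m →+* k := WittVector.constantCoeff.comp (augmentation k n m).toRingHom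
  have h : maxA k n m ≤ RingHom.ker f := by
    refine maxA_le k n m ?_ (fun i r => ?_) fun r => ?_
    · rw [RingHom.mem_ker, map_ofNat, CharTwo.two_eq_zero]
    · have : f (tA k n m i r) = WittVector.constantCoeff (augmentation k n m (tA k n m i r)) := rfl
      rw [RingHom.mem_ker, this, augmentation_tA, map_zero]
    · have : ∀ r, f (uA k n m r) = WittVector.constantCoeff (augmentation k n m (uA k n m r)) :=
        fun _ => rfl
      rw [RingHom.mem_ker, map_sub, this, this, augmentation_uA, augmentation_uA, sub_self]
  exact fun h1 => RingHom.ker_ne_top f (top_le_iff.1 (h1 ▸ h))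

/-- Modulo `𝔪` every element of degree `0` is a constant. -/
lemma exists_sub_algebraMap_mem_maxA {a : ARing k n m} (ha : a ∈ gradA k n m 0) :
    ∃ w, a - algebraMap (WittVector 2 k) (ARing k n m) w ∈ maxA k n m := by
  have hπ : ∀ x, Ideal.Quotient.mk (maxA k n m) x = 0 ↔ x ∈ maxA k n m := fun x =>
    Ideal.Quotient.eq_zero_iff_mem
  -- Modulo `𝔪` the homomorphism `normalize` is the augmentation, and it fixes elements of degree
  -- `0`.
  have h : (Ideal.Quotient.mk (maxA k n m)).comp (normalize k n m) =
      ((Ideal.Quotient.mk (maxA k n m)).comp (algebraMap (WittVector 2 k) (ARing k n m))).comp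
        (augmentation k n m).toRingHom := by
    refine ARing.ringHom_ext k n m (fun w => ?_) (fun i r => ?_) fun r => ?_
    · have h1 := normalize_apply k n m (d := 0) (algebraMap_mem_gradA k n m w)
      rw [neg_zero, uPow_zero, Units.val_one, mul_one] at h1
      change Ideal.Quotient.mk _ (normalize k n m _) =
        Ideal.Quotient.mk _ (algebraMap _ _ (augmentation k n m _))
      rw [h1, AlgHom.commutes]
      rfl
    · change Ideal.Quotient.mk _ (normalize k n m _) =
        Ideal.Quotient.mk _ (algebraMap _ _ (augmentation k n m _))
      rw [normalize_apply k n m (tA_mem_gradA k n m i r), augmentation_tA, map_zero, map_zero, hπ]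
      exact Ideal.mul_mem_right _ _ (tA_mem_maxA k n m i r)
    · change Ideal.Quotient.mk _ (normalize k n m _) =
        Ideal.Quotient.mk _ (algebraMap _ _ (augmentation k n m _))
      rw [normalize_apply k n m (d := 1) (uA_mem_gradA k n m r), augmentation_uA, map_one,
        Ideal.Quotient.eq]
      have h1 : (uA₀ k n m) * uPow k n m (-1) = 1 := (uPow k n m 1).mul_inv
      rw [← h1, ← sub_mul]
      exact Ideal.mul_mem_right _ _ (uA_sub_mem_maxA k n m r)
  refine ⟨augmentation k n m a, ?_⟩
  have h1 : Ideal.Quotient.mk _ (normalize k n m a) =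
    Ideal.Quotient.mk _ (algebraMap _ _ (augmentation k n m a)) := RingHom.congr_fun h a
  have h2 := normalize_apply k n m (d := 0) ha
  rw [neg_zero, uPow_zero, Units.val_one, mul_one] at h2
  rwa [h2, Ideal.Quotient.eq] at h1

end ARing

/-! ### Powers of `1 + w φ^m` -/

section Powers

open Finset

variable {B : Type*} [CommRing B]

/-- The Frobenius endomorphism of a ring in which `2 = 0`. -/
def squareHom (h2 : (2 : B) = 0) : B →+* B where
  toFun x := x ^ 2
  map_one' := one_pow 2
  map_mul' x y := mul_pow x y 2
  map_zero' := zero_pow two_ne_zero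
  map_add' x y := by linear_combination x * y * h2

lemma squareHom_pow_apply (h2 : (2 : B) = 0) (i : ℕ) (x : B) :
    (squareHom h2 ^ i) x = x ^ 2 ^ i := by
  induction i with
  | zero => simp
  | succ i ih =>
    rw [pow_succ', RingHom.mul_def, RingHom.comp_apply, ih, pow_succ 2, pow_mul]
    rfl

/-- The twisted power series `1 + w φ^m`, where `0 < m`. -/
def oneAddSeries (σ : B →+* B) (m : ℕ) (w : B) : TwistedSeries σ :=
  ⟨fun k => if k = 0 then 1 else if k = m then w else 0⟩

lemma coeff_mul_oneAddSeries {σ : B →+* B} {m : ℕ} (hm : 0 < m) (w : B) (a : TwistedSeries σ)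
    (k : ℕ) : (a * oneAddSeries σ m w).coeff k =
      a.coeff k + if m ≤ k then a.coeff (k - m) * (σ ^ (k - m)) w else 0 := by
  have h1 : oneAddSeries σ m w = 1 + ⟨fun k => if k = m then w else 0⟩ := by
    refine TwistedSeries.ext (funext fun k => ?_)
    rw [TwistedSeries.coeff_add, TwistedSeries.coeff_one, oneAddSeries]
    by_cases hk : k = 0
    · simp [hk, hm.ne]
    · simp [hk]
  rw [h1, mul_add, mul_one, TwistedSeries.coeff_add, TwistedSeries.coeff_mul]
  congr 1
  split_ifs with hk
  · rw [sum_eq_single (k - m, m)]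
    · simp
    · rintro ⟨i, j⟩ hp hne
      rw [HasAntidiagonal.mem_antidiagonal] at hp
      have : j ≠ m := by
        rintro rfl
        exact hne (Prod.ext (by simp at hp ⊢; omega) rfl)
      simp [this]
    · intro h
      exact absurd (HasAntidiagonal.mem_antidiagonal.2 (by simp; omega)) h
  · refine sum_eq_zero fun p hp => ?_
    rw [HasAntidiagonal.mem_antidiagonal] at hp
    have : p.2 ≠ m := by omega
    simp [this]

/-- The coefficients of `a (1 + w φ^m)^r` if `a` is supported in an interval of length `m`. -/
lemma coeff_mul_oneAddSeries_pow {σ : B →+* B} {m : ℕ} (hm : 0 < m) (w : B)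
    {a : TwistedSeries σ} {c : ℕ} (ha : ∀ k, k < c ∨ c + m ≤ k → a.coeff k = 0) (r : ℕ) :
    (∀ k < c, (a * oneAddSeries σ m w ^ r).coeff k = 0) ∧
    ∀ i j, c ≤ i → i < c + m → (a * oneAddSeries σ m w ^ r).coeff (i + m * j) =
      r.choose j * a.coeff i * ∏ l ∈ range j, (σ ^ (i + m * l)) w := by
  induction r with
  | zero =>
    simp only [pow_zero, mul_one]
    refine ⟨fun k hk => ha k (Or.inl hk), fun i j hi hi' => ?_⟩
    cases j with
    | zero => simp
    | succ j =>
      rw [ha _ (Or.inr (by rw [Nat.mul_succ]; omega)), Nat.choose_zero_succ]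
      simp
  | succ r ih =>
    simp only [pow_succ, ← mul_assoc, coeff_mul_oneAddSeries hm]
    refine ⟨fun k hk => ?_, fun i j hi hi' => ?_⟩
    · rw [ih.1 k hk, zero_add]
      split_ifs with h
      · rw [ih.1 _ (by omega), zero_mul]
      · rfl
    · rw [ih.2 i j hi hi']
      cases j with
      | zero =>
        have : (if m ≤ i + m * 0 then (a * oneAddSeries σ m w ^ r).coeff (i + m * 0 - m) *
            (σ ^ (i + m * 0 - m)) w else 0) = 0 := by
          split_ifs with h
          · rw [ih.1 _ (by simp at h ⊢; omega), zero_mul]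
          · rfl
        rw [this, add_zero]
        simp
      | succ j =>
        have e1 : i + m * (j + 1) - m = i + m * j := by rw [Nat.mul_succ]; omega
        rw [if_pos (by rw [Nat.mul_succ]; omega), e1, ih.2 i j hi hi', prod_range_succ,
          Nat.choose_succ_succ]
        push_cast
        ring

/-- In characteristic `2` and for `N = 2^s` a power of `2`, the series `(1 + w φ^m)^N` is
`1 + w' φ^(N m)` with a unit `w'`, up to terms of degree greater than `N m`. -/
lemma coeff_oneAddSeries_two_pow (h2 : (2 : B) = 0) {σ : B →+* B} {m : ℕ} (hm : 0 < m) {w : B}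
    (hw : IsUnit w) (s : ℕ) :
    (∀ k, 0 < k → k < 2 ^ s * m → (oneAddSeries σ m w ^ 2 ^ s).coeff k = 0) ∧
      IsUnit ((oneAddSeries σ m w ^ 2 ^ s).coeff (2 ^ s * m)) := by
  have h := (coeff_mul_oneAddSeries_pow hm w (a := (1 : TwistedSeries σ)) (c := 0) (fun k hk => by
    rw [TwistedSeries.coeff_one, if_neg (by omega)]) (2 ^ s)).2
  simp only [one_mul] at h
  constructor
  · intro k hk hk'
    have hlt := Nat.mod_lt k hm
    have := h (k % m) (k / m) (Nat.zero_le _) (by omega)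
    rw [Nat.mod_add_div] at this
    rw [this, TwistedSeries.coeff_one]
    split_ifs with h0
    · have hdiv : k = m * (k / m) := by
        have := Nat.mod_add_div k m
        omega
      have hd0 : k / m ≠ 0 := fun h => by rw [h] at hdiv; omega
      have hd1 : k / m ≠ 2 ^ s := fun h => by rw [h, mul_comm] at hdiv; omega
      obtain ⟨c, hc⟩ := Nat.prime_two.dvd_choose_pow hd0 hd1
      rw [hc]
      push_cast
      rw [h2]
      ring
    · ring
  · have := h 0 (2 ^ s) le_rfl (by omega)
    rw [zero_add, mul_comm m] at this
    rw [this, TwistedSeries.coeff_one, if_pos rfl, Nat.choose_self, Nat.cast_one, one_mul, one_mul]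
    exact IsUnit.prod_iff.2 fun l _ => hw.map _

/-- A polynomial `∑ e_r y^r` of degree less than `N` vanishes if its expansion at `y = 1` has at
most one term `c (y - 1)^(N-1)` and either `c = 0` or its value at `y = 0` is zero. -/
lemma eq_zero_of_sum_choose {N : ℕ} (hN : 0 < N) (e : ℕ → B)
    (h : ∀ j, j + 1 < N → ∑ r ∈ range N, (r.choose j : B) * e r = 0)
    (h' : e 0 = 0 ∨ ∑ r ∈ range N, (r.choose (N - 1) : B) * e r = 0) : ∀ r < N, e r = 0 := by
  set Q : Polynomial B := ∑ r ∈ range N, Polynomial.C (e r) * (Polynomial.X + 1) ^ r with hQ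
  have hcoeff : ∀ j, Q.coeff j = ∑ r ∈ range N, (r.choose j : B) * e r := by
    intro j
    rw [hQ, Polynomial.finsetSum_coeff]
    refine sum_congr rfl fun r _ => ?_
    rw [Polynomial.coeff_C_mul, Polynomial.coeff_X_add_one_pow, mul_comm]
  have hQ1 : Q = Polynomial.C (Q.coeff (N - 1)) * Polynomial.X ^ (N - 1) := by
    ext j
    rw [Polynomial.coeff_C_mul, Polynomial.coeff_X_pow]
    split_ifs with hj
    · rw [hj, mul_one]
    · rw [mul_zero, hcoeff]
      by_cases hjN : j + 1 < N
      · exact h j hjN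
      · refine sum_eq_zero fun r hr => ?_
        rw [Nat.choose_eq_zero_of_lt (by have := mem_range.1 hr; omega), Nat.cast_zero, zero_mul]
  have hc : Q.coeff (N - 1) = 0 := by
    rcases h' with h0 | h0
    · have h1 : Q.eval (-1) = e 0 := by
        rw [hQ, Polynomial.eval_finsetSum, sum_eq_single 0]
        · simp
        · intro r _ hr
          simp [hr]
        · intro h
          exact absurd (mem_range.2 hN) h
      rw [hQ1, h0, Polynomial.eval_mul, Polynomial.eval_C, Polynomial.eval_pow,
        Polynomial.eval_X] at h1
      exact ((isUnit_one.neg.pow _).mul_left_eq_zero).1 h1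
    · rw [hcoeff, h0]
  have hQ0 : Q = 0 := by rw [hQ1, hc, map_zero, zero_mul]
  have hcomp :
      Q.comp (Polynomial.X - 1) = ∑ r ∈ range N, Polynomial.C (e r) * Polynomial.X ^ r := by
    rw [hQ, ← Polynomial.coe_compRingHom_apply, map_sum]
    simp
  intro r hr
  have := congrArg (fun q => Polynomial.coeff q r) hcomp
  simp only [hQ0, Polynomial.zero_comp, Polynomial.coeff_zero, Polynomial.finsetSum_coeff,
    Polynomial.coeff_C_mul, Polynomial.coeff_X_pow] at this
  rw [sum_eq_single r (fun b _ hb => by rw [if_neg hb.symm, mul_zero])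
    (fun h => absurd (mem_range.2 hr) h), if_pos rfl, mul_one] at this
  exact this.symm

end Powers

/-! ### Reductions of `T` in characteristic `2` -/

section Reduction

open Finset

variable {B : Type*} [CommRing B] {n : ℕ}

lemma map_sigmaR (h2 : (2 : B) = 0) (f : RRing n →+* B) (a : RRing n) :
    f (sigmaR n a) = squareHom h2 (f a) := by
  obtain ⟨c, hc⟩ := two_dvd_sigmaR_sub_sq n a
  have := congrArg f hc
  rw [map_sub, map_mul, map_ofNat, h2, zero_mul, sub_eq_zero, map_pow] at this
  exact this

/-- The homomorphism of rings of twisted power series induced by `f`. -/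
def reduceSeries (h2 : (2 : B) = 0) (f : RRing n →+* B) :
    TwistedSeries (sigmaR n) →+* TwistedSeries (squareHom h2) :=
  TwistedSeries.map f (map_sigmaR h2 f)

lemma coeff_reduceSeries (h2 : (2 : B) = 0) (f : RRing n →+* B) (a : TwistedSeries (sigmaR n))
    (k : ℕ) :
    (reduceSeries h2 f a).coeff k = f (a.coeff k) := rfl

lemma coeff_reduceSeries_twistT_sub (h2 : (2 : B) = 0) (f : RRing n →+* B) (m : ℕ) (w : B)
    (s : ℕ) (hs : s < 2 ^ (n - 1)) (i : ℕ) :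
    (reduceSeries h2 f (twistT n s) - oneAddSeries (squareHom h2) m w).coeff (i + 1) =
      f (MvPolynomial.X (i, ⟨s, hs⟩)) - if i + 1 = m then w else 0 := by
  rw [TwistedSeries.coeff_sub, coeff_reduceSeries, ← gammaR_pow_tR n s hs]
  simp [oneAddSeries, twistT]

lemma coeff_zero_reduceSeries_twistT_sub (h2 : (2 : B) = 0) (f : RRing n →+* B) (m : ℕ) (w : B)
    (s : ℕ) :
    (reduceSeries h2 f (twistT n s) - oneAddSeries (squareHom h2) m w).coeff 0 = 0 := by
  rw [TwistedSeries.coeff_sub, coeff_reduceSeries]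
  simp [oneAddSeries, twistT, tR]

/-- If `f(γ^s t_i)` is `w` for `i = m` and `0` for `i ≠ m`, then the image of `T` is
`(1 + w φ^m)^N`, whose coefficients in degrees `0 < k < N m` vanish. -/
lemma reduction_of_eq (h2 : (2 : B) = 0) (f : RRing n →+* B) {m : ℕ} (hm : 0 < m) {w : B}
    (hw : IsUnit w)
    (hf : ∀ x, f (MvPolynomial.X x) = if x.1 + 1 = m then w else 0) :
    (∀ k, 0 < k → k < 2 ^ (n - 1) * m → f ((twistProd n (2 ^ (n - 1))).coeff k) = 0) ∧
      IsUnit (f ((twistProd n (2 ^ (n - 1))).coeff (2 ^ (n - 1) * m))) := by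
  have hT : ∀ s < 2 ^ (n - 1),
      reduceSeries h2 f (twistT n s) = oneAddSeries (squareHom h2) m w := by
    intro s hs
    rw [← sub_eq_zero]
    refine TwistedSeries.ext (funext fun i => ?_)
    cases i with
    | zero => exact coeff_zero_reduceSeries_twistT_sub h2 f m w s
    | succ i =>
      rw [coeff_reduceSeries_twistT_sub h2 f m w s hs, hf, sub_self]
      rfl
  have hprod : ∀ s ≤ 2 ^ (n - 1),
      reduceSeries h2 f (twistProd n s) = oneAddSeries (squareHom h2) m w ^ s := by
    intro s
    induction s with
    | zero => intro; rw [twistProd, map_one, pow_zero]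
    | succ s ih =>
      intro hs
      rw [twistProd, map_mul, hT s hs, ih (by omega), pow_succ']
  simp only [← coeff_reduceSeries h2 f, hprod _ le_rfl]
  exact coeff_oneAddSeries_two_pow h2 hm hw (n - 1)

/-- Rigidity of the family of the `f(γ^s t_i)`: if it differs from the family with value `w` for
`i = m` and `0` for `i ≠ m` by elements of square zero, and the image of `T` has no coefficients in
degrees `0 < k < N m`, then it is equal to that family.
With `P = 1 + w φ^m` and `f(T_s) = P + E_s`, one has `φ E_s = 0`, hence
`f(T) = P^N + ∑ E_s P^s`. -/
lemma eq_of_reduction_eq_zero (h2 : (2 : B) = 0) (f : RRing n →+* B) {m : ℕ} (hm : 0 < m) {w : B}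
    (hw : IsUnit w)
    (hsq : ∀ x, (f (MvPolynomial.X x) - if x.1 + 1 = m then w else 0) ^ 2 = 0)
    (hbig : ∀ x, m < x.1 + 1 → f (MvPolynomial.X x) = 0)
    (hzero : ∀ i, i + 1 = m → f (MvPolynomial.X (i, ⟨0, by positivity⟩)) = w)
    (hT : ∀ k, 0 < k → k < 2 ^ (n - 1) * m → f ((twistProd n (2 ^ (n - 1))).coeff k) = 0) :
    ∀ x, f (MvPolynomial.X x) = if x.1 + 1 = m then w else 0 := by
  set N := 2 ^ (n - 1) with hN
  have hNpos : 0 < N := by positivity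
  set P := oneAddSeries (squareHom h2) m w with hP
  let E : ℕ → TwistedSeries (squareHom h2) := fun s => reduceSeries h2 f (twistT n s) - P
  have hE0 : ∀ s, (E s).coeff 0 = 0 := coeff_zero_reduceSeries_twistT_sub h2 f m w
  have hEsucc : ∀ s (hs : s < N) i, (E s).coeff (i + 1) =
      f (MvPolynomial.X (i, ⟨s, hs⟩)) - if i + 1 = m then w else 0 :=
    coeff_reduceSeries_twistT_sub h2 f m w
  -- This is the equation `φ E_s = 0`.
  have hkill : ∀ s < N, ∀ i, 0 < i → ∀ j, (squareHom h2 ^ i) ((E s).coeff j) = 0 := by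
    intro s hs i hi j
    rw [squareHom_pow_apply]
    refine pow_eq_zero_of_le (m := 2) (Nat.le_self_pow hi.ne' 2) ?_
    cases j with
    | zero => rw [hE0, zero_pow two_ne_zero]
    | succ j => rw [hEsucc s hs]; exact hsq _
  have hleft : ∀ s < N, ∀ (a : TwistedSeries (squareHom h2)) k,
      (a * E s).coeff k = a.coeff 0 * (E s).coeff k := by
    intro s hs a k
    rw [TwistedSeries.coeff_mul, sum_eq_single (0, k)]
    · rfl
    · rintro ⟨i, j⟩ hp hne
      rw [HasAntidiagonal.mem_antidiagonal] at hp
      have : 0 < i := by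
        rcases Nat.eq_zero_or_pos i with rfl | h
        · exact absurd (by simpa using hp) fun h : j = k => hne (by rw [h])
        · exact h
      rw [hkill s hs i this, mul_zero]
    · intro h
      exact absurd (HasAntidiagonal.mem_antidiagonal.2 (zero_add k)) h
  have hPE : ∀ s < N, P * E s = E s := fun s hs =>
    TwistedSeries.ext (funext fun k => by rw [hleft s hs]; simp [hP, oneAddSeries])
  have hEE : ∀ r, ∀ s < N, E r * E s = 0 := fun r s hs =>
    TwistedSeries.ext (funext fun k => by rw [hleft s hs, hE0, zero_mul]; rfl)
  have hprod : ∀ s ≤ N, reduceSeries h2 f (twistProd n s) =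
      P ^ s + ∑ r ∈ range s, E r * P ^ r := by
    intro s
    induction s with
    | zero => intro; rw [twistProd, map_one, pow_zero, sum_range_zero, add_zero]
    | succ s ih =>
      intro hs
      have h1 : reduceSeries h2 f (twistT n s) = P + E s := by rw [add_sub_cancel]
      have h3 : P * ∑ r ∈ range s, E r * P ^ r = ∑ r ∈ range s, E r * P ^ r := by
        rw [mul_sum]
        refine sum_congr rfl fun r hr => ?_
        rw [← mul_assoc, hPE r (by have := mem_range.1 hr; omega)]
      have h4 : E s * ∑ r ∈ range s, E r * P ^ r = 0 := by
        rw [mul_sum]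
        refine sum_eq_zero fun r hr => ?_
        rw [← mul_assoc, hEE s r (by have := mem_range.1 hr; omega), zero_mul]
      rw [twistProd, map_mul, h1, ih (by omega), add_mul, mul_add, mul_add, h3, h4, sum_range_succ,
        pow_succ']
      abel
  have hsum : ∀ k, 0 < k → k < N * m → ∑ r ∈ range N, (E r * P ^ r).coeff k = 0 := by
    intro k hk hk'
    have h1 := hT k hk hk'
    rw [← coeff_reduceSeries h2 f, hprod N le_rfl, TwistedSeries.coeff_add,
      (coeff_oneAddSeries_two_pow h2 hm hw (n - 1)).1 k hk hk', zero_add] at h1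
    have : ∀ M, (∑ r ∈ range M, E r * P ^ r).coeff k = ∑ r ∈ range M, (E r * P ^ r).coeff k := by
      intro M
      induction M with
      | zero => rfl
      | succ M ih => rw [sum_range_succ, sum_range_succ, TwistedSeries.coeff_add, ih]
    rw [← this, h1]
  have hcoeff : ∀ i j, 1 ≤ i → i < 1 + m → i + m * j < N * m →
      ∑ r ∈ range N, (r.choose j : B) * (E r).coeff i = 0 := by
    intro i j hi hi' hij
    have h1 := hsum (i + m * j) (by omega) hij
    have h3 : ∀ r ∈ range N, (E r * P ^ r).coeff (i + m * j) = (r.choose j : B) * (E r).coeff i *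
        ∏ l ∈ range j, (squareHom h2 ^ (i + m * l)) w := by
      intro r hr
      refine (coeff_mul_oneAddSeries_pow hm w (c := 1) (fun k hk => ?_) r).2 i j hi hi'
      cases k with
      | zero => exact hE0 r
      | succ k =>
        rw [hEsucc r (mem_range.1 hr), hbig _ (by simp; omega), if_neg (by omega), sub_zero]
    rw [sum_congr rfl h3, ← sum_mul] at h1
    have hu : IsUnit (∏ l ∈ range j, (squareHom h2 ^ (i + m * l)) w) :=
      IsUnit.prod_iff.2 fun l _ => hw.map _
    exact hu.mul_left_eq_zero.1 h1
  -- For `i < m` the degree `i + m (N-1)` is still less than `N m`, so all `N` relations are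
  -- available. For `i = m` the last one is missing, but the coefficient of `E_0` vanishes by
  -- assumption.
  have hE : ∀ i, 1 ≤ i → i < 1 + m → ∀ r < N, (E r).coeff i = 0 := by
    intro i hi hi'
    refine eq_zero_of_sum_choose hNpos (fun r => (E r).coeff i) (fun j hj => ?_) ?_
    · refine hcoeff i j hi hi' ?_
      have : m * (j + 2) ≤ m * N := Nat.mul_le_mul_left m hj
      rw [mul_comm N]
      rw [mul_add] at this
      omega
    · by_cases him : i = m
      · left
        obtain ⟨i, rfl⟩ : ∃ i', i = i' + 1 := ⟨i - 1, by omega⟩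
        rw [hEsucc 0 hNpos, hzero i him, if_pos him, sub_self]
      · right
        refine hcoeff i (N - 1) hi hi' ?_
        have : m * N = m * (N - 1) + m := by
          rw [← Nat.mul_succ]
          congr
          omega
        rw [mul_comm N, this]
        omega
  suffices h : ∀ i s (hs : s < N), f (MvPolynomial.X (i, ⟨s, hs⟩)) = if i + 1 = m then w else 0 from
    fun x => h x.1 x.2 x.2.2
  intro i s hs
  by_cases hi : i + 1 < 1 + m
  · have := hE (i + 1) (by omega) hi s hs
    rwa [hEsucc s hs, sub_eq_zero] at this
  · rw [hbig _ (by simp; omega), if_neg (by omega)]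

end Reduction

/-! ### The image of `T` in `A` -/

section ImageInA

variable (k : Type*) [Field k] [CharP k 2] (n m : ℕ)

/-- The homomorphism `𝓡_n → A` underlying `mapF`. -/
def mapA : RRing n →+* ARing k n m :=
  MvPolynomial.eval₂Hom ((algebraMap (WittVector 2 k) (ARing k n m)).comp (zLocToWitt k))
    fun x : ℕ × Fin (2 ^ (n - 1)) => (gammaA k n m ^ x.2.1) (imageOfT k n m x.1)

lemma mapA_X (x : ℕ × Fin (2 ^ (n - 1))) :
    mapA k n m (MvPolynomial.X x) = (gammaA k n m ^ x.2.1) (imageOfT k n m x.1) :=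
  MvPolynomial.eval₂Hom_X' _ _ _

lemma mapA_X_of_lt (x : ℕ × Fin (2 ^ (n - 1))) (h : x.1 < m - 1) :
    mapA k n m (MvPolynomial.X x) = tA k n m ⟨x.1, h⟩ x.2 := by
  rw [mapA_X, imageOfT, dif_pos h, gammaA_pow_tA k n m _ _ x.2.2]

lemma mapA_X_of_eq (x : ℕ × Fin (2 ^ (n - 1))) (h : x.1 + 1 = m) :
    mapA k n m (MvPolynomial.X x) = (uA k n m x.2 : ARing k n m) ^ (2 ^ m - 1) := by
  rw [mapA_X, imageOfT, dif_neg (by omega), if_pos h, map_pow, gammaA_pow_uA k n m _ x.2.2]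

lemma mapA_X_of_gt (x : ℕ × Fin (2 ^ (n - 1))) (h : m < x.1 + 1) :
    mapA k n m (MvPolynomial.X x) = 0 := by
  rw [mapA_X, imageOfT, dif_neg (by omega), if_neg (by omega), map_zero]

lemma mapA_mem_gradA {a : RRing n} {d : ℤ}
    (ha : MvPolynomial.IsWeightedHomogeneous (weightR n) a d) : mapA k n m a ∈ gradA k n m d := by
  suffices h : ∀ x, (gammaA k n m ^ x.2.1) (imageOfT k n m x.1) ∈ gradA k n m (weightR n x) from
    eval₂Hom_mem_graded (A := ARing k n m) (gradA k n m) (w := weightR n)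
      (f := (algebraMap (WittVector 2 k) (ARing k n m)).comp (zLocToWitt k))
      (fun c => algebraMap_mem_gradA k n m _) h ha
  intro x
  rw [← mapA_X]
  rcases lt_trichotomy (x.1 + 1) m with h | h | h
  · rw [mapA_X_of_lt k n m x (by omega)]
    exact tA_mem_gradA k n m _ _
  · rw [mapA_X_of_eq k n m x h]
    have := SetLike.pow_mem_graded (2 ^ m - 1) (uA_mem_gradA k n m x.2)
    convert this using 1
    rw [weightR, h, nsmul_eq_mul, Nat.cast_sub Nat.one_le_two_pow, mul_comm]
    norm_num
  · rw [mapA_X_of_gt k n m x h]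
    exact zero_mem _

/-- The images of the variables of `𝓡_n` are congruent modulo `𝔪` to `u^(2^m-1)` or `0`. -/
lemma mapA_X_sub_mem_maxA (x : ℕ × Fin (2 ^ (n - 1))) :
    mapA k n m (MvPolynomial.X x) - (if x.1 + 1 = m then uA₀ k n m ^ (2 ^ m - 1) else 0) ∈
      maxA k n m := by
  rcases lt_trichotomy (x.1 + 1) m with h | h | h
  · rw [mapA_X_of_lt k n m x (by omega), if_neg h.ne, sub_zero]
    exact tA_mem_maxA k n m _ _
  · rw [mapA_X_of_eq k n m x h, if_pos h]
    exact Ideal.mem_of_dvd _ (sub_dvd_pow_sub_pow _ _ _) (uA_sub_mem_maxA k n m _)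
  · rw [mapA_X_of_gt k n m x h, if_neg h.ne', sub_zero]
    exact zero_mem _

/-- The image in `A` of the `i`-th coefficient of `T = T_(N-1) ⋯ T_0`. -/
def imageT (i : ℕ) : ARing k n m := mapA k n m ((twistProd n (2 ^ (n - 1))).coeff i)

variable {m}

/-- Modulo `𝔪` the images of the coefficients of `T` in degrees `0 < i < h` vanish, and the one in
degree `h` is a unit. -/
lemma imageT_reduction (hm : 1 ≤ m) :
    (∀ i, 0 < i → i < 2 ^ (n - 1) * m → imageT k n m i ∈ maxA k n m) ∧
      IsUnit (Ideal.Quotient.mk (maxA k n m) (imageT k n m (2 ^ (n - 1) * m))) := by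
  have h2 : (2 : ARing k n m ⧸ maxA k n m) = 0 := by
    rw [← map_ofNat (Ideal.Quotient.mk (maxA k n m)) 2]
    exact Ideal.Quotient.eq_zero_iff_mem.2 (two_mem_maxA k n m)
  have hw : IsUnit (Ideal.Quotient.mk (maxA k n m) (uA₀ k n m ^ (2 ^ m - 1))) :=
    ((uA k n m _).isUnit.pow _).map _
  have h := reduction_of_eq h2 ((Ideal.Quotient.mk (maxA k n m)).comp (mapA k n m)) hm hw
    fun x => by
      have := Ideal.Quotient.eq.2 (mapA_X_sub_mem_maxA k n m x)
      rw [RingHom.comp_apply, this]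
      split_ifs
      · rfl
      · exact map_zero _
  exact ⟨fun i hi hi' => Ideal.Quotient.eq_zero_iff_mem.1 (h.1 i hi hi'), h.2⟩

/-- The ideal of `A` generated by `2` and the images of the coefficients of `T` in degrees
`0 < i < h`. -/
def idealT (m h : ℕ) : Ideal (ARing k n m) := Ideal.span ({2} ∪ imageT k n m '' Set.Ico 1 h)

/-- The ideals `I_h` and `𝔪` of `A` agree modulo `𝔪²`. In `A / (I_h + 𝔪²)` the rigidity of the
images of the `γ^s t_i` gives `γ^s t_i = 0` for `i < m` and `(γ^s u)^(2^m-1) = u^(2^m-1)`. -/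
lemma maxA_le_sup (hm : 1 ≤ m) :
    maxA k n m ≤ idealT k n m (2 ^ (n - 1) * m) ⊔ maxA k n m ^ 2 := by
  set I := idealT k n m (2 ^ (n - 1) * m) ⊔ maxA k n m ^ 2 with hI
  set π := Ideal.Quotient.mk I
  have hπ : ∀ {x}, π x = 0 ↔ x ∈ I := Ideal.Quotient.eq_zero_iff_mem
  have h2I : (2 : ARing k n m) ∈ I := Ideal.mem_sup_left (Ideal.subset_span (Or.inl rfl))
  have h2 : (2 : ARing k n m ⧸ I) = 0 := by
    rw [← map_ofNat π 2]
    exact hπ.2 h2I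
  have hsq : ∀ x ∈ maxA k n m, π x ^ 2 = 0 := fun x hx => by
    rw [← map_pow]
    exact hπ.2 (Ideal.mem_sup_right (Ideal.pow_mem_pow hx 2))
  set w := π (uA₀ k n m ^ (2 ^ m - 1)) with hwdef
  have hw : IsUnit w := ((uA k n m _).isUnit.pow _).map _
  have hite : ∀ p : Prop, [Decidable p] →
      π (if p then uA₀ k n m ^ (2 ^ m - 1) else 0) = if p then w else 0 := by
    intro p _
    split_ifs
    · rfl
    · exact map_zero _
  have key := eq_of_reduction_eq_zero h2 (π.comp (mapA k n m)) hm hw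
    (fun x => by
      rw [RingHom.comp_apply, ← hite, ← map_sub]
      exact hsq _ (mapA_X_sub_mem_maxA k n m x))
    (fun x hx => by rw [RingHom.comp_apply, mapA_X_of_gt k n m x hx, map_zero])
    (fun i hi => by rw [RingHom.comp_apply, mapA_X_of_eq k n m (i, _) hi])
    (fun i hi hi' => hπ.2 (Ideal.mem_sup_left
      (Ideal.subset_span (Or.inr ⟨i, ⟨hi, hi'⟩, rfl⟩))))
  refine maxA_le k n m h2I (fun i r => ?_) fun r => ?_
  · have h := key (i.1, r)
    have hi := i.2
    rw [RingHom.comp_apply, mapA_X_of_lt k n m (i.1, r) hi, if_neg (by simp; omega)] at h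
    exact hπ.1 h
  · have h := key (m - 1, r)
    rw [RingHom.comp_apply, mapA_X_of_eq k n m (m - 1, r) (by simp; omega),
      if_pos (by simp; omega), hwdef, map_pow, map_pow] at h
    -- Since `(γ^r u - u)² = 0`, the powers with exponent `2^m` agree as well, and the quotient of
    -- the two equations is `γ^r u = u`.
    have h3 : π (uA k n m r) ^ 2 = π (uA₀ k n m) ^ 2 := by
      have := hsq _ (uA_sub_mem_maxA k n m r)
      rw [map_sub] at this
      linear_combination this + (π (uA₀ k n m) * π (uA k n m r) - π (uA₀ k n m) ^ 2) * h2
    have h4 : π (uA k n m r) ^ 2 ^ m = π (uA₀ k n m) ^ 2 ^ m := by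
      obtain ⟨m', rfl⟩ : ∃ m', m = m' + 1 := ⟨m - 1, by omega⟩
      rw [pow_succ', pow_mul, pow_mul, h3]
    have h5 : ∀ y : ARing k n m ⧸ I, y ^ 2 ^ m = y * y ^ (2 ^ m - 1) := fun y => by
      rw [← pow_succ', Nat.sub_add_cancel Nat.one_le_two_pow]
    rw [h5, h5, h] at h4
    have hw' : IsUnit (π (uA₀ k n m) ^ (2 ^ m - 1)) := by rwa [← map_pow]
    rw [← hπ, map_sub, hw'.mul_right_cancel h4, sub_self]

end ImageInA

/-! ### Completions along finitely generated ideals -/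

section Completion

variable {A : Type*} [CommRing A] {I : Ideal A}

lemma map_le_jacobson (hI : I.FG) :
    I.map (algebraMap A (AdicCompletion I A)) ≤ (⊥ : Ideal (AdicCompletion I A)).jacobson :=
  have := AdicCompletion.isAdicComplete_self I hI
  IsAdicComplete.le_jacobson_bot _

lemma mem_map_of_evalOneₐ_eq_zero (hI : I.FG) {x : AdicCompletion I A}
    (hx : AdicCompletion.evalOneₐ I x = 0) : x ∈ I.map (algebraMap A (AdicCompletion I A)) := by
  rw [← AdicCompletion.ker_evalOneₐ_eq_map I hI]
  exact hx

/-- An element of the completion is a unit if it is a unit modulo `I`. -/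
lemma isUnit_of_isUnit_evalOneₐ (hI : I.FG) {x : AdicCompletion I A}
    (hx : IsUnit (AdicCompletion.evalOneₐ I x)) : IsUnit x := by
  obtain ⟨y', hy'⟩ := hx.exists_right_inv
  obtain ⟨y, rfl⟩ := AdicCompletion.evalOneₐ_surjective I y'
  refine isUnit_of_mul_isUnit_left (y := y) (Ideal.isUnit_of_sub_one_mem_jacobson_bot _
    (map_le_jacobson hI (mem_map_of_evalOneₐ_eq_zero hI ?_)))
  rw [map_sub, map_mul, hy', map_one, sub_self]

/-- Nakayama's lemma in the completion. -/
lemma map_le_map_of_le_sup_sq (hI : I.FG) {I' : Ideal A} (h : I ≤ I' ⊔ I ^ 2) :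
    I.map (algebraMap A (AdicCompletion I A)) ≤ I'.map (algebraMap A (AdicCompletion I A)) := by
  refine Submodule.le_of_le_smul_of_le_jacobson_bot (hI.map _) (map_le_jacobson hI) ?_
  have := Ideal.map_mono (f := algebraMap A (AdicCompletion I A)) h
  rwa [Ideal.map_sup, sq, Ideal.map_mul] at this

lemma evalₐ_eq_of_le {i j : ℕ} (hij : i ≤ j) {x : AdicCompletion I A} {a : A}
    (h : AdicCompletion.evalₐ I j x = Ideal.Quotient.mk _ a) :
    AdicCompletion.evalₐ I i x = Ideal.Quotient.mk _ a := by
  induction x using AdicCompletion.induction_on with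
  | _ r =>
    rw [AdicCompletion.evalₐ_mk] at h ⊢
    refine (AdicCompletion.Ideal.mk_eq_mk I hij r).symm.trans ?_
    rw [Ideal.Quotient.eq] at h ⊢
    exact Ideal.pow_le_pow_right hij h

lemma pow_le_comap_pow (ρ : A →+* A) (hρ : I ≤ I.comap ρ) (i : ℕ) : I ^ i ≤ (I ^ i).comap ρ :=
  (Ideal.pow_right_mono hρ i).trans (Ideal.le_comap_pow ρ i)

/-- The ring homomorphism `lim A / I^i → A / I^i` induced by an endomorphism of `A` that
preserves `I`. -/
def completionMapAux (ρ : A →+* A) (hρ : I ≤ I.comap ρ) (i : ℕ) :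
    AdicCompletion I A →+* A ⧸ I ^ i :=
  (Ideal.quotientMap (I ^ i) ρ (pow_le_comap_pow ρ hρ i)).comp (AdicCompletion.evalₐ I i).toRingHom

lemma completionMapAux_apply (ρ : A →+* A) (hρ : I ≤ I.comap ρ) (i : ℕ) {x : AdicCompletion I A}
    {a : A} (hx : AdicCompletion.evalₐ I i x = Ideal.Quotient.mk _ a) :
    completionMapAux ρ hρ i x = Ideal.Quotient.mk _ (ρ a) :=
  (congrArg (Ideal.quotientMap (I ^ i) ρ (pow_le_comap_pow ρ hρ i)) hx).trans Ideal.quotientMap_mk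

lemma factorPow_comp_completionMapAux (ρ : A →+* A) (hρ : I ≤ I.comap ρ) {i j : ℕ} (hij : i ≤ j) :
    (Ideal.Quotient.factorPow I hij).comp (completionMapAux ρ hρ j) = completionMapAux ρ hρ i := by
  ext x
  obtain ⟨a, ha⟩ := Ideal.Quotient.mk_surjective (AdicCompletion.evalₐ I j x)
  rw [RingHom.comp_apply, completionMapAux_apply ρ hρ j ha.symm,
    completionMapAux_apply ρ hρ i (evalₐ_eq_of_le hij ha.symm)]
  rfl

/-- The endomorphism of the completion induced by an endomorphism that preserves `I`. -/
def completionMap (ρ : A →+* A) (hρ : I ≤ I.comap ρ) :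
    AdicCompletion I A →+* AdicCompletion I A :=
  AdicCompletion.liftRingHom I (completionMapAux ρ hρ) (factorPow_comp_completionMapAux ρ hρ)

lemma evalₐ_completionMap (ρ : A →+* A) (hρ : I ≤ I.comap ρ) (i : ℕ) {x : AdicCompletion I A}
    {a : A} (hx : AdicCompletion.evalₐ I i x = Ideal.Quotient.mk _ a) :
    AdicCompletion.evalₐ I i (completionMap ρ hρ x) = Ideal.Quotient.mk _ (ρ a) := by
  rw [completionMap, AdicCompletion.evalₐ_liftRingHom, completionMapAux_apply ρ hρ i hx]

lemma completionMap_algebraMap (ρ : A →+* A) (hρ : I ≤ I.comap ρ) (a : A) :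
    completionMap ρ hρ (algebraMap A (AdicCompletion I A) a) =
      algebraMap A (AdicCompletion I A) (ρ a) :=
  AdicCompletion.ext_evalₐ fun i =>
    (evalₐ_completionMap ρ hρ i (AdicCompletion.evalₐ_of I i a)).trans
      (AdicCompletion.evalₐ_of I i _).symm

end Completion

/-! ### The ring `R(k, m)` -/

section RingRkm

variable (k : Type*) [Field k] (n m : ℕ)

/-- The ideal of `A` at which the completion is taken; it is equal to `𝔪`. -/
abbrev zeroPartA : Ideal (ARing k n m) := zeroPartIdeal (gradA k n m) (maxA k n m)

/-- The canonical map `A → R(k, m)`. -/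
abbrev toRkm : ARing k n m →+* Rkm k n m := toGradedCompletion (gradA k n m) (maxA k n m)

lemma zeroPartA_eq : zeroPartA k n m = maxA k n m := zeroPartIdeal_maxA k n m

lemma map_zeroPartA : (zeroPartA k n m).map (toRkm k n m) = maxR k n m :=
  congrArg (Ideal.map _) (zeroPartA_eq k n m)

lemma zeroPartA_fg : (zeroPartA k n m).FG := by
  rw [zeroPartA_eq]
  exact maxA_fg k n m

lemma normalize_of_mem_zero {a : ARing k n m} (ha : a ∈ gradA k n m 0) :
    normalize k n m a = a := by
  rw [normalize_apply k n m (d := 0) ha, neg_zero, uPow_zero, Units.val_one, mul_one]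

lemma normalize_mem_zero (a : ARing k n m) : normalize k n m a ∈ gradA k n m 0 := by
  induction a using AddMonoidAlgebra.induction_linear with
  | zero => rw [map_zero]; exact zero_mem _
  | add a b ha hb => rw [map_add]; exact add_mem ha hb
  | single e w =>
    have h : AddMonoidAlgebra.single e w ∈ gradA k n m (2 * halfDegree n m e) := by
      rw [← expoDegree_eq]
      exact AddMonoidAlgebra.single_mem_gradeBy _ _ _
    rw [normalize_apply k n m h]
    exact mul_uPow_mem_gradA k n m h

lemma zeroPartA_le_comap_normalize :
    zeroPartA k n m ≤ (zeroPartA k n m).comap (normalize k n m) :=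
  Ideal.span_le.2 fun x hx => by
    change normalize k n m x ∈ zeroPartA k n m
    rw [normalize_of_mem_zero k n m hx.2]
    exact Ideal.subset_span hx

/-- The extension `Â → R(k, m)` of `normalize` to the completion `Â = lim A / 𝔪^i`. Since it fixes
the elements of degree `0`, it allows to descend statements from `Â` to `R(k, m)`. -/
def normalizeHat : AdicCompletion (zeroPartA k n m) (ARing k n m) →+* Rkm k n m :=
  (completionMap (normalize k n m) (zeroPartA_le_comap_normalize k n m)).codRestrict _ fun x =>
    Subring.subset_closure (Set.mem_iUnion.2 ⟨0, fun i => by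
      obtain ⟨a, ha⟩ := Ideal.Quotient.mk_surjective
        (AdicCompletion.evalₐ (zeroPartA k n m) i x)
      exact ⟨_, normalize_mem_zero k n m a, evalₐ_completionMap _ _ i ha.symm⟩⟩)

lemma coe_normalizeHat (x : AdicCompletion (zeroPartA k n m) (ARing k n m)) :
    (normalizeHat k n m x : AdicCompletion (zeroPartA k n m) (ARing k n m)) =
      completionMap (normalize k n m) (zeroPartA_le_comap_normalize k n m) x := rfl

lemma normalizeHat_algebraMap (a : ARing k n m) :
    normalizeHat k n m (algebraMap _ _ a) = toRkm k n m (normalize k n m a) :=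
  Subtype.ext (completionMap_algebraMap _ _ a)

lemma normalizeHat_coe_of_mem {x : Rkm k n m} {d : ℤ}
    (hx : (x : AdicCompletion (zeroPartA k n m) (ARing k n m)) ∈
      completedPiece (gradA k n m) (maxA k n m) (2 * d)) :
    normalizeHat k n m x = x * toRkm k n m (uPow k n m (-d)) := by
  refine Subtype.ext (AdicCompletion.ext_evalₐ fun i => ?_)
  obtain ⟨a, ha, hax⟩ := hx i
  have h1 := evalₐ_completionMap (normalize k n m) (zeroPartA_le_comap_normalize k n m) i hax
  rw [normalize_apply k n m ha] at h1
  refine h1.trans ?_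
  have h2 : AdicCompletion.evalₐ (zeroPartA k n m) i
      (toRkm k n m (uPow k n m (-d)) : AdicCompletion (zeroPartA k n m) (ARing k n m)) =
      Ideal.Quotient.mk _ (uPow k n m (-d) : ARing k n m) := AdicCompletion.evalₐ_of _ i _
  rw [Subring.coe_mul, map_mul, map_mul, h2]
  exact congrArg (· * _) hax.symm

lemma toRkm_mem_completedPiece {a : ARing k n m} {s : ℤ} (ha : a ∈ gradA k n m s) :
    (toRkm k n m a : AdicCompletion (zeroPartA k n m) (ARing k n m)) ∈
      completedPiece (gradA k n m) (maxA k n m) s :=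
  fun i => ⟨a, ha, AdicCompletion.evalₐ_of _ i _⟩

lemma isUnit_toRkm_uPow (d : ℤ) : IsUnit (toRkm k n m (uPow k n m d)) :=
  (uPow k n m d).isUnit.map _

/-- Membership in ideals generated by homogeneous elements descends from `Â` to `R(k, m)`. -/
lemma normalizeHat_mem_map {I : Ideal (ARing k n m)} (hI : I ≤ I.comap (normalize k n m))
    {x : AdicCompletion (zeroPartA k n m) (ARing k n m)}
    (hx : x ∈ I.map (algebraMap (ARing k n m) _)) :
    normalizeHat k n m x ∈ I.map (toRkm k n m) := by
  have h1 := Ideal.mem_map_of_mem (normalizeHat k n m) hx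
  rw [Ideal.map_map] at h1
  refine Ideal.map_le_iff_le_comap.2 ?_ h1
  intro a ha
  change normalizeHat k n m (algebraMap _ _ a) ∈ I.map (toRkm k n m)
  rw [normalizeHat_algebraMap]
  exact Ideal.mem_map_of_mem _ (hI ha)

lemma isUnit_normalizeHat {x : AdicCompletion (zeroPartA k n m) (ARing k n m)}
    (hx : IsUnit (AdicCompletion.evalOneₐ (zeroPartA k n m) x)) : IsUnit (normalizeHat k n m x) :=
  (isUnit_of_isUnit_evalOneₐ (zeroPartA_fg k n m) hx).map _

lemma isHomogeneousIdeal_maxR :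
    IsHomogeneousIdeal (gradA k n m) (maxA k n m) (maxR k n m) := by
  refine ⟨toRkm k n m '' ((maxA k n m : Set (ARing k n m)) ∩ gradA k n m 0), ?_, ?_⟩
  · rintro _ ⟨a, ha, rfl⟩
    exact ⟨0, toRkm_mem_completedPiece k n m ha.2⟩
  · rw [← Ideal.map_span]
    exact map_zeroPartA k n m

lemma maxR_ne_top [CharP k 2] : maxR k n m ≠ ⊤ := by
  let f : Rkm k n m →+* ARing k n m ⧸ zeroPartA k n m :=
    (AdicCompletion.evalOneₐ (zeroPartA k n m)).toRingHom.comp (Subring.subtype _)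
  have hf : ∀ a, f (toRkm k n m a) = Ideal.Quotient.mk _ a := fun a =>
    AdicCompletion.evalOneₐ_of _ _
  have h : maxR k n m ≤ RingHom.ker f := by
    refine Ideal.map_le_iff_le_comap.2 fun a ha => ?_
    rw [Ideal.mem_comap, RingHom.mem_ker, hf, Ideal.Quotient.eq_zero_iff_mem, zeroPartA_eq]
    exact ha
  have : Nontrivial (ARing k n m ⧸ zeroPartA k n m) :=
    Ideal.Quotient.nontrivial_iff.2 (by rw [zeroPartA_eq]; exact maxA_ne_top k n m)
  exact fun h1 => RingHom.ker_ne_top f (top_le_iff.1 (h1 ▸ h))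

/-- A homogeneous element of `R(k, m)` lies in `𝔪` or is a unit, because the ring of elements of
degree `0` in `A / 𝔪` is the residue field of `W(k)`. -/
lemma mem_maxR_or_isUnit [Finite k] [CharP k 2] {x : Rkm k n m} {s : ℤ}
    (hx : (x : AdicCompletion (zeroPartA k n m) (ARing k n m)) ∈
      completedPiece (gradA k n m) (maxA k n m) s) : x ∈ maxR k n m ∨ IsUnit x := by
  by_cases hs : ∃ d, s = 2 * d
  · obtain ⟨d, rfl⟩ := hs
    -- Multiplication by a power of `u` reduces to the case of degree `0`.
    set y := x * toRkm k n m (uPow k n m (-d))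
    have hxy : normalizeHat k n m x = y := normalizeHat_coe_of_mem k n m hx
    obtain ⟨a, ha, hax⟩ : ∃ a ∈ gradA k n m 0,
        AdicCompletion.evalₐ (zeroPartA k n m) 1 y = Ideal.Quotient.mk _ a := by
      obtain ⟨a, ha, hax⟩ := hx 1
      refine ⟨_, normalize_mem_zero k n m a, ?_⟩
      rw [← hxy, coe_normalizeHat, evalₐ_completionMap _ _ 1 hax]
    have hyy : normalizeHat k n m y = y := by
      have hy0 : (y : AdicCompletion (zeroPartA k n m) (ARing k n m)) ∈
          completedPiece (gradA k n m) (maxA k n m) (2 * 0) := by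
        rw [← hxy]
        intro i
        obtain ⟨b, hb⟩ := Ideal.Quotient.mk_surjective
          (AdicCompletion.evalₐ (zeroPartA k n m) i x)
        exact ⟨_, normalize_mem_zero k n m b, evalₐ_completionMap _ _ i hb.symm⟩
      rw [normalizeHat_coe_of_mem k n m hy0, neg_zero, uPow_zero, Units.val_one, map_one, mul_one]
    have hey : AdicCompletion.evalOneₐ (zeroPartA k n m) y = Ideal.Quotient.mk _ a := by
      rw [← AdicCompletion.factorₐ_evalₐ_one, hax]
      rfl
    obtain ⟨w, hw⟩ := exists_sub_algebraMap_mem_maxA k n m ha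
    rw [← zeroPartA_eq, ← Ideal.Quotient.eq] at hw
    rw [hw] at hey
    have hu := isUnit_toRkm_uPow k n m (-d)
    by_cases hw0 : w.coeff 0 = 0
    · left
      have : PerfectRing k 2 := PerfectRing.ofFiniteOfIsReduced 2 k
      obtain ⟨w', rfl⟩ := Ideal.mem_span_singleton.1
        ((WittVector.mem_span_p_iff_coeff_zero_eq_zero w).2 hw0)
      have h0 : AdicCompletion.evalOneₐ (zeroPartA k n m) y = 0 := by
        rw [hey, Ideal.Quotient.eq_zero_iff_mem, zeroPartA_eq, map_mul, Nat.cast_ofNat,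
          map_ofNat]
        exact Ideal.mul_mem_right _ _ (two_mem_maxA k n m)
      have h1 := normalizeHat_mem_map k n m (zeroPartA_le_comap_normalize k n m)
        (mem_map_of_evalOneₐ_eq_zero (zeroPartA_fg k n m) h0)
      rw [hyy, map_zeroPartA] at h1
      exact (Ideal.mul_unit_mem_iff_mem _ hu).1 h1
    · right
      have hwu : IsUnit (AdicCompletion.evalOneₐ (zeroPartA k n m) y) := by
        rw [hey]
        exact ((WittVector.isUnit_of_coeff_zero_ne_zero w hw0).map _).map _
      have h1 := isUnit_normalizeHat k n m hwu
      rw [hyy] at h1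
      exact isUnit_of_mul_isUnit_left h1
  · left
    have : x = 0 := by
      refine Subtype.ext (AdicCompletion.ext_evalₐ fun i => ?_)
      obtain ⟨a, ha, hax⟩ := hx i
      rw [hax, (exists_eq_two_mul_or_eq_zero k n m ha).resolve_left hs]
      simp
    rw [this]
    exact zero_mem _

theorem isGreatest_maxR [Finite k] [CharP k 2] :
    IsGreatest {𝔞 : Ideal (Rkm k n m) | 𝔞 ≠ ⊤ ∧
      IsHomogeneousIdeal (gradA k n m) (maxA k n m) 𝔞} (maxR k n m) := by
  refine ⟨⟨maxR_ne_top k n m, isHomogeneousIdeal_maxR k n m⟩, ?_⟩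
  rintro _ ⟨hne, T, hT, rfl⟩
  refine Ideal.span_le.2 fun x hx => ?_
  obtain ⟨s, hs⟩ := hT x hx
  exact (mem_maxR_or_isUnit k n m hs).resolve_right fun h =>
    hne (Ideal.eq_top_of_isUnit_mem _ (Ideal.subset_span hx) h)

variable [CharP k 2] {m}

/-- The statement about Araki elements in `R(k, m)`, for a sequence `v` of elements of `𝓡_n` with
the degrees of the Araki elements and the same reductions as the coefficients of `T`. -/
theorem idealI_eq_maxR_and_isUnit (hm : 1 ≤ m) {v : ℕ → RRing n}
    (hdeg : ∀ i, MvPolynomial.IsWeightedHomogeneous (weightR n) (v i) (2 * (2 ^ i - 1)))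
    (hspan : ∀ i, Ideal.span ({2} ∪ v '' Set.Ico 1 i) =
      Ideal.span ({2} ∪ (twistProd n (2 ^ (n - 1))).coeff '' Set.Ico 1 i))
    (hcongr : ∀ i, 0 < i → v i - (twistProd n (2 ^ (n - 1))).coeff i ∈
      Ideal.span ({2} ∪ (twistProd n (2 ^ (n - 1))).coeff '' Set.Ico 1 i)) :
    idealI k n m v (2 ^ (n - 1) * m) = maxR k n m ∧
      IsUnit (mapF k n m (v (2 ^ (n - 1) * m))) := by
  set h := 2 ^ (n - 1) * m with hh
  have hmapT : (Ideal.span ({2} ∪ (twistProd n (2 ^ (n - 1))).coeff '' Set.Ico 1 h)).map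
      (mapA k n m) = idealT k n m h := by
    rw [Ideal.map_span, Set.image_union, Set.image_singleton, map_ofNat, Set.image_image]
    rfl
  have hmapv : idealT k n m h = Ideal.span ({2} ∪ (fun i => mapA k n m (v i)) '' Set.Ico 1 h) := by
    rw [← hmapT, ← hspan, Ideal.map_span, Set.image_union, Set.image_singleton, map_ofNat,
      Set.image_image]
  have hidealI : idealI k n m v h = (idealT k n m h).map (toRkm k n m) := by
    rw [hmapv, Ideal.map_span, Set.image_union, Set.image_singleton, map_ofNat, Set.image_image,
      idealI]
    congr 2
    ext x
    constructor
    · rintro ⟨i, hi, hi', rfl⟩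
      exact ⟨i, ⟨hi, hi'⟩, rfl⟩
    · rintro ⟨i, ⟨hi, hi'⟩, rfl⟩
      exact ⟨i, hi, hi', rfl⟩
  obtain ⟨hlow, hunit⟩ := imageT_reduction k n hm
  have hle : idealT k n m h ≤ maxA k n m := by
    refine Ideal.span_le.2 ?_
    rintro x (rfl | ⟨i, ⟨hi, hi'⟩, rfl⟩)
    · exact two_mem_maxA k n m
    · exact hlow i hi hi'
  -- As the `v_i` are homogeneous, `normalize` multiplies them by units.
  have hhom : idealT k n m h ≤ (idealT k n m h).comap (normalize k n m) := by
    conv_lhs => rw [hmapv]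
    refine Ideal.span_le.2 ?_
    rintro x (rfl | ⟨i, hi, rfl⟩)
    · change normalize k n m 2 ∈ idealT k n m h
      rw [map_ofNat]
      exact Ideal.subset_span (Or.inl rfl)
    · change normalize k n m (mapA k n m (v i)) ∈ idealT k n m h
      rw [normalize_apply k n m (mapA_mem_gradA k n m (hdeg i)), hmapv]
      exact Ideal.mul_mem_right _ _ (Ideal.subset_span (Or.inr ⟨i, hi, rfl⟩))
  constructor
  · rw [hidealI]
    refine le_antisymm (Ideal.map_mono hle) ?_
    have h1 := map_le_map_of_le_sup_sq (I := zeroPartA k n m) (zeroPartA_fg k n m)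
      (I' := idealT k n m h) (by rw [zeroPartA_eq]; exact maxA_le_sup k n hm)
    rw [← map_zeroPartA]
    refine Ideal.map_le_iff_le_comap.2 (Ideal.span_le.2 fun x hx => ?_)
    have h2 := normalizeHat_mem_map k n m hhom (h1 (Ideal.mem_map_of_mem _ (Ideal.subset_span hx)))
    rwa [normalizeHat_algebraMap, normalize_of_mem_zero k n m hx.2] at h2
  · have hpos : 0 < h := by positivity
    have h1 := Ideal.mem_map_of_mem (mapA k n m) (hcongr h hpos)
    rw [hmapT, map_sub] at h1
    have h3 := hle h1
    rw [← Ideal.Quotient.eq] at h3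
    have h4 : IsUnit (Ideal.Quotient.mk (maxA k n m) (mapA k n m (v h))) := by
      rw [h3]
      exact hunit
    rw [← zeroPartA_eq] at h4
    have h5 := isUnit_normalizeHat k n m
      (x := algebraMap _ _ (mapA k n m (v h))) h4
    rw [normalizeHat_algebraMap, normalize_apply k n m (mapA_mem_gradA k n m (hdeg h)),
      map_mul] at h5
    exact isUnit_of_mul_isUnit_left h5

end RingRkm

end

end RealLubinTate

theorem mainTheorem2 (k : Type*) [Field k] [Finite k] [CharP k 2] (n m : ℕ)
    (hn : 1 ≤ n) (hm : 1 ≤ m) :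
    (∃! F : FormalGroup (RealLubinTate.RRing n), RealLubinTate.IsCanonicalFormalGroup n F) ∧
    (∀ F : FormalGroup (RealLubinTate.RRing n), RealLubinTate.IsCanonicalFormalGroup n F →
      (∃! v : ℕ → RealLubinTate.RRing n, RealLubinTate.IsArakiSequence F v) ∧
      ∀ v : ℕ → RealLubinTate.RRing n, RealLubinTate.IsArakiSequence F v →
        RealLubinTate.idealI k n m v (2 ^ (n - 1) * m) = RealLubinTate.maxR k n m ∧
        IsUnit (RealLubinTate.mapF k n m (v (2 ^ (n - 1) * m)))) ∧
    IsGreatest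
      {𝔞 : Ideal (RealLubinTate.Rkm k n m) | 𝔞 ≠ ⊤ ∧
        RealLubinTate.IsHomogeneousIdeal
          (RealLubinTate.gradA k n m) (RealLubinTate.maxA k n m) 𝔞}
      (RealLubinTate.maxR k n m) := by
  refine ⟨RealLubinTate.existsUnique_isCanonicalFormalGroup n, fun F hF => ?_,
    RealLubinTate.isGreatest_maxR k n m⟩
  obtain ⟨hu, hv⟩ := RealLubinTate.exists_araki_congr hF
  refine ⟨hu, fun v hva => ?_⟩
  obtain ⟨h1, h2, h3⟩ := hv v hva
  exact RealLubinTate.idealI_eq_maxR_and_isUnit k n hm h1 h2 h3
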